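/- \textbf{Theorem.} An instance of the two-stage robust multi-representative selection problem with alternative continuous budgeted uncertainty (2MRS-AC) consists of $n$ items that are partitioned into sets $[n]=T_1\cup\dots\cup T_m$, integers $p_j\in\{1,\dots,|T_j|\}$ for $j\in[m]$, and non-negative rational numbers $C_i,\underline c_i,d_i$ ($i\in[n]$) and $\Gamma$. Let \[X=\Big\{x\in\{0,1\}^n:\ \sum_{i\in T_j}x_i=p_j\ \forall j\in[m]\Big\},\qquad Y(x)=\{y\in\{0,1\}^n: x+y\in X\},\qquad X'=\{x\in\{0,1\}^n: Y(x)\neq\emptyset\},\] \[U^{AC}=\Big\{c\in\mathbb R^n:\ \exists\,\delta\in\prod_{i=1}^n[0,d_i]\text{ with } c_i=\underline c_i+\delta_i\ \forall i\in[n]\ \text{and}\ \sum_{i=1}^n\delta_i\le\Gamma\Big\}.\] The problem is to solve \[\min_{x\in X'}\Big(\sum_{i=1}^n C_ix_i+\max_{c\in U^{AC}}\ \min_{y\in Y(x)}\ \sum_{i=1}^n c_iy_i\Big).\tag{1}\] There is an algorithm that solves (2MRS-AC) in time polynomial in the bit length of the instance (time being measured on a random access machine with logarithmic cost). For every instance it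 outputs the optimal value $v$ of (1) and an optimal first-stage solution $x$ of (1), together with rational $y,\pi,\rho$ such that $(x,y,\pi,\rho)$ is an optimal solution, again with value $v$, of the mixed-integer program \begin{align*} \min\ & \sum_{i=1}^n C_ix_i+\sum_{i=1}^n\underline c_iy_i+\Gamma\pi+\sum_{i=1}^n d_i\rho_i\\ \text{s.t.}\ & \sum_{i\in T_j}(x_i+y_i)=p_j\quad\forall j\in[m],\qquad x_i+y_i\le1,\quad \pi+\rho_i\ge y_i\quad\forall i\in[n],\\ & x\in\{0,1\}^n,\ y\in[0,1]^n,\ \pi\in\mathbb R_{\ge0},\ \rho\in\mathbb R_{\ge0}^n . \end{align*} -/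

import Mathlib

/-! ## The machine model: a random access machine with logarithmic cost

Memory consists of banks (numbered by naturals) of integer-indexed cells that hold integers.
A program is finite, hence it uses finitely many banks.  The time of a run counts, for every
operation, the bit lengths of all the integers that the operation handles. -/

namespace RAM

/-- `s b a` is the content of cell `a` of bank `b`. -/
abbrev Memory := ℕ → ℤ → ℤ

/-- Length of the binary representation of an integer, with one extra bit for the sign. -/
def bits (z : ℤ) : ℕ := z.natAbs.size + 1

/-- Arithmetic expressions; `load b e` reads the cell of bank `b` whose address is the value
of `e`. -/
inductive Expr : Type
  | const (z : ℤ) : Expr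
  | load (b : ℕ) (e : Expr) : Expr
  | add (e₁ e₂ : Expr) : Expr
  | sub (e₁ e₂ : Expr) : Expr
  | mul (e₁ e₂ : Expr) : Expr

namespace Expr

/-- Value of an expression. -/
def eval (s : Memory) : Expr → ℤ
  | const z => z
  | load b e => s b (e.eval s)
  | add e₁ e₂ => e₁.eval s + e₂.eval s
  | sub e₁ e₂ => e₁.eval s - e₂.eval s
  | mul e₁ e₂ => e₁.eval s * e₂.eval s

/-- Time to evaluate an expression: the total bit length of the values of all its
subexpressions (in particular of all operands, addresses and results). -/
def cost (s : Memory) : Expr → ℕ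
  | const z => bits z
  | load b e => e.cost s + bits (s b (e.eval s))
  | add e₁ e₂ => e₁.cost s + e₂.cost s + bits (e₁.eval s + e₂.eval s)
  | sub e₁ e₂ => e₁.cost s + e₂.cost s + bits (e₁.eval s - e₂.eval s)
  | mul e₁ e₂ => e₁.cost s + e₂.cost s + bits (e₁.eval s * e₂.eval s)

end Expr

/-- Programs. `store b e₁ e₂` writes the value of `e₂` to the cell of bank `b` whose address is
the value of `e₁`; the guard `e` of a branching or of a loop holds if the value of `e` is
positive. -/
inductive Cmd : Type
  | skip : Cmd
  | store (b : ℕ) (e₁ e₂ : Expr) : Cmd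
  | seq (c₁ c₂ : Cmd) : Cmd
  | ite (e : Expr) (c₁ c₂ : Cmd) : Cmd
  | loop (e : Expr) (c : Cmd) : Cmd

/-- Memory after writing `v` to cell `a` of bank `b`. -/
def write (s : Memory) (b : ℕ) (a v : ℤ) : Memory :=
  fun b' a' => if b' = b ∧ a' = a then v else s b' a'

/-- `Exec c s s' t`: started with memory `s`, the program `c` halts after time `t` with
memory `s'`. -/
inductive Exec : Cmd → Memory → Memory → ℕ → Prop
  | skip (s : Memory) : Exec .skip s s 1
  | store (s : Memory) (b : ℕ) (e₁ e₂ : Expr) :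
      Exec (.store b e₁ e₂) s (write s b (e₁.eval s) (e₂.eval s)) (e₁.cost s + e₂.cost s + 1)
  | seq {c₁ c₂ : Cmd} {s s' s'' : Memory} {t₁ t₂ : ℕ} :
      Exec c₁ s s' t₁ → Exec c₂ s' s'' t₂ → Exec (.seq c₁ c₂) s s'' (t₁ + t₂ + 1)
  | ite_pos {e : Expr} {c₁ c₂ : Cmd} {s s' : Memory} {t : ℕ} :
      0 < e.eval s → Exec c₁ s s' t → Exec (.ite e c₁ c₂) s s' (e.cost s + t + 1)
  | ite_neg {e : Expr} {c₁ c₂ : Cmd} {s s' : Memory} {t : ℕ} :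
      ¬ 0 < e.eval s → Exec c₂ s s' t → Exec (.ite e c₁ c₂) s s' (e.cost s + t + 1)
  | loop_pos {e : Expr} {c : Cmd} {s s' s'' : Memory} {t₁ t₂ : ℕ} :
      0 < e.eval s → Exec c s s' t₁ → Exec (.loop e c) s' s'' t₂ →
      Exec (.loop e c) s s'' (e.cost s + t₁ + t₂ + 1)
  | loop_neg {e : Expr} {c : Cmd} {s : Memory} :
      ¬ 0 < e.eval s → Exec (.loop e c) s s (e.cost s + 1)

/-- Initial memory for an input word `w`: bank `0` holds `w` in the cells `0, 1, 2, …`, and all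
other cells are zero. -/
def initial (w : List ℤ) : Memory :=
  fun b a => if b = 0 ∧ 0 ≤ a then w.getD a.toNat 0 else 0

/-- Bit length of an input word. -/
def inputSize (w : List ℤ) : ℕ := (w.map bits).sum

end RAM

/-! ## Two-stage robust multi-representative selection -/

namespace MultiRepSel

/-- An instance: `n` items, of which item `i` belongs to the part `T_j` with `j = part i`
(`j ∈ [m]`), numbers `p_j ∈ {1, …, |T_j|}`, first-stage costs `C`, lower second-stage costs
`c`, maximal deviations `d`, and the budget `Γ`; all numbers are rational. -/
structure Instance where
  n : ℕ
  m : ℕ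
  part : Fin n → Fin m
  p : Fin m → ℕ
  C : Fin n → ℚ
  c : Fin n → ℚ
  d : Fin n → ℚ
  Γ : ℚ
  one_le_p : ∀ j, 1 ≤ p j
  p_le : ∀ j, p j ≤ (Finset.univ.filter fun i => part i = j).card
  C_nonneg : ∀ i, 0 ≤ C i
  c_nonneg : ∀ i, 0 ≤ c i
  d_nonneg : ∀ i, 0 ≤ d i
  Γ_nonneg : 0 ≤ Γ

namespace Instance

variable (I : Instance)

/-- The items of part `T_j`. -/
def T (j : Fin I.m) : Finset (Fin I.n) := Finset.univ.filter fun i => I.part i = j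

/-- The nominal feasible set `X ⊆ {0,1}ⁿ`: exactly `p_j` items from each part `T_j`. -/
def X : Set (Fin I.n → ℝ) :=
  {x | (∀ i, x i = 0 ∨ x i = 1) ∧ ∀ j, ∑ i ∈ I.T j, x i = I.p j}

/-- Second-stage solutions `Y(x) = {y ∈ {0,1}ⁿ : x + y ∈ X}`. -/
def Y (x : Fin I.n → ℝ) : Set (Fin I.n → ℝ) :=
  {y | (∀ i, y i = 0 ∨ y i = 1) ∧ x + y ∈ I.X}

/-- First-stage solutions `X' = {x ∈ {0,1}ⁿ : Y(x) ≠ ∅}`. -/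
def X' : Set (Fin I.n → ℝ) :=
  {x | (∀ i, x i = 0 ∨ x i = 1) ∧ (I.Y x).Nonempty}

/-- The alternative continuous budgeted uncertainty set. -/
def UAC : Set (Fin I.n → ℝ) :=
  {c | ∃ δ : Fin I.n → ℝ, (∀ i, 0 ≤ δ i ∧ δ i ≤ I.d i) ∧ (∀ i, c i = I.c i + δ i) ∧
    ∑ i, δ i ≤ I.Γ}

/-- `v = min_{y ∈ Y(x)} ∑ i, c_i y_i`. -/
def IsSecondStageValue (x c : Fin I.n → ℝ) (v : ℝ) : Prop :=
  IsLeast ((fun y => ∑ i, c i * y i) '' I.Y x) v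

/-- `v = ∑ i, C_i x_i + max_{c ∈ U} min_{y ∈ Y(x)} ∑ i, c_i y_i`. -/
def IsRobustValue (U : Set (Fin I.n → ℝ)) (x : Fin I.n → ℝ) (v : ℝ) : Prop :=
  ∃ w, IsGreatest {u | ∃ c ∈ U, I.IsSecondStageValue x c u} w ∧
    v = ∑ i, (I.C i : ℝ) * x i + w

/-- `x` is an optimal solution, and `v` the optimal value, of
`min_{x ∈ X'} (∑ i, C_i x_i + max_{c ∈ U} min_{y ∈ Y(x)} ∑ i, c_i y_i)`. -/
def IsTwoStageOptimal (U : Set (Fin I.n → ℝ)) (x : Fin I.n → ℝ) (v : ℝ) : Prop :=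
  x ∈ I.X' ∧ I.IsRobustValue U x v ∧
    ∀ x' ∈ I.X', ∃ v', I.IsRobustValue U x' v' ∧ v ≤ v'

/-- Feasible solutions of the mixed-integer program for alternative continuous budgeted
uncertainty. -/
structure IsMIPFeasible (x y : Fin I.n → ℝ) (π : ℝ) (ρ : Fin I.n → ℝ) : Prop where
  sum_eq : ∀ j, ∑ i ∈ I.T j, (x i + y i) = I.p j
  add_le : ∀ i, x i + y i ≤ 1
  le_dual : ∀ i, y i ≤ π + ρ i
  x_binary : ∀ i, x i = 0 ∨ x i = 1
  y_mem : ∀ i, 0 ≤ y i ∧ y i ≤ 1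
  π_nonneg : 0 ≤ π
  ρ_nonneg : ∀ i, 0 ≤ ρ i

/-- Objective function of the mixed-integer program. -/
def mipObjective (x y : Fin I.n → ℝ) (π : ℝ) (ρ : Fin I.n → ℝ) : ℝ :=
  ∑ i, (I.C i : ℝ) * x i + ∑ i, (I.c i : ℝ) * y i + I.Γ * π + ∑ i, (I.d i : ℝ) * ρ i

/-- `(x, y, π, ρ)` is an optimal solution, and `v` the optimal value, of the mixed-integer
program. -/
def IsMIPOptimal (x y : Fin I.n → ℝ) (π : ℝ) (ρ : Fin I.n → ℝ) (v : ℝ) : Prop :=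
  I.IsMIPFeasible x y π ρ ∧ v = I.mipObjective x y π ρ ∧
    ∀ x' y' π' ρ', I.IsMIPFeasible x' y' π' ρ' → v ≤ I.mipObjective x' y' π' ρ'

/-- The input word of an instance; indices of parts start at `0`, and a rational number is given
by its numerator and its denominator in lowest terms. -/
def encode : List ℤ :=
  [(I.n : ℤ), (I.m : ℤ), I.Γ.num, (I.Γ.den : ℤ)] ++
  List.ofFn (fun i => ((I.part i : ℕ) : ℤ)) ++
  List.ofFn (fun j => (I.p j : ℤ)) ++
  List.ofFn (fun i => (I.C i).num) ++ List.ofFn (fun i => ((I.C i).den : ℤ)) ++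
  List.ofFn (fun i => (I.c i).num) ++ List.ofFn (fun i => ((I.c i).den : ℤ)) ++
  List.ofFn (fun i => (I.d i).num) ++ List.ofFn (fun i => ((I.d i).den : ℤ))

end Instance

/-- Cells `a` and `a + 1` of bank `1` hold a numerator and a positive denominator of `q`. -/
def HoldsFraction (s : RAM.Memory) (a : ℤ) (q : ℝ) : Prop :=
  0 < s 1 (a + 1) ∧ q = (s 1 a : ℝ) / (s 1 (a + 1) : ℝ)

/-- The output in bank `1`: the value `v` in the cells `0, 1`, the number `π` in the cells `2, 3`,
and for each item `i` the five cells from `4 + 5 i` on hold `x_i`, the fraction `y_i`, and the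
fraction `ρ_i`. -/
structure IsOutput {n : ℕ} (s : RAM.Memory) (x y : Fin n → ℝ) (π : ℝ) (ρ : Fin n → ℝ)
    (v : ℝ) : Prop where
  value : HoldsFraction s 0 v
  dual : HoldsFraction s 2 π
  x_eq : ∀ i : Fin n, x i = (s 1 (4 + 5 * ((i : ℕ) : ℤ)) : ℝ)
  y_eq : ∀ i : Fin n, HoldsFraction s (5 + 5 * ((i : ℕ) : ℤ)) (y i)
  ρ_eq : ∀ i : Fin n, HoldsFraction s (7 + 5 * ((i : ℕ) : ℤ)) (ρ i)

end MultiRepSel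

/-! For a fixed first stage, the inner minimum over binary `y` equals the minimum over fractional
`y`, because the vertices of the polytope of fractional selections are integral
(`exists_binary_le`). Sion's minimax theorem, applied to the Lagrangian in which the budget
constraint carries the multiplier `π`, exchanges maximum and minimum (`exists_saddlePoint`). Hence
the robust value of `x` is the optimum of the mixed-integer program with `x` held fixed
(`exists_isRobustValue`), an optimal solution of the program is also two-stage optimal
(`IsMIPOptimal.isTwoStageOptimal`), and it remains to solve the program.

For fixed `x` and `π` the best `ρ i` is `max 0 (y i - π)`. Once the signs of all `y i - π` are
prescribed, the objective is linear in `(y, π)`, so it is minimal at an extreme point of a polytope.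
At an extreme point, each part has at most one item with `y i` outside `{0, 1, π}`; and if `0 < π <
1`, some part has items at `π` and all its other items at `0` or `1`, since otherwise `π` could be
shifted in both directions. If that part has `b` items at `π`, then `b * π` is an integer, and the
integrality of the part sums makes every `y i` a multiple of `1 / b` as well. So `π = r / b` with `r
≤ b ≤ n + 1` may be assumed (`exists_grid_le`): polynomially many candidates, which do not depend on
`x`.

With the threshold `r / b` fixed, each item is either taken in the first stage or receives `k / b`
with `k ≤ b`. The cost is a sum over items and the constraints separate by parts, so a dynamic
program over items and spent units, at most `b * p j` of them, solves each part, first stage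
included. The best threshold is found by enumeration. Multiplying all costs by the product of all
denominators makes them integral, and their bit length stays linear in the input size
(`Instance.fits`).

The running time is separated from correctness. If every loop makes at most `N` iterations and every
stored number has at most `B` bits, then the time of a fixed program is bounded by a polynomial in
`N` and `B` (`Runs.exists_exec`). Correctness is shown with weakest preconditions that carry these
two side conditions. -/

namespace RAM

/-! ### Bit lengths -/

theorem one_le_bits (z : ℤ) : 1 ≤ bits z := Nat.le_add_left _ _

theorem bits_le_iff {z : ℤ} {k : ℕ} : bits z ≤ k + 1 ↔ z.natAbs < 2 ^ k := by
  rw [bits, Nat.add_le_add_iff_right, Nat.size_le]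

theorem natAbs_lt_two_pow_bits (z : ℤ) : z.natAbs < 2 ^ (bits z - 1) :=
  bits_le_iff.1 (by have := one_le_bits z; omega)

theorem natAbs_succ_le_two_pow_bits (z : ℤ) : z.natAbs + 1 ≤ 2 ^ bits z :=
  (natAbs_lt_two_pow_bits z).trans_le (Nat.pow_le_pow_right (by norm_num) (by omega))

/-- The sign bits counted on both sides leave room for the carry. -/
theorem bits_add_le (x y : ℤ) : bits (x + y) ≤ bits x + bits y := by
  obtain ⟨a, ha⟩ : ∃ a, bits x = a + 1 := ⟨_, rfl⟩
  obtain ⟨b, hb⟩ : ∃ b, bits y = b + 1 := ⟨_, rfl⟩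
  have hx := bits_le_iff.1 ha.le
  have hy := bits_le_iff.1 hb.le
  rw [ha, hb, show a + 1 + (b + 1) = (a + b + 1) + 1 by ring, bits_le_iff]
  calc (x + y).natAbs ≤ x.natAbs + y.natAbs := Int.natAbs_add_le x y
    _ < 2 ^ (a + b) + 2 ^ (a + b) := add_lt_add_of_lt_of_le
        (hx.trans_le (Nat.pow_le_pow_right (by norm_num) (by omega)))
        (hy.le.trans (Nat.pow_le_pow_right (by norm_num) (by omega)))
    _ = 2 ^ (a + b + 1) := by ring

theorem bits_neg (x : ℤ) : bits (-x) = bits x := by simp [bits]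

theorem bits_sub_le (x y : ℤ) : bits (x - y) ≤ bits x + bits y := by
  simpa [sub_eq_add_neg, bits_neg] using bits_add_le x (-y)

theorem bits_mul_le (x y : ℤ) : bits (x * y) ≤ bits x + bits y := by
  obtain ⟨a, ha⟩ : ∃ a, bits x = a + 1 := ⟨_, rfl⟩
  obtain ⟨b, hb⟩ : ∃ b, bits y = b + 1 := ⟨_, rfl⟩
  have hx := bits_le_iff.1 ha.le
  have hy := bits_le_iff.1 hb.le
  rw [ha, hb, show a + 1 + (b + 1) = (a + b + 1) + 1 by ring, bits_le_iff, Int.natAbs_mul]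
  calc x.natAbs * y.natAbs < 2 ^ a * 2 ^ b := Nat.mul_lt_mul'' hx hy
    _ ≤ 2 ^ (a + b + 1) := by rw [← pow_add]; exact Nat.pow_le_pow_right (by norm_num) (by omega)

/-- All cells have bit length at most `B`. -/
def Bounded (B : ℕ) (s : Memory) : Prop := ∀ b a, bits (s b a) ≤ B

/-! ### Bounds for the time of expressions and programs -/

namespace Expr

instance : Add Expr := ⟨Expr.add⟩
instance : Sub Expr := ⟨Expr.sub⟩
instance : Mul Expr := ⟨Expr.mul⟩
instance (k : ℕ) : OfNat Expr k := ⟨Expr.const k⟩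

/-- The scalar variable in cell `0` of bank `b`. -/
def var (b : ℕ) : Expr := load b (const 0)

@[simp] theorem eval_add (s : Memory) (e₁ e₂ : Expr) :
    (e₁ + e₂).eval s = e₁.eval s + e₂.eval s := rfl
@[simp] theorem eval_sub (s : Memory) (e₁ e₂ : Expr) :
    (e₁ - e₂).eval s = e₁.eval s - e₂.eval s := rfl
@[simp] theorem eval_mul (s : Memory) (e₁ e₂ : Expr) :
    (e₁ * e₂).eval s = e₁.eval s * e₂.eval s := rfl
@[simp] theorem eval_ofNat (s : Memory) (k : ℕ) [k.AtLeastTwo] :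
    (ofNat(k) : Expr).eval s = (ofNat(k) : ℤ) := rfl
@[simp] theorem eval_zero (s : Memory) : (0 : Expr).eval s = 0 := rfl
@[simp] theorem eval_one (s : Memory) : (1 : Expr).eval s = 1 := rfl
@[simp] theorem eval_var (s : Memory) (b : ℕ) : (var b).eval s = s b 0 := rfl
@[simp] theorem eval_load (s : Memory) (b : ℕ) (e : Expr) :
    (load b e).eval s = s b (e.eval s) := rfl

/-- In a memory with cells of length at most `B`, the value has length at most `size * B`. -/
def size : Expr → ℕ
  | const z => bits z
  | load _ _ => 1
  | add e₁ e₂ => e₁.size + e₂.size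
  | sub e₁ e₂ => e₁.size + e₂.size
  | mul e₁ e₂ => e₁.size + e₂.size

/-- In a memory with cells of length at most `B`, the evaluation takes time at most
`weight * B`. -/
def weight : Expr → ℕ
  | const z => bits z
  | load _ e => e.weight + 1
  | add e₁ e₂ => e₁.weight + e₂.weight + (e₁.size + e₂.size)
  | sub e₁ e₂ => e₁.weight + e₂.weight + (e₁.size + e₂.size)
  | mul e₁ e₂ => e₁.weight + e₂.weight + (e₁.size + e₂.size)

theorem bits_eval_le {B : ℕ} {s : Memory} (hB : 1 ≤ B) (hs : Bounded B s) (e : Expr) :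
    bits (e.eval s) ≤ e.size * B := by
  induction e with
  | const z => exact Nat.le_mul_of_pos_right _ hB
  | load b e _ => simpa [size] using hs b _
  | add e₁ e₂ h₁ h₂ =>
    simp only [eval, size, add_mul]; exact (bits_add_le _ _).trans (add_le_add h₁ h₂)
  | sub e₁ e₂ h₁ h₂ =>
    simp only [eval, size, add_mul]; exact (bits_sub_le _ _).trans (add_le_add h₁ h₂)
  | mul e₁ e₂ h₁ h₂ =>
    simp only [eval, size, add_mul]; exact (bits_mul_le _ _).trans (add_le_add h₁ h₂)

theorem cost_le {B : ℕ} {s : Memory} (hB : 1 ≤ B) (hs : Bounded B s) (e : Expr) :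
    e.cost s ≤ e.weight * B := by
  induction e with
  | const z => exact Nat.le_mul_of_pos_right _ hB
  | load b e h =>
    simp only [cost, weight, add_mul, one_mul]; exact add_le_add h (hs b _)
  | add e₁ e₂ h₁ h₂ =>
    have := bits_eval_le hB hs (add e₁ e₂)
    simp only [cost, weight, add_mul, eval, size] at *; omega
  | sub e₁ e₂ h₁ h₂ =>
    have := bits_eval_le hB hs (sub e₁ e₂)
    simp only [cost, weight, add_mul, eval, size] at *; omega
  | mul e₁ e₂ h₁ h₂ =>
    have := bits_eval_le hB hs (mul e₁ e₂)
    simp only [cost, weight, add_mul, eval, size] at *; omega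

end Expr

/-- `Runs N B c s s'`: started with `s`, the program halts with `s'`, every loop makes at most `N`
iterations whenever it is entered, and only numbers of length at most `B` are stored. -/
def Runs (N B : ℕ) : Cmd → Memory → Memory → Prop
  | .skip, s, s' => s' = s
  | .store b e₁ e₂, s, s' => bits (e₂.eval s) ≤ B ∧ s' = write s b (e₁.eval s) (e₂.eval s)
  | .seq c₁ c₂, s, s' => ∃ r, Runs N B c₁ s r ∧ Runs N B c₂ r s'
  | .ite e c₁ c₂, s, s' =>
      (0 < e.eval s ∧ Runs N B c₁ s s') ∨ (¬ 0 < e.eval s ∧ Runs N B c₂ s s')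
  | .loop e c, s, s' => ∃ k ≤ N, ∃ f : ℕ → Memory, f 0 = s ∧ f k = s' ∧
      (∀ i < k, 0 < e.eval (f i) ∧ Runs N B c (f i) (f (i + 1))) ∧ ¬ 0 < e.eval (f k)

namespace Cmd

/-- A bound for the time of runs with at most `N` iterations of each loop and numbers of length at
most `B`. -/
noncomputable def time (N B : Polynomial ℕ) : Cmd → Polynomial ℕ
  | skip => 1
  | store _ e₁ e₂ => (e₁.weight : Polynomial ℕ) * B + (e₂.weight : Polynomial ℕ) * B + 1
  | seq c₁ c₂ => c₁.time N B + c₂.time N B + 1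
  | ite e c₁ c₂ => (e.weight : Polynomial ℕ) * B + (c₁.time N B + c₂.time N B) + 1
  | loop e c => N * ((e.weight : Polynomial ℕ) * B + c.time N B + 1) +
      ((e.weight : Polynomial ℕ) * B + 1)

end Cmd

theorem Bounded.write {B : ℕ} {s : Memory} (hs : Bounded B s) {b : ℕ} {a v : ℤ}
    (hv : bits v ≤ B) : Bounded B (write s b a v) := by
  intro b' a'
  unfold RAM.write
  split_ifs
  · exact hv
  · exact hs _ _

/-- Induction on the program. Values of expressions are longer than the cells by a constant factor
that depends on the syntax only, and `Runs` limits what is stored, so the bound on the cells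
persists through every iteration and one bound serves for all executions of a loop body. -/
theorem Runs.exists_exec {N B : Polynomial ℕ} {x : ℕ} (hB : 1 ≤ B.eval x) {c : Cmd} {s s' : Memory}
    (h : Runs (N.eval x) (B.eval x) c s s') (hs : Bounded (B.eval x) s) :
    Bounded (B.eval x) s' ∧ ∃ t ≤ (c.time N B).eval x, Exec c s s' t := by
  induction c generalizing s s' with
  | skip =>
    obtain rfl : s' = s := h
    exact ⟨hs, 1, by simp [Cmd.time], .skip _⟩
  | store b e₁ e₂ =>
    obtain ⟨h₁, rfl⟩ := h
    refine ⟨hs.write h₁, _, ?_, .store _ _ _ _⟩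
    have := e₁.cost_le hB hs
    have := e₂.cost_le hB hs
    simp [Cmd.time]; omega
  | seq c₁ c₂ ih₁ ih₂ =>
    obtain ⟨r, h₁, h₂⟩ := h
    obtain ⟨hr, t₁, ht₁, e₁⟩ := ih₁ h₁ hs
    obtain ⟨hs', t₂, ht₂, e₂⟩ := ih₂ h₂ hr
    refine ⟨hs', _, ?_, .seq e₁ e₂⟩
    simp [Cmd.time]; omega
  | ite e c₁ c₂ ih₁ ih₂ =>
    have hc := e.cost_le hB hs
    obtain ⟨he, h⟩ | ⟨he, h⟩ := h
    · obtain ⟨hs', t, ht, e'⟩ := ih₁ h hs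
      refine ⟨hs', _, ?_, .ite_pos he e'⟩
      simp [Cmd.time]; omega
    · obtain ⟨hs', t, ht, e'⟩ := ih₂ h hs
      refine ⟨hs', _, ?_, .ite_neg he e'⟩
      simp [Cmd.time]; omega
  | loop e c ih =>
    obtain ⟨k, hk, f, rfl, rfl, hf, hend⟩ := h
    have hbd : ∀ i ≤ k, Bounded (B.eval x) (f i) := by
      intro i
      induction i with
      | zero => exact fun _ => hs
      | succ i hi => exact fun hik => (ih (hf i (by omega)).2 (hi (by omega))).1
    refine ⟨hbd k le_rfl, ?_⟩
    -- `j` counts the iterations that are still to come: `Exec.loop_pos` prepends an iteration, so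
    -- the run is assembled from its end.
    have key : ∀ j ≤ k, ∃ t ≤ j * (e.weight * B.eval x + (c.time N B).eval x + 1) +
        (e.weight * B.eval x + 1), Exec (.loop e c) (f (k - j)) (f k) t := by
      intro j
      induction j with
      | zero =>
        intro _
        have := e.cost_le hB (hbd k le_rfl)
        exact ⟨e.cost (f k) + 1, by omega, .loop_neg hend⟩
      | succ j hj =>
        intro hjk
        obtain ⟨t, ht, et⟩ := hj (by omega)
        obtain ⟨hpos, hrun⟩ := hf (k - (j + 1)) (by omega)
        have hb := hbd (k - (j + 1)) (by omega)
        obtain ⟨_, t', ht', et'⟩ := ih hrun hb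
        rw [show k - (j + 1) + 1 = k - j by omega] at et'
        refine ⟨_, ?_, .loop_pos hpos et' et⟩
        have := e.cost_le hB hb
        rw [add_mul]; omega
    obtain ⟨t, ht, et⟩ := key k le_rfl
    rw [Nat.sub_self] at et
    refine ⟨t, ht.trans ?_, et⟩
    simp only [Cmd.time, Polynomial.eval_add, Polynomial.eval_mul, Polynomial.eval_natCast,
      Polynomial.eval_one, Nat.cast_id]
    gcongr

/-! ### Weakest preconditions -/

/-- Some run (in the sense of `Runs`) from `s` ends in a memory with the property `Q`. -/
def WP (N B : ℕ) (c : Cmd) (s : Memory) (Q : Memory → Prop) : Prop := ∃ s', Runs N B c s s' ∧ Q s'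

namespace Cmd

/-- Sequential composition of a list of programs. -/
def block : List Cmd → Cmd
  | [] => skip
  | [c] => c
  | c :: cs => seq c (block cs)

/-- The banks that the program may change. -/
def writes : Cmd → List ℕ
  | skip => []
  | store b _ _ => [b]
  | seq c₁ c₂ => c₁.writes ++ c₂.writes
  | ite _ c₁ c₂ => c₁.writes ++ c₂.writes
  | loop _ c => c.writes

/-- Assignment to a scalar variable. -/
def set (b : ℕ) (e : Expr) : Cmd := store b (.const 0) e

/-- The body is executed with the values `0, 1, …, e - 1` of the scalar variable `v`. -/
def forLoop (v : ℕ) (e : Expr) (body : Cmd) : Cmd :=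
  seq (set v 0) (loop (e - .var v) (seq body (set v (.var v + 1))))

end Cmd

section

variable {N B : ℕ} {s : Memory} {Q Q' : Memory → Prop}

@[simp] theorem wp_skip : WP N B .skip s Q ↔ Q s := by simp [WP, Runs]

@[simp] theorem wp_store {b : ℕ} {e₁ e₂ : Expr} : WP N B (.store b e₁ e₂) s Q ↔
    bits (e₂.eval s) ≤ B ∧ Q (write s b (e₁.eval s) (e₂.eval s)) := by
  simp [WP, Runs, and_assoc]

@[simp] theorem wp_set {b : ℕ} {e : Expr} : WP N B (.set b e) s Q ↔
    bits (e.eval s) ≤ B ∧ Q (write s b 0 (e.eval s)) := wp_store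

@[simp] theorem wp_seq {c₁ c₂ : Cmd} : WP N B (.seq c₁ c₂) s Q ↔
    WP N B c₁ s fun r => WP N B c₂ r Q := by
  simp only [WP, Runs]
  grind

@[simp] theorem wp_ite {e : Expr} {c₁ c₂ : Cmd} : WP N B (.ite e c₁ c₂) s Q ↔
    if 0 < e.eval s then WP N B c₁ s Q else WP N B c₂ s Q := by
  unfold WP
  split_ifs with h <;> simp [Runs, h]

@[simp] theorem wp_block_singleton {c : Cmd} : WP N B (.block [c]) s Q ↔ WP N B c s Q := Iff.rfl

@[simp] theorem wp_block_cons {c c' : Cmd} {cs : List Cmd} :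
    WP N B (.block (c :: c' :: cs)) s Q ↔ WP N B c s fun r => WP N B (.block (c' :: cs)) r Q :=
  wp_seq

/-- The frame rule is purely syntactic. As every variable and every array has a bank of its own,
preservation of a variable reduces to a decidable statement about a list of numbers. -/
theorem Runs.frame {c : Cmd} {s' : Memory} (h : Runs N B c s s') {b : ℕ} (hb : b ∉ c.writes) :
    s' b = s b := by
  induction c generalizing s s' with
  | skip => rw [show s' = s from h]
  | store b' e₁ e₂ =>
    obtain ⟨_, rfl⟩ := h
    have : b ≠ b' := by simpa [Cmd.writes] using hb
    funext a
    simp [write, this]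
  | seq c₁ c₂ ih₁ ih₂ =>
    obtain ⟨r, h₁, h₂⟩ := h
    simp only [Cmd.writes, List.mem_append, not_or] at hb
    rw [ih₂ h₂ hb.2, ih₁ h₁ hb.1]
  | ite e c₁ c₂ ih₁ ih₂ =>
    simp only [Cmd.writes, List.mem_append, not_or] at hb
    obtain ⟨_, h⟩ | ⟨_, h⟩ := h
    · exact ih₁ h hb.1
    · exact ih₂ h hb.2
  | loop e c ih =>
    obtain ⟨k, _, f, rfl, rfl, hf, _⟩ := h
    have : ∀ i ≤ k, f i b = f 0 b := by
      intro i
      induction i with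
      | zero => exact fun _ => rfl
      | succ i hi => exact fun hik => (ih (hf i (by omega)).2 hb).trans (hi (by omega))
    exact this k le_rfl

/-- The banks that `c` does not write agree in `s` and `s'`. -/
def Frame (c : Cmd) (s s' : Memory) : Prop := ∀ b ∉ c.writes, s' b = s b

theorem WP.imp {c : Cmd} (h : WP N B c s Q) (hQ : ∀ s', Frame c s s' → Q s' → Q' s') :
    WP N B c s Q' := by
  obtain ⟨s', hr, hs'⟩ := h
  exact ⟨s', hr, hQ s' (fun _ hb => hr.frame hb) hs'⟩

/-- The bound `e` is evaluated anew before each iteration, hence the hypothesis that its value is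
`L` in every memory that differs only in banks written by the loop. The step asks for the invariant
after the counter has been incremented, which the caller discharges because bank `v` rarely matters
to it. -/
theorem wp_forLoop {v : ℕ} {e : Expr} {body : Cmd} (Inv : ℕ → Memory → Prop) (L : ℕ)
    (hL : L ≤ N) (hB : bits (L : ℤ) ≤ B) (hv : v ∉ body.writes)
    (he : ∀ s', Frame (.forLoop v e body) s s' → e.eval s' = L)
    (h0 : Inv 0 (write s v 0 0))
    (hstep : ∀ i < L, ∀ s', Frame (.forLoop v e body) s s' → s' v 0 = i → Inv i s' →
      WP N B body s' fun r => Inv (i + 1) (write r v 0 (i + 1 : ℕ)))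
    (hQ : ∀ s', Frame (.forLoop v e body) s s' → s' v 0 = L → Inv L s' → Q s') :
    WP N B (.forLoop v e body) s Q := by
  have hbits : ∀ i : ℕ, i ≤ L → bits (i : ℤ) ≤ B := by
    intro i hi
    refine le_trans ?_ hB
    simp only [bits, Int.natAbs_natCast]
    exact Nat.add_le_add_right (Nat.size_le_size hi) 1
  have hw : (Cmd.forLoop v e body).writes = v :: (body.writes ++ [v]) := rfl
  -- The sequence of memories demanded by `Runs` is built by extending it one iteration at a time.
  have hchain : ∀ k ≤ L, ∃ f : ℕ → Memory, f 0 = write s v 0 0 ∧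
      (∀ i < k, 0 < (e - .var v).eval (f i) ∧
        Runs N B (.seq body (.set v (.var v + 1))) (f i) (f (i + 1))) ∧
      Frame (.forLoop v e body) s (f k) ∧ f k v 0 = k ∧ Inv k (f k) := by
    intro k
    induction k with
    | zero =>
      intro _
      refine ⟨fun _ => write s v 0 0, rfl, by simp, ?_, by simp [write], h0⟩
      intro b hb
      have : b ≠ v := by rintro rfl; simp [hw] at hb
      funext a; simp [write, this]
    | succ k hk =>
      intro hkL
      obtain ⟨f, hf0, hf, hfr, hfv, hfI⟩ := hk (by omega)
      obtain ⟨r, hr, hrI⟩ := hstep k (by omega) (f k) hfr hfv hfI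
      have hrv : r v 0 = k := by rw [hr.frame hv, hfv]
      refine ⟨fun i => if i ≤ k then f i else write r v 0 (k + 1 : ℕ), by simp [hf0], ?_, ?_, ?_, ?_⟩
      · intro i hi
        obtain hik | rfl : i < k ∨ i = k := by omega
        · simpa [hik.le, Nat.succ_le_of_lt hik] using hf i hik
        · simp only [le_refl, if_true, Nat.not_succ_le_self, if_false]
          refine ⟨?_, r, hr, ?_, ?_⟩
          · simp [he _ hfr, hfv]; omega
          · simpa [hrv] using hbits (i + 1) hkL
          · simp [hrv, Expr.eval]
      · intro b hb
        have hbv : b ≠ v := by rintro rfl; simp [hw] at hb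
        simp only [Nat.not_succ_le_self, if_false]
        have h2 : r b = f k b := hr.frame (by simp [hw] at hb; tauto)
        rw [← hfr b hb, ← h2]
        funext a; simp [write, hbv]
      · simp [write]
      · simpa using hrI
  obtain ⟨f, hf0, hf, hfr, hfv, hfI⟩ := hchain L le_rfl
  refine ⟨f L, ⟨write s v 0 0, ⟨?_, rfl⟩, L, hL, f, hf0, rfl, hf, ?_⟩, hQ _ hfr hfv hfI⟩
  · simpa using hbits 0 (Nat.zero_le _)
  · simp [he _ hfr, hfv]

end

theorem write_same (s : Memory) (b : ℕ) (a v : ℤ) : write s b a v b a = v := by simp [write]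

theorem write_apply_ne (s : Memory) {b b' : ℕ} (a v : ℤ) (h : b' ≠ b) :
    write s b a v b' = s b' := by
  funext a'; simp [write, h]

end RAM

/-! ### Extreme points of the threshold polytope and rounding to a grid -/

namespace MultiRepSel

open Finset Filter Topology

section Polytope

variable {ι κ : Type*} [Fintype ι] [DecidableEq κ]

/-- Fractional second-stage solutions `y` together with a threshold `π ∈ [0, M]`, where `S`
prescribes the items with `π ≤ y_i`. -/
def thresholdPolytope (part : ι → κ) (F : Set ι) (q : κ → ℤ) (M : ℝ) (S : Set ι) :
    Set ((ι → ℝ) × ℝ) :=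
  {z | (∀ i, 0 ≤ z.1 i ∧ z.1 i ≤ 1) ∧ (∀ i ∉ F, z.1 i = 0) ∧ (0 ≤ z.2 ∧ z.2 ≤ M) ∧
    (∀ j, ∑ i with part i = j, z.1 i = q j) ∧ (∀ i ∈ S, z.2 ≤ z.1 i) ∧ ∀ i ∉ S, z.1 i ≤ z.2}

variable {part : ι → κ} {F : Set ι} {q : κ → ℤ} {M : ℝ} {S : Set ι}

theorem isCompact_thresholdPolytope : IsCompact (thresholdPolytope part F q M S) := by
  refine IsCompact.of_isClosed_subset
    (isCompact_Icc (a := ((fun _ => 0, 0) : (ι → ℝ) × ℝ)) (b := (fun _ => 1, M))) ?_ ?_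
  · simp only [thresholdPolytope, Set.ofPred_and, Set.ofPred_forall]
    refine .inter (isClosed_iInter fun i => .inter ?_ ?_) <| .inter
      (isClosed_iInter fun i => isClosed_iInter fun _ => ?_) <| .inter (.inter ?_ ?_) <| .inter
      (isClosed_iInter fun j => ?_) <| .inter
      (isClosed_iInter fun i => isClosed_iInter fun _ => ?_)
      (isClosed_iInter fun i => isClosed_iInter fun _ => ?_)
    all_goals first
      | exact isClosed_le (by fun_prop) (by fun_prop)
      | exact isClosed_eq (by fun_prop) (by fun_prop)
  · rintro ⟨y, π⟩ ⟨h1, _, h2, _⟩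
    exact ⟨⟨fun i => (h1 i).1, h2.1⟩, ⟨fun i => (h1 i).2, h2.2⟩⟩

/-- The minimizers form a compact exposed face. It has an extreme point by the Krein–Milman theorem,
and extreme points of a face are extreme in the whole set. -/
theorem exists_extremePoint_isMinOn {E : Type*} [AddCommGroup E] [Module ℝ E]
    [TopologicalSpace E] [T2Space E] [IsTopologicalAddGroup E] [ContinuousSMul ℝ E]
    [LocallyConvexSpace ℝ E] {K : Set E} (hK : IsCompact K) (hne : K.Nonempty) (l : E →L[ℝ] ℝ) :
    ∃ z ∈ K.extremePoints ℝ, ∀ w ∈ K, l z ≤ l w := by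
  obtain ⟨z₀, hz₀, hmin⟩ := hK.exists_isMinOn hne l.continuous.continuousOn
  set A : Set E := {z ∈ K | ∀ w ∈ K, (-l) w ≤ (-l) z} with hA
  have hexp : IsExposed ℝ K A := fun _ => ⟨-l, hA⟩
  have hAne : A.Nonempty := ⟨z₀, hz₀, fun w hw => by simpa using hmin hw⟩
  have hAK : IsCompact A := hexp.isCompact hK
  obtain ⟨z, hz⟩ := hAK.extremePoints_nonempty hAne
  refine ⟨z, hexp.isExtreme.extremePoints_subset_extremePoints hz, fun w hw => ?_⟩
  have := (extremePoints_subset hz).2 w hw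
  simpa using this

/-- There is no direction in which an extreme point can be moved both ways. -/
theorem eq_zero_of_mem_extremePoints {y : ι → ℝ} {π : ℝ}
    (hz : (y, π) ∈ (thresholdPolytope part F q M S).extremePoints ℝ) {w : ι → ℝ} {τ : ℝ}
    (hw : ∀ i, w i = 0 ∨ (0 < y i ∧ y i < 1)) (hF : ∀ i ∉ F, w i = 0)
    (hτ : τ = 0 ∨ (0 < π ∧ π < M)) (hsum : ∀ j, ∑ i with part i = j, w i = 0)
    (htight : ∀ i, w i = τ ∨ y i ≠ π) : w = 0 ∧ τ = 0 := by
  obtain ⟨h1, h2, h3, h4, h5, h6⟩ := extremePoints_subset hz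
  -- An inequality that is strict at `(y, π)` survives small moves, and a tight one stays tight
  -- because the direction changes both of its sides equally.
  have hmem : ∀ᶠ t in 𝓝 (0 : ℝ), (y + t • w, π + t * τ) ∈ thresholdPolytope part F q M S := by
    have lt_of (a b : ℝ) (a' b' : ℝ) (h : a < b) : ∀ᶠ t in 𝓝 (0 : ℝ), a + t * a' ≤ b + t * b' := by
      have : ∀ᶠ t in 𝓝 (0 : ℝ), a + t * a' < b + t * b' :=
        Tendsto.eventually_lt (y := a) (z := b)
          (by simpa using (Continuous.tendsto (f := fun t : ℝ => a + t * a') (by fun_prop) 0))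
          (by simpa using (Continuous.tendsto (f := fun t : ℝ => b + t * b') (by fun_prop) 0)) h
      exact this.mono fun _ h => h.le
    have e1 : ∀ᶠ t in 𝓝 (0 : ℝ), ∀ i, 0 ≤ y i + t * w i ∧ y i + t * w i ≤ 1 := by
      refine eventually_all.2 fun i => ?_
      obtain h | ⟨ha, hb⟩ := hw i
      · simpa [h] using h1 i
      · filter_upwards [lt_of 0 (y i) 0 (w i) ha, lt_of (y i) 1 (w i) 0 hb] with t ht ht'
        simp at *; exact ⟨ht, ht'⟩
    have e2 : ∀ᶠ t in 𝓝 (0 : ℝ), 0 ≤ π + t * τ ∧ π + t * τ ≤ M := by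
      obtain h | ⟨ha, hb⟩ := hτ
      · simpa [h] using h3
      · filter_upwards [lt_of 0 π 0 τ ha, lt_of π M τ 0 hb] with t ht ht'
        simp at *; exact ⟨ht, ht'⟩
    have e3 : ∀ᶠ t in 𝓝 (0 : ℝ), ∀ i, (i ∈ S → π + t * τ ≤ y i + t * w i) ∧
        (i ∉ S → y i + t * w i ≤ π + t * τ) := by
      refine eventually_all.2 fun i => ?_
      obtain h | h := htight i
      · refine .of_forall fun t => ⟨fun hi => ?_, fun hi => ?_⟩
        · have := h5 i hi; simp at this; rw [h]; linarith
        · have := h6 i hi; simp at this; rw [h]; linarith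
      · by_cases hi : i ∈ S
        · filter_upwards [lt_of π (y i) τ (w i) (lt_of_le_of_ne (h5 i hi) (Ne.symm h))] with t ht
          exact ⟨fun _ => ht, fun h => absurd hi h⟩
        · filter_upwards [lt_of (y i) π (w i) τ (lt_of_le_of_ne (h6 i hi) h)] with t ht
          exact ⟨fun h => absurd h hi, fun _ => ht⟩
    filter_upwards [e1, e2, e3] with t ht1 ht2 ht3
    refine ⟨by simpa using ht1, fun i hi => ?_, ht2, fun j => ?_, fun i hi => ?_, fun i hi => ?_⟩
    · have := h2 i hi; simp at this; simp [hF i hi, this]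
    · have := h4 j
      simp only [Pi.add_apply, Pi.smul_apply, smul_eq_mul, sum_add_distrib, ← mul_sum, hsum j]
      simpa using this
    · simpa using (ht3 i).1 hi
    · simpa using (ht3 i).2 hi
  have hneg : ∀ᶠ t in 𝓝 (0 : ℝ), (y + (-t) • w, π + (-t) * τ) ∈ thresholdPolytope part F q M S := by
    have : Tendsto (fun t : ℝ => -t) (𝓝 0) (𝓝 0) := by
      simpa using (continuous_neg (G := ℝ)).tendsto 0
    exact this.eventually hmem
  obtain ⟨t, ⟨ht1, ht2⟩, ht0⟩ := (((hmem.and hneg).filter_mono nhdsWithin_le_nhds).and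
    (self_mem_nhdsWithin (a := (0 : ℝ)) (s := Set.Ioi 0))).exists
  have ht0 : 0 < t := ht0
  -- `(y, π)` is the midpoint of the points reached with `t` and `-t`, so both of them equal it;
  -- since `t > 0`, the direction vanishes.
  have heq := (mem_extremePoints.1 hz).2 _ ht1 _ ht2 (by
    refine ⟨1 / 2, 1 / 2, by norm_num, by norm_num, by norm_num, ?_⟩
    ext i
    · simp; ring
    · simp; ring)
  have heq1 := congrArg Prod.fst heq.1
  have heq2 := congrArg Prod.snd heq.1
  refine ⟨funext fun i => ?_, ?_⟩
  · have := congrFun heq1 i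
    simpa [ht0.ne'] using this
  · simpa [ht0.ne'] using heq2

/-- `t` is a multiple of `1 / b`. -/
def OnGrid (b : ℕ) (t : ℝ) : Prop := ∃ k : ℤ, t * b = k

theorem OnGrid.sum {b : ℕ} {α : Type*} (s : Finset α) {f : α → ℝ} (h : ∀ i ∈ s, OnGrid b (f i)) :
    OnGrid b (∑ i ∈ s, f i) := by
  choose! k hk using h
  exact ⟨∑ i ∈ s, k i, by push_cast; rw [sum_mul]; exact sum_congr rfl hk⟩

theorem OnGrid.int (b : ℕ) (t : ℤ) : OnGrid b (t : ℝ) := ⟨t * b, by push_cast; rfl⟩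

theorem OnGrid.sub {b : ℕ} {t u : ℝ} (ht : OnGrid b t) (hu : OnGrid b u) : OnGrid b (t - u) := by
  obtain ⟨k, hk⟩ := ht
  obtain ⟨l, hl⟩ := hu
  exact ⟨k - l, by push_cast; rw [sub_mul, hk, hl]⟩

/-- Two free items in one part could exchange a small amount in both directions without changing the
sum of the part. -/
theorem part_ne_of_mem_extremePoints {y : ι → ℝ} {π : ℝ}
    (hz : (y, π) ∈ (thresholdPolytope part F q M S).extremePoints ℝ) {a b : ι} (hab : a ≠ b)
    (ha : y a ≠ 0 ∧ y a ≠ 1 ∧ y a ≠ π) (hb : y b ≠ 0 ∧ y b ≠ 1 ∧ y b ≠ π) : part a ≠ part b := by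
  classical
  intro hp
  obtain ⟨h1, h2, -⟩ := extremePoints_subset hz
  have hlt (i : ι) (h : y i ≠ 0 ∧ y i ≠ 1 ∧ y i ≠ π) : 0 < y i ∧ y i < 1 :=
    ⟨lt_of_le_of_ne (h1 i).1 h.1.symm, lt_of_le_of_ne (h1 i).2 h.2.1⟩
  have key := eq_zero_of_mem_extremePoints hz (w := Pi.single a 1 - Pi.single b 1) (τ := 0)
    ?_ ?_ (.inl rfl) ?_ ?_
  · have := congrFun key.1 a
    simp [hab] at this
  · intro i
    by_cases hia : i = a
    · subst hia; exact .inr (hlt i ha)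
    by_cases hib : i = b
    · subst hib; exact .inr (hlt i hb)
    left; simp [hia, hib]
  · intro i hi
    have h0 := h2 i hi
    have hia : i ≠ a := by rintro rfl; exact ha.1 h0
    have hib : i ≠ b := by rintro rfl; exact hb.1 h0
    simp [hia, hib]
  · intro j
    simp [sum_sub_distrib, hp]
  · intro i
    by_cases hia : i = a
    · subst hia; exact .inr ha.2.2
    by_cases hib : i = b
    · subst hib; exact .inr hb.2.2
    left; simp [hia, hib]

/-- The values `0`, `1` and `π` are on the grid. Any other value occurs at most once in its part, so
it is an integer minus a sum of grid values. -/
theorem onGrid_of_mem_extremePoints {y : ι → ℝ} {π : ℝ}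
    (hz : (y, π) ∈ (thresholdPolytope part F q M S).extremePoints ℝ) {b : ℕ} (hπ : OnGrid b π)
    (i : ι) : OnGrid b (y i) := by
  classical
  obtain ⟨h1, h2, h3, h4, -⟩ := extremePoints_subset hz
  have hfree (i : ι) (h : ¬ (y i ≠ 0 ∧ y i ≠ 1 ∧ y i ≠ π)) : OnGrid b (y i) := by
    by_cases h0 : y i = 0
    · rw [h0]; simpa using OnGrid.int b 0
    by_cases h1 : y i = 1
    · rw [h1]; simpa using OnGrid.int b 1
    have : y i = π := by tauto
    rwa [this]
  by_cases hi : y i ≠ 0 ∧ y i ≠ 1 ∧ y i ≠ π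
  · have hsum := h4 (part i)
    simp only at hsum
    rw [← add_sum_erase _ _ (show i ∈ univ.filter (fun i' => part i' = part i) by simp)] at hsum
    rw [eq_sub_of_add_eq hsum]
    refine (OnGrid.int b _).sub (.sum _ fun a ha => hfree a fun hfa => ?_)
    simp only [mem_erase, mem_filter, mem_univ, true_and] at ha
    exact part_ne_of_mem_extremePoints hz ha.1 hfa hi ha.2
  · exact hfree i hi

/-- If every part with items at `π` also had a free item, then `π` and all items at `π` could move
together, with the free items compensating. So for `0 < π < 1` some part has items at `π` and
otherwise only zeros and ones; its integral sum shows that `π` times the number of its items at `π`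
is an integer. -/
theorem exists_onGrid_of_mem_extremePoints {y : ι → ℝ} {π : ℝ}
    (hz : (y, π) ∈ (thresholdPolytope part F q 1 S).extremePoints ℝ) :
    ∃ b : ℕ, 1 ≤ b ∧ b ≤ Fintype.card ι + 1 ∧ OnGrid b π := by
  classical
  obtain ⟨h1, h2, h3, h4, -⟩ := extremePoints_subset hz
  by_cases hπ : 0 < π ∧ π < 1
  swap
  · refine ⟨1, le_rfl, by omega, ?_⟩
    have h3' : 0 ≤ π ∧ π ≤ 1 := h3
    obtain h | h : π = 0 ∨ π = 1 := by
      by_cases h0 : 0 < π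
      · right; exact le_antisymm h3'.2 (not_lt.1 fun h => hπ ⟨h0, h⟩)
      · left; exact le_antisymm (not_lt.1 h0) h3'.1
    · rw [h]; simpa using OnGrid.int 1 0
    · rw [h]; simpa using OnGrid.int 1 1
  obtain ⟨a, ha, hfree⟩ : ∃ a, y a = π ∧
      ∀ i, part i = part a → ¬ (y i ≠ 0 ∧ y i ≠ 1 ∧ y i ≠ π) := by
    by_contra! hcon
    -- Moving all items at `π` with speed one raises the sum of part `j` by `cnt j`; the free item,
    -- unique in its part, takes this back. A part without items at `π` does not move.
    let cnt : κ → ℝ := fun j => ∑ i with part i = j, if y i = π then 1 else 0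
    have key := eq_zero_of_mem_extremePoints hz (τ := 1) (w := fun i => if y i = π then 1 else
      if y i ≠ 0 ∧ y i ≠ 1 then - cnt (part i) else 0) ?_ ?_ (.inr hπ) ?_ ?_
    · simp at key
    · intro i
      by_cases hi : y i = π
      · right; rwa [hi]
      by_cases hi' : y i ≠ 0 ∧ y i ≠ 1
      · exact .inr ⟨lt_of_le_of_ne (h1 i).1 hi'.1.symm, lt_of_le_of_ne (h1 i).2 hi'.2⟩
      · left; rw [if_neg hi, if_neg hi']
    · intro i hi
      have h0 : y i = 0 := h2 i hi
      rw [if_neg (by rw [h0]; exact hπ.1.ne), if_neg (by simp [h0])]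
    · intro j
      by_cases hj : ∃ a, part a = j ∧ y a = π
      · obtain ⟨a, rfl, ha⟩ := hj
        obtain ⟨i₀, hi₀, hf0⟩ := hcon a ha
        have : ∀ i ∈ univ.filter (fun i => part i = part a), (if y i = π then (1 : ℝ) else
            if y i ≠ 0 ∧ y i ≠ 1 then - cnt (part i) else 0) =
            (if y i = π then 1 else 0) + if i = i₀ then - cnt (part a) else 0 := by
          intro i hi
          simp only [mem_filter, mem_univ, true_and] at hi
          by_cases hii : i = i₀
          · subst hii
            simp [hf0, hi]
          · by_cases hi' : y i = π
            · simp [hi', hii]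
            · by_cases hi'' : y i ≠ 0 ∧ y i ≠ 1
              · exact absurd (hi.trans hi₀.symm) (part_ne_of_mem_extremePoints hz hii
                  ⟨hi''.1, hi''.2, hi'⟩ hf0)
              · simp [hi', hi'', hii]
        rw [sum_congr rfl this, sum_add_distrib, sum_ite_eq' (univ.filter fun i => part i = part a)]
        simp [hi₀, cnt]
      · push Not at hj
        have hc : cnt j = 0 := by
          refine sum_eq_zero fun i hi => ?_
          simp only [mem_filter, mem_univ, true_and] at hi
          rw [if_neg (hj i hi)]
        refine sum_eq_zero fun i hi => ?_
        simp only [mem_filter, mem_univ, true_and] at hi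
        rw [if_neg (hj i hi), hi, hc]
        simp
    · intro i
      by_cases hi : y i = π
      · left; rw [if_pos hi]
      · exact .inr hi
  have hsum := h4 (part a)
  simp only at hsum
  set A := (univ.filter fun i => part i = part a)
  refine ⟨(A.filter fun i => y i = π).card, ?_, ?_, ?_⟩
  · exact card_pos.2 ⟨a, by simp [A, ha]⟩
  · exact (card_le_univ _).trans (Nat.le_succ _)
  · rw [← sum_filter_add_sum_filter_not A (fun i => y i = π)] at hsum
    have hcst : ∑ i ∈ A with y i = π, y i = π * (A.filter fun i => y i = π).card := by
      rw [sum_congr rfl (g := fun _ => π) (by simp), sum_const, nsmul_eq_mul, mul_comm]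
    have hint : OnGrid 1 (∑ i ∈ A with ¬ y i = π, y i) := by
      refine .sum _ fun i hi => ?_
      simp only [mem_filter, A, mem_univ, true_and] at hi
      have := hfree i hi.1
      obtain h | h : y i = 0 ∨ y i = 1 := by tauto
      · rw [h]; simpa using OnGrid.int 1 0
      · rw [h]; simpa using OnGrid.int 1 1
    obtain ⟨k, hk⟩ := hint
    refine ⟨q (part a) - k, ?_⟩
    rw [hcst] at hsum
    push_cast at hk ⊢
    linarith

/-- For a fixed first stage, thresholds and second-stage solutions may be rounded to multiples of
some `1 / b` with small `b`. -/
theorem exists_grid_le (c d : ι → ℝ) {Γ : ℝ} (hΓ : 0 ≤ Γ) {y : ι → ℝ} {π : ℝ}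
    (hy : ∀ i, 0 ≤ y i ∧ y i ≤ 1) (hF : ∀ i ∉ F, y i = 0)
    (hq : ∀ j, ∑ i with part i = j, y i = q j) (hπ : 0 ≤ π) :
    ∃ b : ℕ, 1 ≤ b ∧ b ≤ Fintype.card ι + 1 ∧ ∃ r ≤ b, ∃ k : ι → ℕ, (∀ i, k i ≤ b) ∧
      (∀ i ∉ F, k i = 0) ∧ (∀ j, (∑ i with part i = j, (k i : ℤ)) = b * q j) ∧
      Γ * ((r : ℝ) / b) + ∑ i, c i * ((k i : ℝ) / b) +
        ∑ i, d i * max 0 ((k i : ℝ) / b - (r : ℝ) / b) ≤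
      Γ * π + ∑ i, c i * y i + ∑ i, d i * max 0 (y i - π) := by
  classical
  -- Fixing the sign of each `y i - π` turns the positive parts into linear functions. The threshold
  -- is first cut off at `1`: as `y i ≤ 1`, this leaves the positive parts unchanged, and the budget
  -- term does not grow because `0 ≤ Γ`.
  set S : Set ι := {i | min π 1 ≤ y i}
  let obj : ((ι → ℝ) × ℝ) → ℝ := fun z =>
    Γ * z.2 + ∑ i, c i * z.1 i + ∑ i, d i * (if i ∈ S then z.1 i - z.2 else 0)
  let l : ((ι → ℝ) × ℝ) →L[ℝ] ℝ :=
    { toFun := obj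
      map_add' := by
        intro z w
        simp only [obj, Prod.fst_add, Prod.snd_add, Pi.add_apply]
        rw [show (∑ i, d i * if i ∈ S then z.1 i + w.1 i - (z.2 + w.2) else 0) =
          ∑ i, d i * (if i ∈ S then z.1 i - z.2 else 0) +
          ∑ i, d i * (if i ∈ S then w.1 i - w.2 else 0) by
            rw [← sum_add_distrib]; refine sum_congr rfl fun i _ => ?_
            split_ifs <;> ring]
        simp only [mul_add, sum_add_distrib]
        ring
      map_smul' := by
        intro t z
        simp only [obj, Prod.smul_fst, Prod.smul_snd, Pi.smul_apply, smul_eq_mul, RingHom.id_apply,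
          mul_add, mul_sum]
        congr 1
        · congr 1
          · ring
          · exact sum_congr rfl fun i _ => by ring
        · exact sum_congr rfl fun i _ => by split_ifs <;> ring
      cont := by
        refine Continuous.add (by fun_prop) (continuous_finsetSum _ fun i _ => ?_)
        by_cases hi : i ∈ S
        · simp only [hi, if_true]; fun_prop
        · simp only [hi, if_false]; fun_prop }
  have hobj (z : (ι → ℝ) × ℝ) (hz : z ∈ thresholdPolytope part F q 1 S) :
      l z = Γ * z.2 + ∑ i, c i * z.1 i + ∑ i, d i * max 0 (z.1 i - z.2) := by
    change obj z = _
    simp only [obj]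
    congr 1
    refine sum_congr rfl fun i _ => ?_
    by_cases hi : i ∈ S
    · rw [if_pos hi, max_eq_right (by linarith [hz.2.2.2.2.1 i hi])]
    · rw [if_neg hi, max_eq_left (by linarith [hz.2.2.2.2.2 i hi])]
  have hmem : (y, min π 1) ∈ thresholdPolytope part F q 1 S :=
    ⟨hy, hF, ⟨le_min hπ zero_le_one, min_le_right _ _⟩, hq, fun i hi => hi,
      fun i hi => (not_le.1 hi).le⟩
  obtain ⟨⟨y', π'⟩, hz, hmin⟩ :=
    exists_extremePoint_isMinOn isCompact_thresholdPolytope ⟨_, hmem⟩ l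
  obtain ⟨b, hb1, hbn, hgπ⟩ := exists_onGrid_of_mem_extremePoints hz
  have hgy := fun i => onGrid_of_mem_extremePoints hz hgπ i
  have hz' := extremePoints_subset hz
  have hb : (0 : ℝ) < b := by exact_mod_cast hb1
  have nat_of (t : ℝ) (h : OnGrid b t) (h0 : 0 ≤ t ∧ t ≤ 1) : ∃ k : ℕ, k ≤ b ∧ t = k / b := by
    obtain ⟨k, hk⟩ := h
    have hk0 : 0 ≤ k := by
      have : (0 : ℝ) ≤ k := hk ▸ mul_nonneg h0.1 hb.le
      exact_mod_cast this
    lift k to ℕ using hk0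
    refine ⟨k, ?_, ?_⟩
    · have : (k : ℝ) ≤ b := by
        have : (k : ℝ) = t * b := by rw [hk]; simp
        rw [this]; nlinarith [h0.2]
      exact_mod_cast this
    · rw [eq_div_iff hb.ne', hk]; simp
  obtain ⟨r, hr, rfl⟩ := nat_of π' hgπ hz'.2.2.1
  choose k hk hky using fun i => nat_of (y' i) (hgy i) (hz'.1 i)
  obtain rfl : y' = fun i => (k i : ℝ) / b := funext hky
  refine ⟨b, hb1, hbn, r, hr, k, hk, fun i hi => ?_, fun j => ?_, ?_⟩
  · have := hz'.2.1 i hi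
    simpa [hb.ne'] using this
  · have := hz'.2.2.2.1 j
    simp only [← sum_div] at this
    rw [div_eq_iff hb.ne'] at this
    have h2 : (((∑ i with part i = j, (k i : ℤ) : ℤ)) : ℝ) = ((b * q j : ℤ) : ℝ) := by
      push_cast; rw [this]; ring
    exact_mod_cast h2
  · have h := hmin _ hmem
    rw [hobj _ hz', hobj _ hmem] at h
    refine h.trans ?_
    have h' : ∀ i, max 0 (y i - min π 1) = max 0 (y i - π) := by
      intro i
      obtain hp | hp := le_total π 1
      · rw [min_eq_left hp]
      · rw [min_eq_right hp, max_eq_left (by linarith [(hy i).2]),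
          max_eq_left (by linarith [(hy i).2])]
    simp only [h']
    gcongr
    exact min_le_left _ _

/-- A linear function on fractional second-stage solutions is minimal in a binary one. -/
theorem exists_binary_le (c : ι → ℝ) {y : ι → ℝ}
    (hy : ∀ i, 0 ≤ y i ∧ y i ≤ 1) (hF : ∀ i ∉ F, y i = 0)
    (hq : ∀ j, ∑ i with part i = j, y i = q j) :
    ∃ y' : ι → ℝ, (∀ i, y' i = 0 ∨ y' i = 1) ∧ (∀ i ∉ F, y' i = 0) ∧
      (∀ j, ∑ i with part i = j, y' i = q j) ∧ ∑ i, c i * y' i ≤ ∑ i, c i * y i := by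
  let l : ((ι → ℝ) × ℝ) →L[ℝ] ℝ :=
    { toFun := fun z => ∑ i, c i * z.1 i
      map_add' := by intro z w; simp [mul_add, sum_add_distrib]
      map_smul' := by
        intro t z
        simp only [Prod.smul_fst, Pi.smul_apply, smul_eq_mul, RingHom.id_apply, mul_sum]
        exact sum_congr rfl fun i _ => by ring
      cont := by fun_prop }
  -- With `M = 0` the threshold is pinned to zero, which is a multiple of `1`, so extreme points
  -- have integral coordinates.
  have hmem : (y, (0 : ℝ)) ∈ thresholdPolytope part F q 0 Set.univ :=
    ⟨hy, hF, ⟨le_rfl, le_rfl⟩, hq, fun i _ => (hy i).1, fun i hi => absurd trivial hi⟩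
  obtain ⟨⟨y', π'⟩, hz, hmin⟩ :=
    exists_extremePoint_isMinOn isCompact_thresholdPolytope ⟨_, hmem⟩ l
  have hz' := extremePoints_subset hz
  obtain rfl : π' = 0 := le_antisymm hz'.2.2.1.2 hz'.2.2.1.1
  refine ⟨y', fun i => ?_, hz'.2.1, hz'.2.2.2.1, hmin _ hmem⟩
  obtain ⟨k, hk⟩ := onGrid_of_mem_extremePoints hz (b := 1) (by simpa using OnGrid.int 1 0) i
  simp only [Nat.cast_one, mul_one] at hk
  obtain ⟨ha, hb⟩ : 0 ≤ y' i ∧ y' i ≤ 1 := hz'.1 i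
  rw [hk] at ha hb ⊢
  have ha' : 0 ≤ k := by exact_mod_cast ha
  have hb' : k ≤ 1 := by exact_mod_cast hb
  obtain rfl | rfl : k = 0 ∨ k = 1 := by omega
  · simp
  · simp

end Polytope

end MultiRepSel

/-! ### Minimax duality between deviations and the threshold -/

namespace MultiRepSel

open Finset

section SaddlePoint

variable {ι κ : Type*} [Fintype ι] [DecidableEq κ]

/-- Fractional second-stage solutions. -/
def fractional (part : ι → κ) (F : Set ι) (q : κ → ℤ) : Set (ι → ℝ) :=
  {y | (∀ i, 0 ≤ y i ∧ y i ≤ 1) ∧ (∀ i ∉ F, y i = 0) ∧ ∀ j, ∑ i with part i = j, y i = q j}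

variable {part : ι → κ} {F : Set ι} {q : κ → ℤ}

theorem isCompact_fractional : IsCompact (fractional part F q) := by
  refine IsCompact.of_isClosed_subset (isCompact_Icc (a := fun _ => 0) (b := fun _ => 1)) ?_
    fun y h => ⟨fun i => (h.1 i).1, fun i => (h.1 i).2⟩
  simp only [fractional, Set.ofPred_and, Set.ofPred_forall]
  refine .inter (isClosed_iInter fun i => .inter ?_ ?_) <| .inter
    (isClosed_iInter fun i => isClosed_iInter fun _ => ?_) (isClosed_iInter fun j => ?_)
  all_goals first
    | exact isClosed_le (by fun_prop) (by fun_prop)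
    | exact isClosed_eq (by fun_prop) (by fun_prop)

theorem convex_fractional : Convex ℝ (fractional part F q) := by
  intro y hy z hz a b ha hb hab
  refine ⟨fun i => ⟨?_, ?_⟩, fun i hi => ?_, fun j => ?_⟩
  · have h1 := (hy.1 i).1
    have h2 := (hz.1 i).1
    simp only [Pi.add_apply, Pi.smul_apply, smul_eq_mul]
    positivity
  · simp only [Pi.add_apply, Pi.smul_apply, smul_eq_mul]
    nlinarith [(hy.1 i).2, (hz.1 i).2]
  · simp [hy.2.1 i hi, hz.2.1 i hi]
  · simp only [Pi.add_apply, Pi.smul_apply, smul_eq_mul, sum_add_distrib, ← mul_sum, hy.2.2 j,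
      hz.2.2 j]
    rw [← add_mul, hab, one_mul]

/-- Duality between the worst case over budgeted deviations `δ` and the threshold `π`. -/
theorem exists_saddlePoint (hne : (fractional part F q).Nonempty) (c : ι → ℝ) {d : ι → ℝ}
    (hd : ∀ i, 0 ≤ d i) {Γ : ℝ} (hΓ : 0 ≤ Γ) :
    ∃ y ∈ fractional part F q, ∃ π, 0 ≤ π ∧ ∃ δ : ι → ℝ, (∀ i, 0 ≤ δ i ∧ δ i ≤ d i) ∧
      ∑ i, δ i ≤ Γ ∧ (∀ y' ∈ fractional part F q, ∑ i, (c i + δ i) * y i ≤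
        ∑ i, (c i + δ i) * y' i) ∧
      (∀ δ' : ι → ℝ, (∀ i, 0 ≤ δ' i ∧ δ' i ≤ d i) → ∑ i, δ' i ≤ Γ →
        ∑ i, (c i + δ' i) * y i ≤ ∑ i, (c i + δ i) * y i) ∧
      ∑ i, c i * y i + Γ * π + ∑ i, d i * max 0 (y i - π) ≤ ∑ i, (c i + δ i) * y i := by
  -- The Lagrangian with multiplier `π` for the budget constraint; `δ` is then restricted only by
  -- the box. The multiplier is confined to `[0, 2]` for compactness, and an upper end beyond `1` is
  -- what excludes an overspent budget below.
  let f : (ι → ℝ) × ℝ → (ι → ℝ) → ℝ := fun z δ =>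
    ∑ i, c i * z.1 i + Γ * z.2 + ∑ i, δ i * (z.1 i - z.2)
  have hf (z : (ι → ℝ) × ℝ) (δ : ι → ℝ) :
      f z δ = ∑ i, (c i + δ i) * z.1 i + z.2 * (Γ - ∑ i, δ i) := by
    simp only [f, add_mul, mul_sub, sum_add_distrib, sum_sub_distrib, ← sum_mul]
    ring
  have cX : Convex ℝ (fractional part F q ×ˢ Set.Icc (0 : ℝ) 2) :=
    convex_fractional.prod (convex_Icc 0 2)
  have cY : Convex ℝ (Set.Icc (0 : ι → ℝ) d) := convex_Icc 0 d
  obtain ⟨⟨y, π⟩, ⟨hy, hπ⟩, δ, hδ, hsad⟩ := Sion.exists_isSaddlePointOn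
    (X := fractional part F q ×ˢ Set.Icc (0 : ℝ) 2) (Y := Set.Icc (0 : ι → ℝ) d) (f := f)
    (hne.prod ⟨0, by simp⟩) cX (isCompact_fractional.prod isCompact_Icc)
    (fun δ _ => Continuous.lowerSemicontinuous (by fun_prop) |>.lowerSemicontinuousOn _)
    (fun δ _ => ConvexOn.quasiconvexOn ⟨cX, fun z _ w _ a b _ _ _ => le_of_eq (by
      simp only [hf, Prod.fst_add, Prod.snd_add, Prod.smul_fst, Prod.smul_snd, Pi.add_apply,
        Pi.smul_apply, smul_eq_mul, mul_add, sum_add_distrib, mul_sum]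
      simp only [mul_left_comm _ a, mul_left_comm _ b, ← mul_sum]
      ring)⟩)
    cY ⟨0, by simp [hd, Pi.le_def]⟩ isCompact_Icc
    (fun z _ => Continuous.upperSemicontinuous (by fun_prop) |>.upperSemicontinuousOn _)
    (fun z _ => ConcaveOn.quasiconcaveOn ⟨cY, fun δ _ δ' _ a b _ _ hab => le_of_eq (by
      simp only [f, Pi.add_apply, Pi.smul_apply, smul_eq_mul, add_mul, sum_add_distrib, mul_assoc,
        ← mul_sum]
      rw [← eq_sub_iff_add_eq'] at hab
      subst hab
      ring)⟩)
  have hδ' : ∀ i, 0 ≤ δ i ∧ δ i ≤ d i := fun i => ⟨hδ.1 i, hδ.2 i⟩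
  have hmax : ∀ δ' : ι → ℝ, (∀ i, 0 ≤ δ' i ∧ δ' i ≤ d i) → f (y, π) δ' ≤ f (y, π) δ :=
    fun δ' h => hsad _ ⟨hy, hπ⟩ _ ⟨fun i => (h i).1, fun i => (h i).2⟩
  have hmin : ∀ y' ∈ fractional part F q, ∀ π', 0 ≤ π' → π' ≤ 2 → f (y, π) δ ≤ f (y', π') δ :=
    fun y' hy' π' h0 h2 => hsad _ ⟨hy', h0, h2⟩ _ hδ
  -- If the budget were exceeded, minimality in `π` would force `π = 2`. All `y i - π` are then at
  -- most `-1`, so `δ = 0` would be strictly better for the maximizer.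
  have hsum : ∑ i, δ i ≤ Γ := by
    by_contra! hcon
    have h1 := hmin y hy 2 (by norm_num) le_rfl
    simp only [hf] at h1
    have hπ2 : 2 ≤ π := by
      by_contra! h
      nlinarith
    have h2 := hmax 0 fun i => ⟨le_rfl, hd i⟩
    simp only [f, Pi.zero_apply, zero_mul, sum_const_zero] at h2
    have h3 : ∑ i, δ i * (y i - π) ≤ ∑ i, - δ i := by
      refine sum_le_sum fun i _ => ?_
      nlinarith [(hδ' i).1, (hy.1 i).2]
    rw [sum_neg_distrib] at h3
    linarith
  -- Complementary slackness, from comparison with the multiplier `0`.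
  have hcs : π * (Γ - ∑ i, δ i) = 0 := by
    have h1 := hmin y hy 0 le_rfl (by norm_num)
    simp only [hf, zero_mul] at h1
    have := mul_nonneg hπ.1 (sub_nonneg.2 hsum)
    linarith
  have hval : f (y, π) δ = ∑ i, (c i + δ i) * y i := by rw [hf]; simp [hcs]
  refine ⟨y, hy, π, hπ.1, δ, hδ', hsum, fun y' hy' => ?_, fun δ' h hs => ?_, ?_⟩
  · have := hmin y' hy' π hπ.1 hπ.2
    simp only [hf] at this
    linarith
  · have h1 := hmax δ' h
    rw [hval, hf] at h1
    have := mul_nonneg hπ.1 (sub_nonneg.2 hs)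
    simp only at h1
    linarith
  -- For given `(y, π)` the best response in the box deviates fully exactly where `π ≤ y i`; its
  -- value is the dual objective.
  · have h1 := hmax (fun i => if π ≤ y i then d i else 0) fun i => by
      split_ifs <;> simp [hd]
    rw [hval] at h1
    refine le_trans (le_of_eq ?_) h1
    simp only [f]
    congr 1
    refine sum_congr rfl fun i _ => ?_
    split_ifs with h
    · rw [max_eq_right (by linarith)]
    · rw [max_eq_left (by linarith)]; simp

end SaddlePoint

/-! ### The robust value as the optimum of the mixed-integer program -/

namespace Instance

variable (I : Instance)

/-- The number of items that remain to be chosen from each part after the first stage. -/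
noncomputable def remaining (x : Fin I.n → ℝ) (j : Fin I.m) : ℤ :=
  by
    classical
    exact I.p j - ((I.T j).filter fun i => x i = 1).card

theorem sum_eq_remaining_iff {x : Fin I.n → ℝ} (hx : ∀ i, x i = 0 ∨ x i = 1) (y : Fin I.n → ℝ)
    (j : Fin I.m) :
    ∑ i ∈ I.T j, y i = I.remaining x j ↔ ∑ i ∈ I.T j, (x i + y i) = I.p j := by
  classical
  have : ∑ i ∈ I.T j, x i = ((I.T j).filter fun i => x i = 1).card := by
    rw [card_filter]
    push_cast
    refine sum_congr rfl fun i _ => ?_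
    obtain h | h := hx i <;> simp [h]
  rw [sum_add_distrib, this, remaining]
  push_cast
  constructor <;> intro h <;> linarith

/-- Fractional second-stage solutions for the first-stage solution `x`. -/
noncomputable def fractionalY (x : Fin I.n → ℝ) : Set (Fin I.n → ℝ) :=
  fractional I.part {i | x i = 0} (I.remaining x)

theorem mem_fractionalY_iff {x : Fin I.n → ℝ} (hx : ∀ i, x i = 0 ∨ x i = 1) {y : Fin I.n → ℝ} :
    y ∈ I.fractionalY x ↔ (∀ i, 0 ≤ y i ∧ y i ≤ 1) ∧ (∀ i, x i + y i ≤ 1) ∧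
      ∀ j, ∑ i ∈ I.T j, (x i + y i) = I.p j := by
  simp only [fractionalY, fractional, Set.mem_ofPred_eq]
  refine and_congr_right fun hy => and_congr (forall_congr' fun i => ?_)
    (forall_congr' fun j => I.sum_eq_remaining_iff hx y j)
  obtain h | h := hx i
  · simp [h, (hy i).2]
  · simp only [h, one_ne_zero, not_false_eq_true, true_imp_iff]
    constructor <;> intro h' <;> linarith [(hy i).1]

theorem mem_Y_iff {x : Fin I.n → ℝ} (hx : ∀ i, x i = 0 ∨ x i = 1) {y : Fin I.n → ℝ} :
    y ∈ I.Y x ↔ (∀ i, y i = 0 ∨ y i = 1) ∧ y ∈ I.fractionalY x := by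
  rw [mem_fractionalY_iff I hx]
  simp only [Y, X, Set.mem_ofPred_eq, Pi.add_apply]
  refine and_congr_right fun hy => ?_
  constructor
  · rintro ⟨h1, h2⟩
    refine ⟨fun i => ?_, fun i => ?_, h2⟩
    · obtain h | h := hy i <;> simp [h]
    · obtain h | h := h1 i <;> simp [h]
  · rintro ⟨-, h1, h2⟩
    refine ⟨fun i => ?_, h2⟩
    have := h1 i
    obtain h | h := hx i <;> obtain h' | h' := hy i <;> rw [h, h'] at this ⊢ <;>
      first | (norm_num; done) | norm_num at this

/-- Integrality of the second stage: for every cost vector, binary and fractional second stages have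
the same minimum. -/
theorem exists_mem_Y_le {x : Fin I.n → ℝ} (hx : ∀ i, x i = 0 ∨ x i = 1) {y : Fin I.n → ℝ}
    (hy : y ∈ I.fractionalY x) (c : Fin I.n → ℝ) :
    ∃ y' ∈ I.Y x, ∑ i, c i * y' i ≤ ∑ i, c i * y i := by
  obtain ⟨y', h1, h2, h3, h4⟩ := exists_binary_le c hy.1 hy.2.1 hy.2.2
  refine ⟨y', (I.mem_Y_iff hx).2 ⟨h1, fun i => ?_, h2, h3⟩, h4⟩
  obtain h | h := h1 i <;> simp [h]

theorem IsMIPFeasible.mem_fractionalY {x y : Fin I.n → ℝ} {π : ℝ} {ρ : Fin I.n → ℝ}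
    (h : I.IsMIPFeasible x y π ρ) : y ∈ I.fractionalY x :=
  (I.mem_fractionalY_iff h.x_binary).2 ⟨h.y_mem, h.add_le, h.sum_eq⟩

/-- For a fixed first-stage solution, the robust value is the optimal value of the mixed-integer
program. -/
theorem exists_isRobustValue {x : Fin I.n → ℝ} (hxX : x ∈ I.X') :
    ∃ v y π ρ, I.IsRobustValue I.UAC x v ∧ I.IsMIPFeasible x y π ρ ∧
      I.mipObjective x y π ρ ≤ v ∧
      ∀ y' π' ρ', I.IsMIPFeasible x y' π' ρ' → v ≤ I.mipObjective x y' π' ρ' := by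
  obtain ⟨hx, y₀, hy₀⟩ := hxX
  have hd : ∀ i, (0 : ℝ) ≤ I.d i := fun i => by exact_mod_cast I.d_nonneg i
  have hΓ : (0 : ℝ) ≤ I.Γ := by exact_mod_cast I.Γ_nonneg
  obtain ⟨y, hy, π, hπ, δ, hδ, hδs, hmin, hmax, hle⟩ := exists_saddlePoint
    (part := I.part) (F := {i | x i = 0}) (q := I.remaining x)
    ⟨y₀, ((I.mem_Y_iff hx).1 hy₀).2⟩ (fun i => (I.c i : ℝ)) hd hΓ
  change y ∈ I.fractionalY x at hy
  have hy' := (I.mem_fractionalY_iff hx).1 hy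
  refine ⟨∑ i, (I.C i : ℝ) * x i + ∑ i, ((I.c i : ℝ) + δ i) * y i, y, π,
    fun i => max 0 (y i - π), ⟨_, ⟨?_, ?_⟩, rfl⟩, ?_, ?_, ?_⟩
  · refine ⟨fun i => I.c i + δ i, ⟨δ, hδ, fun i => rfl, hδs⟩, ?_, ?_⟩
    · obtain ⟨y', h1, h2⟩ := I.exists_mem_Y_le hx hy fun i => I.c i + δ i
      exact ⟨y', h1, le_antisymm h2 (hmin _ ((I.mem_Y_iff hx).1 h1).2)⟩
    · rintro _ ⟨y', h1, rfl⟩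
      exact hmin _ ((I.mem_Y_iff hx).1 h1).2
  · rintro u ⟨c, ⟨δ', h1, h2, h3⟩, hu⟩
    obtain ⟨y', h4, h5⟩ := I.exists_mem_Y_le hx hy c
    refine (hu.2 ⟨y', h4, rfl⟩).trans (h5.trans ?_)
    simp only [h2]
    exact hmax δ' h1 h3
  · exact ⟨hy'.2.2, hy'.2.1, fun i => by linarith [le_max_right 0 (y i - π)], hx, hy'.1, hπ,
      fun i => le_max_left _ _⟩
  · simp only [mipObjective]
    linarith
  · intro y' π' ρ' h
    have h1 := hmin y' h.mem_fractionalY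
    -- Weak duality: `y' i ≤ π' + ρ' i` is weighted with `δ i`, and `δ i ≤ d i` is used for the part
    -- with `ρ'`. The budget bounds the part with `π'` afterwards.
    have h2 : ∑ i, δ i * y' i ≤ ∑ i, (δ i * π' + I.d i * ρ' i) := by
      refine sum_le_sum fun i _ => ?_
      nlinarith [h.le_dual i, h.ρ_nonneg i, hδ i]
    rw [sum_add_distrib, ← sum_mul] at h2
    have h3 := mul_le_mul_of_nonneg_right hδs h.π_nonneg
    have h4 : ∑ i, ((I.c i : ℝ) + δ i) * y' i = ∑ i, (I.c i : ℝ) * y' i + ∑ i, δ i * y' i := by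
      rw [← sum_add_distrib]; exact sum_congr rfl fun i _ => by ring
    simp only [mipObjective]
    linarith

/-- Both problems minimize the same function of `x`, by `exists_isRobustValue`, and integrality
gives them the same feasible `x`. -/
theorem IsMIPOptimal.isTwoStageOptimal {x y : Fin I.n → ℝ} {π : ℝ} {ρ : Fin I.n → ℝ} {v : ℝ}
    (h : I.IsMIPOptimal x y π ρ v) : I.IsTwoStageOptimal I.UAC x v := by
  obtain ⟨hf, hv, hopt⟩ := h
  have hx : x ∈ I.X' := by
    obtain ⟨y', hy', -⟩ := I.exists_mem_Y_le hf.x_binary hf.mem_fractionalY 0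
    exact ⟨hf.x_binary, y', hy'⟩
  refine ⟨hx, ?_, fun x' hx' => ?_⟩
  · obtain ⟨v', y', π', ρ', hr, hf', hle, hmin⟩ := I.exists_isRobustValue hx
    have h1 : v' ≤ v := hv ▸ hmin _ _ _ hf
    have h2 : v ≤ v' := (hopt _ _ _ _ hf').trans hle
    rwa [le_antisymm h2 h1]
  · obtain ⟨v', y', π', ρ', hr, hf', hle, -⟩ := I.exists_isRobustValue hx'
    exact ⟨v', hr, (hopt _ _ _ _ hf').trans hle⟩

end Instance

end MultiRepSel

/-! ### Integer data and the discrete form of the program -/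

namespace MultiRepSel

open Finset

/-- An instance with integer costs, in the form in which programs handle it. -/
structure Data where
  n : ℕ
  m : ℕ
  part : ℕ → ℕ
  p : ℕ → ℕ
  C : ℕ → ℤ
  c : ℕ → ℤ
  d : ℕ → ℤ
  Γ : ℤ

namespace Data

variable (A : Data)

/-- For the threshold `r / b`, choice `k ≤ b` for item `i` means `y_i = k / b`, and choice `b + 1`
means `x_i = 1`.  This is the cost of a choice, multiplied by `b`. -/
def cost (b r i k : ℕ) : ℤ :=
  if k ≤ b then A.c i * k + A.d i * ((k - r : ℕ) : ℤ) else A.C i * b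

/-- The choices `κ` meet the requirements of all parts. -/
def IsChoice (b : ℕ) (κ : ℕ → ℕ) : Prop :=
  (∀ i < A.n, κ i ≤ b + 1) ∧
    ∀ j < A.m, ∑ i ∈ range A.n, (if A.part i = j then min (κ i) b else 0) = b * A.p j

/-- Total cost of choices for the threshold `r / b`, multiplied by `b`. -/
def total (b r : ℕ) (κ : ℕ → ℕ) : ℤ := ∑ i ∈ range A.n, A.cost b r i (κ i) + A.Γ * r

/-- The choices `κ` for the threshold `r / b` are optimal among all choices for all thresholds. -/
structure IsBest (b r : ℕ) (κ : ℕ → ℕ) : Prop where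
  one_le : 1 ≤ b
  le : b ≤ A.n + 1
  r_le : r ≤ b
  isChoice : A.IsChoice b κ
  optimal : ∀ b' r' κ', 1 ≤ b' → b' ≤ A.n + 1 → r' ≤ b' → A.IsChoice b' κ' →
    A.total b r κ * b' ≤ A.total b' r' κ' * b

/-- The data are those of the instance, with all costs multiplied by `D`. -/
structure Represents (I : Instance) (D : ℤ) : Prop where
  D_pos : 0 < D
  n_eq : A.n = I.n
  m_eq : A.m = I.m
  part_eq : ∀ i : Fin I.n, A.part i = I.part i
  p_eq : ∀ j : Fin I.m, A.p j = I.p j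
  C_eq : ∀ i : Fin I.n, (A.C i : ℝ) = D * I.C i
  c_eq : ∀ i : Fin I.n, (A.c i : ℝ) = D * I.c i
  d_eq : ∀ i : Fin I.n, (A.d i : ℝ) = D * I.d i
  Γ_eq : (A.Γ : ℝ) = D * I.Γ

end Data

/-- First-stage solution of a choice. -/
noncomputable def firstStage (n b : ℕ) (κ : ℕ → ℕ) (i : Fin n) : ℝ := if κ i ≤ b then 0 else 1

/-- Second-stage solution of a choice. -/
noncomputable def secondStage (n b : ℕ) (κ : ℕ → ℕ) (i : Fin n) : ℝ :=
  ((if κ i ≤ b then κ i else 0 : ℕ) : ℝ) / b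

/-- Excess over the threshold of a choice. -/
noncomputable def excess (n b r : ℕ) (κ : ℕ → ℕ) (i : Fin n) : ℝ :=
  ((if κ i ≤ b then κ i - r else 0 : ℕ) : ℝ) / b

namespace Data

variable {A : Data} {I : Instance} {D : ℤ}

/-- The choice `b + 1` is capped to `b` units, a whole item. This lets one constraint on units cover
both stages. -/
theorem firstStage_add_secondStage {n b : ℕ} (hb : 1 ≤ b) {κ : ℕ → ℕ} (i : Fin n)
    (hκ : κ i ≤ b + 1) :
    firstStage n b κ i + secondStage n b κ i = ((min (κ i) b : ℕ) : ℝ) / b := by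
  have hb' : (b : ℝ) ≠ 0 := by positivity
  unfold firstStage secondStage
  split_ifs with h
  · simp [h]
  · rw [min_eq_right (by omega)]; simp [hb']

theorem total_eq (h : A.Represents I D) {b r : ℕ} (hb : 1 ≤ b) (κ : ℕ → ℕ) :
    (A.total b r κ : ℝ) = D * b * I.mipObjective (firstStage I.n b κ) (secondStage I.n b κ)
      ((r : ℝ) / b) (excess I.n b r κ) := by
  have hb' : (b : ℝ) ≠ 0 := by positivity
  simp only [Instance.mipObjective, total, ← sum_add_distrib, add_right_comm _ ((I.Γ : ℝ) * _),
    mul_add ((D : ℝ) * b), mul_sum, h.n_eq, sum_range]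
  push_cast
  rw [h.Γ_eq]
  congr 1
  · refine sum_congr rfl fun i _ => ?_
    unfold firstStage secondStage excess cost
    split_ifs with hi
    · push_cast; rw [h.c_eq, h.d_eq]; field_simp; ring
    · push_cast; rw [h.C_eq]; field_simp; ring
  · field_simp

theorem isMIPFeasible (h : A.Represents I D) {b r : ℕ} (hb : 1 ≤ b) {κ : ℕ → ℕ}
    (hκ : A.IsChoice b κ) :
    I.IsMIPFeasible (firstStage I.n b κ) (secondStage I.n b κ) ((r : ℝ) / b)
      (excess I.n b r κ) := by
  have hb0 : (0 : ℝ) < b := by positivity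
  have hκ' : ∀ i : Fin I.n, κ i ≤ b + 1 := fun i => hκ.1 i (by rw [h.n_eq]; exact i.2)
  refine ⟨fun j => ?_, fun i => ?_, fun i => ?_, fun i => ?_, fun i => ⟨?_, ?_⟩, ?_, fun i => ?_⟩
  · rw [sum_congr rfl fun i _ => firstStage_add_secondStage hb i (hκ' i), ← sum_div,
      div_eq_iff hb0.ne', Instance.T, sum_filter]
    have := hκ.2 j (by rw [h.m_eq]; exact j.2)
    rw [h.n_eq, h.p_eq, sum_range] at this
    simp only [h.part_eq, Fin.val_inj] at this
    rw [mul_comm]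
    exact_mod_cast this
  · rw [firstStage_add_secondStage hb i (hκ' i), div_le_one hb0]
    exact_mod_cast min_le_right _ _
  · unfold secondStage excess
    rw [← add_div, div_le_div_iff_of_pos_right hb0]
    norm_cast
    split_ifs <;> omega
  · unfold firstStage; split_ifs <;> simp
  · unfold secondStage; positivity
  · unfold secondStage
    rw [div_le_one hb0]
    norm_cast
    split_ifs <;> omega
  · positivity
  · unfold excess; positivity

/-- Feasible solutions of the mixed-integer program are not better than all choices. -/
theorem exists_isChoice_le (h : A.Represents I D) {x y : Fin I.n → ℝ} {π : ℝ} {ρ : Fin I.n → ℝ}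
    (hf : I.IsMIPFeasible x y π ρ) :
    ∃ b r κ, 1 ≤ b ∧ b ≤ A.n + 1 ∧ r ≤ b ∧ A.IsChoice b κ ∧
      (A.total b r κ : ℝ) ≤ D * b * I.mipObjective x y π ρ := by
  have hΓ : (0 : ℝ) ≤ I.Γ := by exact_mod_cast I.Γ_nonneg
  have hd : ∀ i, (0 : ℝ) ≤ I.d i := fun i => by exact_mod_cast I.d_nonneg i
  have hD : (0 : ℝ) < D := by exact_mod_cast h.D_pos
  have hy := hf.mem_fractionalY
  obtain ⟨b, hb1, hbn, r, hr, k, hkb, hk0, hkq, hle⟩ := exists_grid_le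
    (fun i => (I.c i : ℝ)) (fun i => (I.d i : ℝ)) hΓ hy.1 hy.2.1 hy.2.2 hf.π_nonneg
  have hb0 : (0 : ℝ) < b := by positivity
  classical
  -- `b + 1` encodes a first-stage item, whose `k` vanishes by `hk0`; the value beyond the items is
  -- arbitrary.
  let κ : ℕ → ℕ := fun i => if hi : i < I.n then (if x ⟨i, hi⟩ = 1 then b + 1 else k ⟨i, hi⟩) else 0
  have hκ (i : Fin I.n) : κ i = if x i = 1 then b + 1 else k i := by simp [κ]
  have hκx (i : Fin I.n) : κ i ≤ b ↔ x i = 0 := by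
    rw [hκ]
    obtain hx | hx := hf.x_binary i
    · simp [hx, hkb i]
    · simp [hx]
  have hx : firstStage I.n b κ = x := by
    funext i
    unfold firstStage
    obtain hx | hx := hf.x_binary i <;> simp [hκx, hx]
  have hyk : secondStage I.n b κ = fun i => (k i : ℝ) / b := by
    funext i
    unfold secondStage
    rw [if_congr (hκx i) rfl rfl]
    obtain hx | hx := hf.x_binary i
    · simp [hx, hκ]
    · simp [hx, hk0 i (by simp [hx])]
  -- Truncated subtraction of natural numbers is the positive part.
  have hex : excess I.n b r κ = fun i => max 0 ((k i : ℝ) / b - (r : ℝ) / b) := by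
    funext i
    unfold excess
    have hm : max 0 ((k i : ℝ) / b - (r : ℝ) / b) = max 0 ((k i : ℝ) - r) / b := by
      rw [← sub_div, ← max_div_div_right hb0.le, zero_div]
    rw [if_congr (hκx i) rfl rfl, hm]
    obtain hx | hx := hf.x_binary i
    · simp only [hx, hκ, if_true, zero_ne_one, if_false]
      obtain hkr | hkr := le_total (k i) r
      · rw [Nat.sub_eq_zero_of_le hkr, max_eq_left]
        · simp
        · have : (k i : ℝ) ≤ r := by exact_mod_cast hkr
          linarith
      · rw [max_eq_right, Nat.cast_sub hkr]
        have : (r : ℝ) ≤ k i := by exact_mod_cast hkr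
        linarith
    · simp [hx, hk0 i (by simp [hx])]
  refine ⟨b, r, κ, hb1, ?_, hr, ⟨fun i hi => ?_, fun j hj => ?_⟩, ?_⟩
  · rw [h.n_eq]; simpa using hbn
  · rw [h.n_eq] at hi
    have := hκ ⟨i, hi⟩
    simp only at this
    rw [this]
    split_ifs
    · exact le_rfl
    · exact (hkb _).trans (Nat.le_succ _)
  · rw [h.m_eq] at hj
    lift j to Fin I.m using hj
    rw [h.n_eq, h.p_eq, sum_range]
    simp only [h.part_eq, Fin.val_inj]
    have h1 := (I.sum_eq_remaining_iff (x := x) hf.x_binary (fun i => (k i : ℝ) / b) j).1 (by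
      rw [← sum_div, div_eq_iff hb0.ne', Instance.T]
      have := hkq j
      rw [mul_comm]
      exact_mod_cast this)
    have h2 (i : Fin I.n) : x i + (k i : ℝ) / b = ((min (κ i) b : ℕ) : ℝ) / b := by
      rw [← hx]
      have := firstStage_add_secondStage hb1 i (κ := κ) (by
        rw [hκ]; split_ifs; exacts [le_rfl, (hkb i).trans (Nat.le_succ _)])
      rw [hyk] at this
      exact this
    simp only [h2] at h1
    rw [← sum_div, div_eq_iff hb0.ne', Instance.T, sum_filter] at h1
    rw [mul_comm]
    exact_mod_cast h1
  · rw [total_eq h hb1, hx, hyk, hex]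
    gcongr
    have h3 : ∑ i, (I.d i : ℝ) * max 0 (y i - π) ≤ ∑ i, (I.d i : ℝ) * ρ i := by
      refine sum_le_sum fun i _ => mul_le_mul_of_nonneg_left (max_le (hf.ρ_nonneg i) ?_) (hd i)
      linarith [hf.le_dual i]
    simp only [Instance.mipObjective]
    linarith

/-- Totals carry the factor `D * b`. Totals for different denominators are therefore compared as
fractions, which `IsBest` states after cross-multiplication. -/
theorem IsBest.isMIPOptimal (h : A.Represents I D) {b r : ℕ} {κ : ℕ → ℕ} (hbest : A.IsBest b r κ) :
    I.IsMIPOptimal (firstStage I.n b κ) (secondStage I.n b κ) ((r : ℝ) / b) (excess I.n b r κ)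
      ((A.total b r κ : ℝ) / ((D * b : ℤ) : ℝ)) := by
  have hD : (0 : ℝ) < D := by exact_mod_cast h.D_pos
  have hb0 : (0 : ℝ) < b := by exact_mod_cast hbest.one_le
  refine ⟨isMIPFeasible h hbest.one_le hbest.isChoice, ?_, fun x' y' π' ρ' hf => ?_⟩
  · rw [total_eq h hbest.one_le]
    push_cast
    field_simp
  · obtain ⟨b', r', κ', h1, h2, h3, h4, h5⟩ := exists_isChoice_le h hf
    have hb' : (0 : ℝ) < b' := by exact_mod_cast h1
    have h6 : (A.total b r κ : ℝ) * b' ≤ A.total b' r' κ' * b := by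
      exact_mod_cast hbest.optimal b' r' κ' h1 h2 h3 h4
    push_cast
    rw [div_le_iff₀ (by positivity)]
    have h7 := mul_le_mul_of_nonneg_right h5 hb0.le
    have h8 : (A.total b r κ : ℝ) * b' ≤ (I.mipObjective x' y' π' ρ' * (D * b)) * b' := by
      linarith
    exact le_of_mul_le_mul_right h8 hb'

end Data

end MultiRepSel

/-! ### The dynamic program for one part and one threshold -/

namespace MultiRepSel

open Finset

namespace Data

/-- The laws of data that come from instances. -/
structure Valid (A : Data) : Prop where
  part_lt : ∀ i < A.n, A.part i < A.m
  p_le : ∀ j < A.m, A.p j ≤ ((range A.n).filter fun i => A.part i = j).card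
  C_nonneg : ∀ i, 0 ≤ A.C i
  c_nonneg : ∀ i, 0 ≤ A.c i
  d_nonneg : ∀ i, 0 ≤ A.d i
  Γ_nonneg : 0 ≤ A.Γ

variable (A : Data)

/-- A bound for all costs. -/
def costSum : ℤ := ∑ i ∈ range A.n, (A.C i + A.c i + A.d i)

/-- Cost of leaving a part unfilled; it exceeds the cost of all choices. -/
def penalty (b : ℕ) : ℤ := b * A.costSum + 1

variable {A} (hA : A.Valid)

theorem cost_zero (b r i : ℕ) : A.cost b r i 0 = 0 := by simp [cost]

include hA in
theorem cost_nonneg (b r i k : ℕ) : 0 ≤ A.cost b r i k := by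
  have := hA.C_nonneg i
  have := hA.c_nonneg i
  have := hA.d_nonneg i
  unfold cost
  split_ifs <;> positivity

include hA in
theorem cost_le (b r i k : ℕ) : A.cost b r i k ≤ b * (A.C i + A.c i + A.d i) := by
  have h1 := hA.C_nonneg i
  have h2 := hA.c_nonneg i
  have h3 := hA.d_nonneg i
  unfold cost
  split_ifs with h
  · have h4 : ((k - r : ℕ) : ℤ) ≤ b := by exact_mod_cast (Nat.sub_le _ _).trans h
    have h5 : (k : ℤ) ≤ b := by exact_mod_cast h
    nlinarith [mul_le_mul_of_nonneg_left h4 h3, mul_le_mul_of_nonneg_left h5 h2]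
  · nlinarith

include hA in
theorem costSum_nonneg : 0 ≤ A.costSum := sum_nonneg fun i _ => by
  have h1 := hA.C_nonneg i
  have h2 := hA.c_nonneg i
  have h3 := hA.d_nonneg i
  positivity

include hA in
theorem penalty_pos (b : ℕ) : 0 < A.penalty b := by
  have := costSum_nonneg hA
  unfold penalty
  positivity

include hA in
-- Each choice costs at most `b` times the three costs of its item, and the `+ 1` in the penalty
-- makes the inequality strict.
theorem sum_cost_lt_penalty (b r : ℕ) (κ : ℕ → ℕ) (P : ℕ → Prop) [DecidablePred P] :
    ∑ i ∈ range A.n, (if P i then A.cost b r i (κ i) else 0) < A.penalty b := by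
  refine (sum_le_sum fun i _ => ?_).trans_lt (b := ∑ i ∈ range A.n, b * (A.C i + A.c i + A.d i)) ?_
  · have := cost_le hA b r i (κ i)
    have := cost_nonneg hA b r i (κ i)
    split_ifs <;> linarith
  · rw [← mul_sum, penalty, costSum]; omega

variable (A) in
/-- The number of choices for item `i` in the problem for part `j`. -/
def options (b j i : ℕ) : ℕ := if A.part i = j then b + 2 else 1

/-- `v` is the least cost of reaching state `s` with one of the first `K` choices for item `i`,
where `prev` are the costs before item `i`; it is reached with the choice `ch`. -/
structure IsEntry (A : Data) (b r i : ℕ) (prev : ℕ → ℤ) (s K : ℕ) (v : ℤ) (ch : ℕ) : Prop where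
  lt : ch < K ∨ ch = 0
  unit_le : min ch b ≤ s
  eq : v = prev (s - min ch b) + A.cost b r i ch
  le_prev : v ≤ prev s
  le : ∀ k < K, min k b ≤ s → v ≤ prev (s - min k b) + A.cost b r i k

/-- Choice `0` is free and uses no units, so the entry of the preceding row is a correct start
before any choice has been tried. This is why `IsEntry.lt` admits `ch = 0` even for `K = 0`. -/
theorem IsEntry.zero (b r i : ℕ) (prev : ℕ → ℤ) (s : ℕ) :
    IsEntry A b r i prev s 0 (prev s) 0 :=
  ⟨.inr rfl, by simp, by simp [cost_zero], le_rfl, fun k hk => absurd hk (Nat.not_lt_zero _)⟩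

theorem IsEntry.skip {b r i s K ch : ℕ} {prev : ℕ → ℤ} {v : ℤ}
    (h : IsEntry A b r i prev s K v ch)
    (hK : min K b ≤ s → v ≤ prev (s - min K b) + A.cost b r i K) :
    IsEntry A b r i prev s (K + 1) v ch := by
  refine ⟨h.lt.imp_left fun h => by omega, h.unit_le, h.eq, h.le_prev, fun k hk hs => ?_⟩
  obtain hk | rfl : k < K ∨ k = K := by omega
  · exact h.le k hk hs
  · exact hK hs

theorem IsEntry.replace {b r i s K ch : ℕ} {prev : ℕ → ℤ} {v : ℤ}
    (h : IsEntry A b r i prev s K v ch) (hs : min K b ≤ s)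
    (hK : prev (s - min K b) + A.cost b r i K < v) :
    IsEntry A b r i prev s (K + 1) (prev (s - min K b) + A.cost b r i K) K := by
  refine ⟨.inl (by omega), hs, rfl, hK.le.trans h.le_prev, fun k hk hs' => ?_⟩
  obtain hk | rfl : k < K ∨ k = K := by omega
  · exact hK.le.trans (h.le k hk hs')
  · exact le_rfl

/-- The first `L + 1` rows of the dynamic program for part `j`. -/
structure IsTable (A : Data) (b r j W L : ℕ) (V : ℕ → ℕ → ℤ) (ch : ℕ → ℕ → ℕ) : Prop where
  zero : ∀ s < W, V 0 s = if s = 0 then 0 else A.penalty b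
  entry : ∀ i < L, ∀ s < W, IsEntry A b r i (V i) s (A.options b j i) (V (i + 1) s) (ch i s)

section Table

variable {b r j W L : ℕ} {V : ℕ → ℕ → ℤ} {ch : ℕ → ℕ → ℕ} (h : IsTable A b r j W L V ch)

include hA h in
-- Entries never increase from row to row, since choice `0` is free; so the penalty of the first row
-- bounds the whole table, which keeps the numbers short.
theorem IsTable.bounds {i : ℕ} (hi : i ≤ L) {s : ℕ} (hs : s < W) :
    0 ≤ V i s ∧ V i s ≤ A.penalty b := by
  induction i generalizing s with
  | zero =>
    have := penalty_pos hA b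
    rw [h.zero s hs]
    split_ifs <;> omega
  | succ i ih =>
    have he := h.entry i (by omega) s hs
    refine ⟨?_, he.le_prev.trans (ih (by omega) hs).2⟩
    rw [he.eq]
    exact add_nonneg (ih (by omega) (by omega)).1 (cost_nonneg hA _ _ _ _)

include h in
-- Bellman's inequality, iterated from the last item to the first.
theorem IsTable.le (κ : ℕ → ℕ) (hκ : ∀ i < L, κ i < A.options b j i) {i : ℕ} (hi : i ≤ L) {s : ℕ}
    (hs : s < W) (hsum : ∑ i' ∈ range i, min (κ i') b ≤ s) :
    V i s ≤ V 0 (s - ∑ i' ∈ range i, min (κ i') b) +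
      ∑ i' ∈ range i, A.cost b r i' (κ i') := by
  induction i generalizing s with
  | zero => simp
  | succ i ih =>
    rw [sum_range_succ] at hsum
    have he := (h.entry i (by omega) s hs).le (κ i) (hκ i (by omega)) (by omega)
    have := ih (by omega) (s := s - min (κ i) b) (by omega) (by omega)
    rw [sum_range_succ, sum_range_succ]
    rw [show s - min (κ i) b - ∑ i' ∈ range i, min (κ i') b =
      s - (∑ i' ∈ range i, min (κ i') b + min (κ i) b) by omega] at this
    linarith

end Table

/-- State of backtracking after the choices for the last `t` items have been fixed: `cur` units
remain to be distributed. -/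
structure IsBacktrack (A : Data) (b r j : ℕ) (V : ℕ → ℕ → ℤ) (s₀ t cur : ℕ) (κ : ℕ → ℕ) :
    Prop where
  le : ∀ i ∈ Ico (A.n - t) A.n, A.part i = j → κ i ≤ b + 1
  units : cur + ∑ i ∈ Ico (A.n - t) A.n, (if A.part i = j then min (κ i) b else 0) = s₀
  value : V (A.n - t) cur +
    ∑ i ∈ Ico (A.n - t) A.n, (if A.part i = j then A.cost b r i (κ i) else 0) = V A.n s₀

theorem IsBacktrack.zero (b r j : ℕ) (V : ℕ → ℕ → ℤ) (s₀ : ℕ) (κ : ℕ → ℕ) :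
    IsBacktrack A b r j V s₀ 0 s₀ κ := by
  constructor <;> simp

/-- The recorded choice attains its entry, so following it shifts its cost and its units from the
table and the state to the two sums. An item of another part has the single option `0` and shifts
nothing. Only the choices for part `j` must agree, because the other cells of the solution may hold
anything. -/
theorem IsBacktrack.succ {b r j W s₀ t cur : ℕ} {V : ℕ → ℕ → ℤ} {ch : ℕ → ℕ → ℕ} {κ κ' : ℕ → ℕ}
    (hV : IsTable A b r j W A.n V ch) (h : IsBacktrack A b r j V s₀ t cur κ) (ht : t < A.n)
    (hs : s₀ < W) {k : ℕ} (hk : k = ch (A.n - t - 1) cur)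
    (hκ : ∀ i ∈ Ico (A.n - t) A.n, A.part i = j → κ' i = κ i)
    (hκ' : A.part (A.n - t - 1) = j → κ' (A.n - t - 1) = k) :
    min k b ≤ cur ∧ IsBacktrack A b r j V s₀ (t + 1) (cur - min k b) κ' := by
  have hcur : cur < W := by have := h.units; omega
  set i := A.n - t - 1 with hi
  have e1 : A.n - t = i + 1 := by omega
  have e2 : A.n - (t + 1) = i := by omega
  have he := hV.entry i (by omega) cur hcur
  rw [← hk] at he
  have hIco : Ico i A.n = insert i (Ico (i + 1) A.n) := (insert_Ico_add_one_left_eq_Ico (by omega)).symm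
  have hni : i ∉ Ico (i + 1) A.n := by simp
  have hlt : k < A.options b j i := by
    obtain h | h := he.lt
    · exact h
    · rw [h, options]; split_ifs <;> omega
  have hk0 : A.part i ≠ j → k = 0 := fun hp => by
    rw [options, if_neg hp] at hlt; omega
  have c1 : ∑ i' ∈ Ico (i + 1) A.n, (if A.part i' = j then min (κ' i') b else 0) =
      ∑ i' ∈ Ico (i + 1) A.n, (if A.part i' = j then min (κ i') b else 0) :=
    sum_congr rfl fun i' hi' => by
      split_ifs with hp
      · rw [hκ i' (e1 ▸ hi') hp]
      · rfl
  have c2 : ∑ i' ∈ Ico (i + 1) A.n, (if A.part i' = j then A.cost b r i' (κ' i') else 0) =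
      ∑ i' ∈ Ico (i + 1) A.n, (if A.part i' = j then A.cost b r i' (κ i') else 0) :=
    sum_congr rfl fun i' hi' => by
      split_ifs with hp
      · rw [hκ i' (e1 ▸ hi') hp]
      · rfl
  have hle := h.le
  have hunits := h.units
  have hvalue := h.value
  rw [e1] at hle hunits hvalue hκ
  have hu := he.unit_le
  refine ⟨hu, ?_, ?_, ?_⟩
  · rw [e2, hIco]
    intro i' hi' hp
    rw [mem_insert] at hi'
    obtain rfl | hi' := hi'
    · rw [hκ' hp]
      rw [options, if_pos hp] at hlt
      omega
    · rw [hκ i' hi' hp]; exact hle i' hi' hp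
  · rw [e2, hIco, sum_insert hni, c1, ← hunits]
    split_ifs with hp
    · rw [hκ' hp]; omega
    · rw [hk0 hp]; simp
  · rw [e2, hIco, sum_insert hni, c2, ← hvalue, he.eq]
    split_ifs with hp
    · rw [hκ' hp]; ring
    · rw [hk0 hp]; simp [cost_zero]

/-- The choices `κ` for the items of part `j` are optimal with cost `v`. -/
structure IsPartOptimal (A : Data) (b r j : ℕ) (κ : ℕ → ℕ) (v : ℤ) : Prop where
  le : ∀ i < A.n, A.part i = j → κ i ≤ b + 1
  units : ∑ i ∈ range A.n, (if A.part i = j then min (κ i) b else 0) = b * A.p j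
  value : ∑ i ∈ range A.n, (if A.part i = j then A.cost b r i (κ i) else 0) = v
  optimal : ∀ κ' : ℕ → ℕ, (∀ i < A.n, A.part i = j → κ' i ≤ b + 1) →
    ∑ i ∈ range A.n, (if A.part i = j then min (κ' i) b else 0) = b * A.p j →
    v ≤ ∑ i ∈ range A.n, (if A.part i = j then A.cost b r i (κ' i) else 0)

include hA in
-- Giving all `b` units to `p j` items is feasible; a feasible choice is needed so that the optimum
-- stays below the penalty.
theorem exists_units_eq {j : ℕ} (hj : j < A.m) (b : ℕ) :
    ∃ κ : ℕ → ℕ, (∀ i < A.n, A.part i = j → κ i ≤ b + 1) ∧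
      ∑ i ∈ range A.n, (if A.part i = j then min (κ i) b else 0) = b * A.p j := by
  obtain ⟨S, hS, hc⟩ := exists_subset_card_eq (hA.p_le j hj)
  refine ⟨fun i => if i ∈ S then b else 0, fun i _ _ => by simp only; split_ifs <;> omega, ?_⟩
  have : ∀ i ∈ range A.n, (if A.part i = j then min (if i ∈ S then b else 0) b else 0) =
      if i ∈ S then b else 0 := by
    intro i _
    by_cases hi : i ∈ S
    · have := (mem_filter.1 (hS hi)).2
      simp [hi, this]
    · simp [hi]
  rw [sum_congr rfl this, ← sum_filter, filter_mem_eq_inter,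
    inter_eq_right.2 (hS.trans (filter_subset _ _)), sum_const, hc, smul_eq_mul, mul_comm]

include hA in
-- If units were left over at the first row, the value would contain the penalty, while some
-- feasible choice is cheaper. So the traced choices use exactly `b * A.p j` units.
theorem IsBacktrack.isPartOptimal {b r j W cur : ℕ} {V : ℕ → ℕ → ℤ} {ch : ℕ → ℕ → ℕ}
    {κ : ℕ → ℕ} (hj : j < A.m) (hV : IsTable A b r j W A.n V ch) (hW : b * A.p j < W)
    (h : IsBacktrack A b r j V (b * A.p j) A.n cur κ) :
    IsPartOptimal A b r j κ (V A.n (b * A.p j)) := by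
  obtain ⟨hle, hunits, hvalue⟩ := h
  simp only [Nat.sub_self, Nat.Ico_zero_eq_range] at hle hunits hvalue
  have hopt : ∀ κ' : ℕ → ℕ, (∀ i < A.n, A.part i = j → κ' i ≤ b + 1) →
      ∑ i ∈ range A.n, (if A.part i = j then min (κ' i) b else 0) = b * A.p j →
      V A.n (b * A.p j) ≤
        ∑ i ∈ range A.n, (if A.part i = j then A.cost b r i (κ' i) else 0) := by
    intro κ' h1 h2
    have e1 (i : ℕ) : min (if A.part i = j then κ' i else 0) b =
        if A.part i = j then min (κ' i) b else 0 := by split_ifs <;> simp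
    have e2 (i : ℕ) : A.cost b r i (if A.part i = j then κ' i else 0) =
        if A.part i = j then A.cost b r i (κ' i) else 0 := by split_ifs <;> simp [cost_zero]
    have := hV.le (fun i => if A.part i = j then κ' i else 0) (fun i hi => by
      unfold options
      split_ifs with hp
      · have := h1 i hi hp; omega
      · exact Nat.one_pos) le_rfl hW (by simp only [e1, h2, le_refl])
    simp only [e1, e2, h2, Nat.sub_self, hV.zero 0 (by omega)] at this
    simpa using this
  obtain ⟨κ₀, h1, h2⟩ := exists_units_eq hA hj b
  have hlt := (hopt κ₀ h1 h2).trans_lt (sum_cost_lt_penalty hA b r κ₀ _)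
  have hnn : 0 ≤ ∑ i ∈ range A.n, (if A.part i = j then A.cost b r i (κ i) else 0) :=
    sum_nonneg fun i _ => by
      have := cost_nonneg hA b r i (κ i)
      split_ifs <;> omega
  have hz := hV.zero cur (by omega)
  have hcur : cur = 0 := by
    by_contra hne
    rw [if_neg hne] at hz
    omega
  subst hcur
  refine ⟨fun i hi => hle i (mem_range.2 hi), by omega, ?_, hopt⟩
  rw [if_pos rfl] at hz
  omega

theorem IsPartOptimal.congr {b r j : ℕ} {κ κ' : ℕ → ℕ} {v : ℤ} (h : IsPartOptimal A b r j κ v)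
    (hκ : ∀ i < A.n, A.part i = j → κ' i = κ i) : IsPartOptimal A b r j κ' v := by
  refine ⟨fun i hi hp => hκ i hi hp ▸ h.le i hi hp, ?_, ?_, h.optimal⟩
  · rw [← h.units]
    refine sum_congr rfl fun i hi => ?_
    split_ifs with hp
    · rw [hκ i (mem_range.1 hi) hp]
    · rfl
  · rw [← h.value]
    refine sum_congr rfl fun i hi => ?_
    split_ifs with hp
    · rw [hκ i (mem_range.1 hi) hp]
    · rfl

/-- The choices `κ` are optimal for the threshold `r / b`, with total cost `v`. -/
structure IsOptimalAt (A : Data) (b r : ℕ) (κ : ℕ → ℕ) (v : ℤ) : Prop where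
  isChoice : A.IsChoice b κ
  value : A.total b r κ = v
  optimal : ∀ κ', A.IsChoice b κ' → v ≤ A.total b r κ'

include hA in
-- Once the threshold is fixed, the budget term is constant and nothing else links different parts.
theorem isOptimalAt_of_parts {b r : ℕ} {κ : ℕ → ℕ} {v : ℕ → ℤ}
    (h : ∀ j < A.m, IsPartOptimal A b r j κ (v j)) :
    IsOptimalAt A b r κ (∑ j ∈ range A.m, v j + A.Γ * r) := by
  have hswap (κ : ℕ → ℕ) : ∑ i ∈ range A.n, A.cost b r i (κ i) = ∑ j ∈ range A.m,
      ∑ i ∈ range A.n, (if A.part i = j then A.cost b r i (κ i) else 0) := by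
    rw [sum_comm]
    refine sum_congr rfl fun i hi => ?_
    rw [sum_ite_eq, if_pos (mem_range.2 (hA.part_lt i (mem_range.1 hi)))]
  refine ⟨⟨fun i hi => (h _ (hA.part_lt i hi)).le i hi rfl, fun j hj => (h j hj).units⟩, ?_,
    fun κ' hκ' => ?_⟩
  · rw [total, hswap, sum_congr rfl fun j hj => (h j (mem_range.1 hj)).value]
  · rw [total, hswap]
    gcongr with j hj
    exact (h j (mem_range.1 hj)).optimal κ' (fun i hi _ => hκ'.1 i hi) (hκ'.2 j (mem_range.1 hj))

end Data

end MultiRepSel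

namespace MultiRepSel

open Finset RAM

/-! ### The program that solves the problem for one threshold

Banks: `2` `n`, `3` `m`, `6` scaled costs, `7` the common denominator, `18` sum of the costs,
`19` row width of the tables, `20` `b`, `21` `r`, `22` part, `23` item, `24` state, `25` choice,
`26` units and `27` cost of the choice, `28` and `29` entry of the tables, `30` number of choices,
`31` and `32` tables of costs and choices, `33` solution, `34` total cost, `35` and `36` state and
step of backtracking, `40` penalty. -/

namespace Program

open RAM.Expr (var load)

/-- Guards test positivity, so `k ≤ b` is expressed as `0 < b - k + 1`. -/
def optionCost : Cmd :=
  .ite (var 20 - var 25 + 1)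
    (.block [.set 26 (var 25), .set 27 (load 6 (var 2 + var 23) * var 25),
      .ite (var 25 - var 21)
        (.set 27 (var 27 + load 6 (2 * var 2 + var 23) * (var 25 - var 21))) .skip])
    (.block [.set 26 (var 20), .set 27 (load 6 (var 23) * var 20)])

def tryOption : Cmd :=
  .seq optionCost
    (.ite (var 24 - var 26 + 1)
      (.ite (var 28 - (load 31 (var 23 * var 19 + (var 24 - var 26)) + var 27))
        (.block [.set 28 (load 31 (var 23 * var 19 + (var 24 - var 26)) + var 27),
          .set 29 (var 25)])
        .skip)
      .skip)

def entry : Cmd :=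
  .block [.set 28 (load 31 (var 23 * var 19 + var 24)), .set 29 0,
    .forLoop 25 (var 30) tryOption,
    .store 31 ((var 23 + 1) * var 19 + var 24) (var 28),
    .store 32 (var 23 * var 19 + var 24) (var 29)]

/-- Runs `c₁` if the current item belongs to the current part, and `c₂` otherwise. -/
def ifInPart (c₁ c₂ : Cmd) : Cmd :=
  .ite (1 - (load 0 (4 + var 23) - var 22) * (load 0 (4 + var 23) - var 22)) c₁ c₂

def row : Cmd :=
  .block [ifInPart (.set 30 (var 20 + 2)) (.set 30 1), .forLoop 24 (var 19) entry]

def table : Cmd :=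
  .block [.forLoop 24 (var 19) (.store 31 (var 24) (var 40)), .store 31 0 0,
    .forLoop 23 (var 2) row]

def backStep : Cmd :=
  .block [.set 23 (var 2 - 1 - var 36), .set 29 (load 32 (var 23 * var 19 + var 35)),
    .ite (var 20 - var 29 + 1) (.set 26 (var 29)) (.set 26 (var 20)),
    .set 35 (var 35 - var 26),
    ifInPart (.store 33 (var 23) (var 29)) .skip]

def backtrack : Cmd :=
  .block [.set 35 (var 20 * load 0 (4 + var 2 + var 22)), .forLoop 36 (var 2) backStep]

def solvePart : Cmd :=
  .block [table, backtrack,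
    .set 34 (var 34 + load 31 (var 2 * var 19 + var 20 * load 0 (4 + var 2 + var 22)))]

def solveThreshold : Cmd :=
  .block [.set 40 (var 20 * var 18 + 1), .set 34 0, .forLoop 22 (var 3) solvePart,
    .set 34 (var 34 + load 6 (3 * var 2) * var 21)]

end Program

/-! ### Memory layout, size bounds and the cost of a choice -/

namespace Data

/-- Width of the rows of the tables. -/
def width (A : Data) : ℕ := (A.n + 2) * (A.n + 2)

/-- The memory holds the data. -/
structure Holds (A : Data) (D : ℤ) (s : Memory) : Prop where
  n_eq : s 2 0 = A.n
  m_eq : s 3 0 = A.m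
  part_eq : ∀ i < A.n, s 0 (4 + i) = A.part i
  p_eq : ∀ j < A.m, s 0 (4 + A.n + j) = A.p j
  C_eq : ∀ i < A.n, s 6 i = A.C i
  c_eq : ∀ i < A.n, s 6 (A.n + i) = A.c i
  d_eq : ∀ i < A.n, s 6 (2 * A.n + i) = A.d i
  Γ_eq : s 6 (3 * A.n) = A.Γ
  D_eq : s 7 0 = D
  sum_eq : s 18 0 = A.costSum
  width_eq : s 19 0 = A.width

/-- The memory holds the data and the threshold `r / b`. -/
structure HoldsThreshold (A : Data) (D : ℤ) (b r : ℕ) (s : Memory) : Prop extends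
    A.Holds D s where
  b_eq : s 20 0 = b
  r_eq : s 21 0 = r
  le : b ≤ A.n + 1
  r_le : r ≤ b

theorem Holds.of_agree {A : Data} {D : ℤ} {s s' : Memory} (h : A.Holds D s)
    (hs : ∀ b ∈ [0, 2, 3, 6, 7, 18, 19], s' b = s b) : A.Holds D s' := by
  have h0 := hs 0 (by simp)
  have h2 := hs 2 (by simp)
  have h3 := hs 3 (by simp)
  have h6 := hs 6 (by simp)
  have h7 := hs 7 (by simp)
  have h18 := hs 18 (by simp)
  have h19 := hs 19 (by simp)
  obtain ⟨⟩ := h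
  constructor <;> simpa only [h0, h2, h3, h6, h7, h18, h19]

theorem HoldsThreshold.of_agree {A : Data} {D : ℤ} {b r : ℕ} {s s' : Memory}
    (h : A.HoldsThreshold D b r s)
    (hs : ∀ b ∈ [0, 2, 3, 6, 7, 18, 19, 20, 21], s' b = s b) : A.HoldsThreshold D b r s' := by
  refine ⟨h.toHolds.of_agree fun b hb => hs b ?_, ?_, ?_, h.le, h.r_le⟩
  · simp only [List.mem_cons, List.not_mem_nil, or_false] at hb ⊢; tauto
  · rw [hs 20 (by simp), h.b_eq]
  · rw [hs 21 (by simp), h.r_eq]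

/-- `N` and `B` are large enough for the data. -/
structure Fits (A : Data) (D : ℤ) (N B : ℕ) : Prop where
  loops : (A.n + A.m + 3) ^ 2 ≤ N
  numbers : ∀ z : ℤ, 0 ≤ z → z ≤ (A.n + A.m + 3) ^ 2 * (A.costSum + A.Γ + D + 1) → bits z ≤ B

section

variable {A : Data} {D : ℤ} {N B b r : ℕ} {s : Memory} (hA : A.Valid) (hD : 0 ≤ D)
  (hfit : A.Fits D N B)

include hA hD hfit in
theorem Fits.bits_nat {k : ℕ} (hk : k ≤ (A.n + A.m + 3) ^ 2) : bits (k : ℤ) ≤ B := by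
  refine hfit.numbers k (by positivity) ?_
  have h1 : (k : ℤ) ≤ (A.n + A.m + 3) ^ 2 := by exact_mod_cast hk
  have h2 := costSum_nonneg hA
  have h3 := hA.Γ_nonneg
  nlinarith [sq_nonneg ((A.n : ℤ) + A.m + 3)]

include hA hD hfit in
theorem Fits.bits_small {k : ℕ} (hk : k ≤ A.n + A.m + 3) : bits (k : ℤ) ≤ B :=
  hfit.bits_nat hA hD (hk.trans (Nat.le_self_pow two_ne_zero _))

include hA hD hfit in
theorem Fits.bits_sum {z : ℤ} (h0 : 0 ≤ z) {k : ℕ} (hk : k ≤ (A.n + A.m + 3) ^ 2)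
    (hz : z ≤ k * (A.costSum + A.Γ + D + 1)) : bits z ≤ B := by
  refine hfit.numbers z h0 (hz.trans ?_)
  have h1 : (k : ℤ) ≤ (A.n + A.m + 3) ^ 2 := by exact_mod_cast hk
  have h2 := costSum_nonneg hA
  have h3 := hA.Γ_nonneg
  exact mul_le_mul_of_nonneg_right h1 (by linarith)

include hA in
theorem le_costSum {i : ℕ} (hi : i < A.n) : A.C i + A.c i + A.d i ≤ A.costSum :=
  single_le_sum (f := fun i => A.C i + A.c i + A.d i) (fun i _ => by
    have := hA.C_nonneg i
    have := hA.c_nonneg i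
    have := hA.d_nonneg i
    linarith) (mem_range.2 hi)

include hA hD hfit in
theorem Fits.bits_penalty (hb : b ≤ A.n + 1) {z : ℤ} (h0 : 0 ≤ z) (hz : z ≤ A.penalty b) :
    bits z ≤ B := by
  refine hfit.bits_sum hA hD h0 (k := A.n + 1)
    ((show A.n + 1 ≤ A.n + A.m + 3 by omega).trans (Nat.le_self_pow two_ne_zero _)) (hz.trans ?_)
  have h1 : (b : ℤ) ≤ A.n + 1 := by exact_mod_cast hb
  have h2 := costSum_nonneg hA
  have h3 := hA.Γ_nonneg
  have h4 := mul_le_mul_of_nonneg_right h1 h2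
  unfold penalty
  push_cast
  nlinarith

include hA hD hfit in
theorem wp_optionCost (h : A.HoldsThreshold D b r s) {i k : ℕ} (hi : i < A.n) (hk : k ≤ b + 1)
    (h23 : s 23 0 = i) (h25 : s 25 0 = k) :
    WP N B Program.optionCost s fun s' => s' 26 0 = (min k b : ℕ) ∧ s' 27 0 = A.cost b r i k := by
  have hbn := h.le
  have hpen : ∀ z : ℤ, 0 ≤ z → z ≤ b * (A.C i + A.c i + A.d i) → bits z ≤ B := by
    intro z h0 hz
    refine hfit.bits_penalty hA hD h.le h0 (hz.trans ?_)
    have := mul_le_mul_of_nonneg_left (le_costSum hA hi) (Int.natCast_nonneg b)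
    unfold penalty
    linarith
  have hC := hA.C_nonneg i
  have hc := hA.c_nonneg i
  have hd := hA.d_nonneg i
  have hcost := hpen _ (cost_nonneg hA b r i k) (cost_le hA b r i k)
  unfold cost at hcost ⊢
  by_cases hkb : k ≤ b
  · have hkb' : (k : ℤ) ≤ b := by exact_mod_cast hkb
    have e1 : bits (k : ℤ) ≤ B := hfit.bits_small hA hD (by omega)
    have e2 : bits (A.c i * k) ≤ B := hpen _ (by positivity) (by nlinarith)
    rw [if_pos hkb] at hcost ⊢
    by_cases hkr : r < k
    · have hkr' : ((k - r : ℕ) : ℤ) = k - r := by push_cast [hkr.le]; rfl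
      rw [hkr'] at hcost ⊢
      simp [Program.optionCost, write, Expr.eval, h.b_eq, h.r_eq, h.n_eq, h.c_eq i hi, h.d_eq i hi,
        h23, h25, e1, e2, hkr, hkb, hcost, show (0 : ℤ) < b - k + 1 by omega]
    · have hkr' : ((k - r : ℕ) : ℤ) = 0 := by simp; omega
      simp [Program.optionCost, write, Expr.eval, h.b_eq, h.r_eq, h.n_eq, h.c_eq i hi,
        h23, h25, e1, e2, hkr, hkb, hkr', show (0 : ℤ) < b - k + 1 by omega]
  · have e1 : bits (b : ℤ) ≤ B := hfit.bits_small hA hD (by omega)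
    rw [if_neg hkb] at hcost ⊢
    simp [Program.optionCost, write, Expr.eval, h.b_eq, h.C_eq i hi, h23, h25, e1, hcost, show ¬ (0 : ℤ) < b - k + 1 by omega, show b ≤ k by omega]

end

end Data

end MultiRepSel

/-! ### Correctness of the entries and rows of the table -/

namespace MultiRepSel

open Finset RAM

namespace Data

variable {A : Data} {D : ℤ} {N B b r : ℕ} {s : Memory} (hA : A.Valid) (hD : 0 ≤ D)
  (hfit : A.Fits D N B)

include hA hD hfit in
theorem wp_tryOption (h : A.HoldsThreshold D b r s) {i k st ch : ℕ} {v : ℤ} {prev : ℕ → ℤ}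
    (hi : i < A.n) (hk : k ≤ b + 1)
    (hprev : ∀ st' ≤ st, s 31 (i * A.width + st' : ℕ) = prev st')
    (hbd : ∀ st' ≤ st, 0 ≤ prev st' ∧ prev st' ≤ A.penalty b)
    (h23 : s 23 0 = i) (h24 : s 24 0 = st) (h25 : s 25 0 = k) (h28 : s 28 0 = v)
    (h29 : s 29 0 = ch) (he : IsEntry A b r i prev st k v ch) :
    WP N B Program.tryOption s fun s' => ∃ v' ch', s' 28 0 = v' ∧ s' 29 0 = (ch' : ℕ) ∧
      IsEntry A b r i prev st (k + 1) v' ch' := by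
  rw [Program.tryOption, wp_seq]
  refine (wp_optionCost hA hD hfit h hi hk h23 h25).imp fun s' hf ⟨h26, h27⟩ => ?_
  have f (x : ℕ) (hx : x ∉ Program.optionCost.writes) : s' x = s x := hf x hx
  have f19 := f 19 (by decide)
  have f23 := f 23 (by decide)
  have f24 := f 24 (by decide)
  have f25 := f 25 (by decide)
  have f28 := f 28 (by decide)
  have f29 := f 29 (by decide)
  have f31 := f 31 (by decide)
  -- A choice replaces the current entry only if its units fit into the state and it is strictly
  -- cheaper; in both other cases `IsEntry.skip` applies.
  by_cases hu : min k b ≤ st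
  · have e1 : (0 : ℤ) < s' 24 0 - s' 26 0 + 1 := by
      rw [f24, h24, h26]; omega
    have e2 : s' 31 (s' 23 0 * s' 19 0 + (s' 24 0 - s' 26 0)) = prev (st - min k b) := by
      rw [f31, f23, f19, f24, h23, h24, h26, h.width_eq, ← hprev _ (Nat.sub_le _ _)]
      congr 1
      push_cast [hu]
      ring
    by_cases hv : prev (st - min k b) + A.cost b r i k < v
    · have hbits : bits (prev (st - min k b) + A.cost b r i k) ≤ B := by
        refine hfit.bits_penalty hA hD h.le
          (add_nonneg (hbd _ (Nat.sub_le _ _)).1 (cost_nonneg hA _ _ _ _)) ?_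
        exact hv.le.trans (he.le_prev.trans (hbd _ le_rfl).2)
      have hbk : bits (k : ℤ) ≤ B := hfit.bits_small hA hD (by have := h.le; omega)
      have e3 : 0 < v - (prev (st - min k b) + A.cost b r i k) := by omega
      have hkk : s' 25 0 = k := by rw [f25, h25]
      simp only [wp_ite, Expr.eval_add, Expr.eval_sub, Expr.eval_mul, Expr.eval_var,
        Expr.eval_load, Expr.eval_one, e1, e2, f28, h28, h27, e3, if_true, wp_block_cons,
        wp_block_singleton, wp_set]
      refine ⟨hbits, ?_, _, k, ?_, ?_, he.replace hu hv⟩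
      · simpa [write, hkk] using hbk
      · simp [write]
      · simp [write, hkk]
    · have e3 : ¬ 0 < v - (prev (st - min k b) + A.cost b r i k) := by omega
      simp only [wp_ite, Expr.eval_add, Expr.eval_sub, Expr.eval_mul, Expr.eval_var,
        Expr.eval_load, Expr.eval_one, e1, e2, f28, h28, h27, e3, if_true, if_false, wp_skip]
      exact ⟨v, ch, rfl, by rw [f29, h29], he.skip fun _ => by omega⟩
  · have e1 : ¬ (0 : ℤ) < s' 24 0 - s' 26 0 + 1 := by
      rw [f24, h24, h26]; omega
    simp only [wp_ite, Expr.eval_add, Expr.eval_sub, Expr.eval_var, Expr.eval_one, e1, if_false,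
      wp_skip]
    exact ⟨v, ch, by rw [f28, h28], by rw [f29, h29], he.skip fun h => absurd h hu⟩

include hA hD hfit in
theorem wp_entry (h : A.HoldsThreshold D b r s) {i K st : ℕ} {prev : ℕ → ℤ}
    (hi : i < A.n) (hK : K ≤ b + 2)
    (hprev : ∀ st' ≤ st, s 31 (i * A.width + st' : ℕ) = prev st')
    (hbd : ∀ st' ≤ st, 0 ≤ prev st' ∧ prev st' ≤ A.penalty b)
    (h23 : s 23 0 = i) (h24 : s 24 0 = st) (h30 : s 30 0 = K) :
    WP N B Program.entry s fun s' => ∃ v ch, IsEntry A b r i prev st K v ch ∧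
      (∀ a, s' 31 a = if a = ((i + 1) * A.width + st : ℕ) then v else s 31 a) ∧
      (∀ a, s' 32 a = if a = (i * A.width + st : ℕ) then (ch : ℤ) else s 32 a) := by
  have hle := h.le
  have e0 : s 31 (s 23 0 * s 19 0 + s 24 0) = prev st := by
    rw [h23, h24, h.width_eq, ← hprev st le_rfl]; push_cast; rfl
  simp only [Program.entry, wp_block_cons, wp_set, Expr.eval_load, Expr.eval_add, Expr.eval_mul,
    Expr.eval_var, e0]
  refine ⟨hfit.bits_penalty hA hD h.le (hbd st le_rfl).1 (hbd st le_rfl).2, ?_, ?_⟩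
  · simpa using hfit.bits_small hA hD (k := 0) (by omega)
  set s₁ := write (write s 28 0 (prev st)) 29 0 (Expr.eval (write s 28 0 (prev st)) 0) with hs₁
  have g (x : ℕ) (h28 : x ≠ 28) (h29 : x ≠ 29) : s₁ x = s x := by
    rw [hs₁, write_apply_ne _ _ _ h29, write_apply_ne _ _ _ h28]
  refine wp_forLoop (fun k s' => ∃ v ch, s' 28 0 = v ∧ s' 29 0 = (ch : ℕ) ∧
      IsEntry A b r i prev st k v ch) K ?_ (hfit.bits_small hA hD (by omega)) (by decide) ?_
      ⟨prev st, 0, by simp [hs₁, write], by simp [hs₁, write], .zero _ _ _ _ _⟩ ?_ ?_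
  · have := hfit.loops
    have := Nat.le_self_pow two_ne_zero (A.n + A.m + 3)
    omega
  · intro s' hf
    rw [Expr.eval_var, hf 30 (by decide), g 30 (by decide) (by decide), h30]
  · rintro k hk s' hf h25 ⟨v, ch, hv, hch, he⟩
    have f (x : ℕ) (hx : x ∉ 25 :: Program.tryOption.writes) : s' x = s x := by
      have hw : (Cmd.forLoop 25 (.var 30) Program.tryOption).writes =
        25 :: (Program.tryOption.writes ++ [25]) := rfl
      rw [hf x (by rw [hw]; simp at hx ⊢; tauto), g x]
      · rintro rfl; revert hx; decide
      · rintro rfl; revert hx; decide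
    have h' : A.HoldsThreshold D b r s' := h.of_agree fun x hx => f x (by revert x; decide)
    refine (wp_tryOption hA hD hfit h' hi (by omega) (fun st' hst => ?_) hbd ?_ ?_ h25 hv hch
      he).imp fun s'' hf' ⟨v', ch', h1, h2, h3⟩ => ⟨v', ch', ?_, ?_, h3⟩
    · rw [f 31 (by decide), hprev st' hst]
    · rw [f 23 (by decide), h23]
    · rw [f 24 (by decide), h24]
    · simpa [write] using h1
    · simpa [write] using h2
  · rintro s' hf h25 ⟨v, ch, hv, hch, he⟩
    have f (x : ℕ) (hx : x ∉ 25 :: Program.tryOption.writes) : s' x = s x := by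
      have hw : (Cmd.forLoop 25 (.var 30) Program.tryOption).writes =
        25 :: (Program.tryOption.writes ++ [25]) := rfl
      rw [hf x (by rw [hw]; simp at hx ⊢; tauto), g x]
      · rintro rfl; revert hx; decide
      · rintro rfl; revert hx; decide
    have f19 := f 19 (by decide)
    have f23 := f 23 (by decide)
    have f24 := f 24 (by decide)
    have f31 := f 31 (by decide)
    have f32 := f 32 (by decide)
    have hv0 : 0 ≤ v := by
      rw [he.eq]
      exact add_nonneg (hbd _ (Nat.sub_le _ _)).1 (cost_nonneg hA _ _ _ _)
    have hb1 : bits v ≤ B :=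
      hfit.bits_penalty hA hD h.le hv0 (he.le_prev.trans (hbd _ le_rfl).2)
    have hb2 : bits (ch : ℤ) ≤ B := hfit.bits_small hA hD (by have := he.lt; omega)
    simp only [wp_block_singleton, wp_store, Expr.eval_add, Expr.eval_mul,
      Expr.eval_var, Expr.eval_one]
    refine ⟨by rwa [hv], ?_, v, ch, he, fun a => ?_, fun a => ?_⟩
    · simpa [write, hch] using hb2
    · simp [write, f31, f23, f24, f19, h23, h24, h.width_eq, hv]
    · simp [write, f32, f23, f24, f19, h23, h24, h.width_eq, hch]

/-- Uniqueness of division with remainder: a store to one cell of the table leaves the other entries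
intact. -/
theorem row_ne {W i i' st st' : ℕ} (hst : st < W) (hst' : st' < W) (h : i ≠ i' ∨ st ≠ st') :
    i * W + st ≠ i' * W + st' := by
  intro he
  have h1 := congrArg (· / W) he
  have h2 := congrArg (· % W) he
  have hW : 0 < W := by omega
  simp only [mul_comm _ W, Nat.mul_add_div hW, Nat.div_eq_of_lt hst, Nat.div_eq_of_lt hst',
    Nat.mul_add_mod, Nat.mod_eq_of_lt hst, Nat.mod_eq_of_lt hst'] at h1 h2
  omega

/-- For integers, `1 - z * z` is positive exactly when `z = 0`; this expresses equality as a guard.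
-/
theorem wp_ifInPart {D : ℤ} (h : A.Holds D s) {i j : ℕ} (hi : i < A.n) (h23 : s 23 0 = i)
    (h22 : s 22 0 = j) {c₁ c₂ : Cmd} {Q : Memory → Prop} :
    WP N B (Program.ifInPart c₁ c₂) s Q ↔
      if A.part i = j then WP N B c₁ s Q else WP N B c₂ s Q := by
  have e : (0 : ℤ) < 1 - ((A.part i : ℤ) - j) * (A.part i - j) ↔ A.part i = j := by
    constructor
    · intro h
      by_contra hne
      have : (A.part i : ℤ) - j ≠ 0 := by omega
      have := mul_self_pos.2 this
      omega
    · rintro h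
      simp [h]
  simp only [Program.ifInPart, wp_ite, Expr.eval_sub, Expr.eval_mul, Expr.eval_add, Expr.eval_one,
    Expr.eval_load, Expr.eval_ofNat, Expr.eval_var, h23, h22]
  rw [h.part_eq i hi, if_congr e rfl rfl]

/-- The memory contains the first `L + 1` rows of the dynamic program for part `j`. -/
def HoldsTable (A : Data) (b r j L : ℕ) (V : ℕ → ℕ → ℤ) (ch : ℕ → ℕ → ℕ) (s : Memory) : Prop :=
  IsTable A b r j A.width L V ch ∧
    (∀ i ≤ L, ∀ st < A.width, s 31 (i * A.width + st : ℕ) = V i st) ∧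
    ∀ i < L, ∀ st < A.width, s 32 (i * A.width + st : ℕ) = ch i st

theorem width_le (A : Data) : A.width ≤ (A.n + A.m + 3) ^ 2 := by
  rw [width, sq]
  exact Nat.mul_le_mul (by omega) (by omega)

theorem options_le (b j i : ℕ) : A.options b j i ≤ b + 2 := by
  unfold options; split_ifs <;> omega

include hA hD hfit in
theorem wp_row (h : A.HoldsThreshold D b r s) {i j : ℕ} {V : ℕ → ℕ → ℤ} {ch : ℕ → ℕ → ℕ}
    (hi : i < A.n) (ht : HoldsTable A b r j i V ch s) (h22 : s 22 0 = j) (h23 : s 23 0 = i) :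
    WP N B Program.row s fun s' => ∃ V' ch', HoldsTable A b r j (i + 1) V' ch' s' := by
  obtain ⟨hT, hV, hch⟩ := ht
  have hle := h.le
  simp only [Program.row, wp_block_cons, wp_block_singleton]
  have h30 : WP N B (Program.ifInPart (.set 30 (.var 20 + 2)) (.set 30 1)) s
      fun s' => s' 30 0 = A.options b j i := by
    rw [wp_ifInPart h.toHolds hi h23 h22]
    have e1 := hfit.bits_small hA hD (k := b + 2) (by omega)
    have e2 := hfit.bits_small hA hD (k := 1) (by omega)
    push_cast at e1 e2
    unfold options
    split_ifs <;> simp [write, h.b_eq, e1, e2]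
  refine h30.imp fun s₁ hf₁ h30 => ?_
  have hw : (Cmd.forLoop 24 (.var 19) Program.entry).writes =
    24 :: (Program.entry.writes ++ [24]) := rfl
  have fr (s' : Memory) (hf : Frame (.forLoop 24 (.var 19) Program.entry) s₁ s') (x : ℕ)
      (hx : x ∉ 24 :: 30 :: Program.entry.writes) : s' x = s x := by
    rw [hf x (by rw [hw]; simp at hx ⊢; tauto), hf₁ x]
    intro hx'
    have : (Program.ifInPart (.set 30 (.var 20 + 2)) (.set 30 1)).writes = [30, 30] := rfl
    rw [this] at hx'
    simp at hx hx'
    tauto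
  refine wp_forLoop (fun st s' =>
    (∀ i' ≤ i, ∀ st < A.width, s' 31 (i' * A.width + st : ℕ) = V i' st) ∧
    (∀ i' < i, ∀ st < A.width, s' 32 (i' * A.width + st : ℕ) = ch i' st) ∧
    ∀ st' < st, ∃ v k, s' 31 ((i + 1) * A.width + st' : ℕ) = v ∧
      s' 32 (i * A.width + st' : ℕ) = (k : ℕ) ∧
      IsEntry A b r i (V i) st' (A.options b j i) v k) A.width ?_ ?_ (by decide) ?_ ?_ ?_ ?_
  · exact A.width_le.trans hfit.loops
  · exact hfit.bits_nat hA hD A.width_le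
  · intro s' hf
    rw [Expr.eval_var, fr s' hf 19 (by decide), h.width_eq]
  · have e31 : write s₁ 24 0 0 31 = s 31 := by
      rw [write_apply_ne _ _ _ (by decide), hf₁ 31 (by decide)]
    have e32 : write s₁ 24 0 0 32 = s 32 := by
      rw [write_apply_ne _ _ _ (by decide), hf₁ 32 (by decide)]
    simp only [e31, e32]
    exact ⟨hV, hch, fun st' h => absurd h (Nat.not_lt_zero _)⟩
  · rintro st hst s' hf h24 ⟨hV', hch', hrow⟩
    have f := fr s' hf
    have h' : A.HoldsThreshold D b r s' := h.of_agree fun x hx => f x (by revert x; decide)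
    refine (wp_entry hA hD hfit h' (K := A.options b j i) (prev := V i) hi (options_le _ _ _)
      (fun st' hst' => hV' i le_rfl st' (by omega))
      (fun st' hst' => hT.bounds hA le_rfl (by omega)) ?_ h24 ?_).imp
      fun s'' hf' ⟨v, k, he, h31, h32⟩ => ?_
    · rw [f 23 (by decide), h23]
    · rw [hf 30 (by decide), h30]
    · simp only [write_apply_ne _ _ _ (show 31 ≠ 24 by decide),
        write_apply_ne _ _ _ (show 32 ≠ 24 by decide), h31, h32, Nat.cast_inj]
      refine ⟨fun i' hi' st' hst' => ?_, fun i' hi' st' hst' => ?_, fun st' hst' => ?_⟩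
      · rw [if_neg (row_ne hst' hst (.inl (by omega))), hV' i' hi' st' hst']
      · rw [if_neg (row_ne hst' hst (.inl (by omega))), hch' i' hi' st' hst']
      · obtain hst' | rfl : st' < st ∨ st' = st := by omega
        · obtain ⟨v', k', h1, h2, h3⟩ := hrow st' hst'
          refine ⟨v', k', ?_, ?_, h3⟩
          · rw [if_neg (row_ne (by omega) hst (.inr (by omega))), h1]
          · rw [if_neg (row_ne (by omega) hst (.inr (by omega))), h2]
        · exact ⟨v, k, by simp, by simp, he⟩
  · rintro s' hf - ⟨hV', hch', hrow⟩
    -- The invariant knows the entries of the new row only one by one; they are collected into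
    -- functions here and appended to the table.
    choose! v k h1 h2 h3 using hrow
    have hVi : ∀ i' ≤ i, Function.update V (i + 1) v i' = V i' := fun i' hi' =>
      Function.update_of_ne (by omega) _ _
    have hci : ∀ i' < i, Function.update ch i k i' = ch i' := fun i' hi' =>
      Function.update_of_ne (by omega) _ _
    refine ⟨Function.update V (i + 1) v, Function.update ch i k, ⟨?_, ?_⟩, ?_, ?_⟩
    · rw [hVi 0 (Nat.zero_le _)]; exact hT.zero
    · intro i' hi' st hst
      obtain hi' | rfl : i' < i ∨ i' = i := by omega
      · rw [hVi i' hi'.le, hVi (i' + 1) hi', hci i' hi']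
        exact hT.entry i' hi' st hst
      · rw [hVi i' le_rfl, Function.update_self, Function.update_self]
        exact h3 st hst
    · intro i' hi' st hst
      obtain hi' | rfl : i' ≤ i ∨ i' = i + 1 := by omega
      · rw [hVi i' hi', hV' i' hi' st hst]
      · rw [Function.update_self, h1 st hst]
    · intro i' hi' st hst
      obtain hi' | rfl : i' < i ∨ i' = i := by omega
      · rw [hci i' hi', hch' i' hi' st hst]
      · rw [Function.update_self, h2 st hst]

end Data

end MultiRepSel

/-! ### Correctness of table, backtracking and a single threshold -/

namespace MultiRepSel

open Finset RAM

namespace Data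

variable {A : Data} {D : ℤ} {N B b r : ℕ} {s : Memory} (hA : A.Valid) (hD : 0 ≤ D)
  (hfit : A.Fits D N B)

include hfit in
theorem Fits.loops_of_le {k : ℕ} (hk : k ≤ A.n + A.m + 3) : k ≤ N :=
  (hk.trans (Nat.le_self_pow two_ne_zero _)).trans hfit.loops

include hA hD hfit in
theorem wp_table (h : A.HoldsThreshold D b r s) {j : ℕ} (h22 : s 22 0 = j)
    (h40 : s 40 0 = A.penalty b) :
    WP N B Program.table s fun s' => ∃ V ch, HoldsTable A b r j A.n V ch s' := by
  simp only [Program.table, wp_block_cons, wp_block_singleton]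
  have hinit : WP N B (.forLoop 24 (.var 19) (.store 31 (.var 24) (.var 40))) s fun s' =>
      ∀ st < A.width, s' 31 (st : ℕ) = A.penalty b := by
    refine wp_forLoop (fun st s' => ∀ st' < st, s' 31 (st' : ℕ) = A.penalty b) A.width
      (A.width_le.trans hfit.loops) (hfit.bits_nat hA hD A.width_le) (by decide) ?_ ?_ ?_ ?_
    · intro s' hf
      rw [Expr.eval_var, hf 19 (by decide), h.width_eq]
    · exact fun _ h => absurd h (Nat.not_lt_zero _)
    · intro st _ s' hf h24 hI
      have e : s' 40 0 = A.penalty b := by rw [hf 40 (by decide), h40]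
      have hb := hfit.bits_penalty hA hD h.le (penalty_pos hA b).le le_rfl
      simp only [wp_store, Expr.eval_var, e, h24]
      refine ⟨hb, fun st' hst' => ?_⟩
      by_cases hs : st' = st
      · simp [write, hs]
      · simp [write, hs, hI st' (by omega)]
    · exact fun s' _ _ hI => hI
  refine hinit.imp fun s₁ hf₁ h31 => ?_
  rw [wp_store]
  refine ⟨by simpa using hfit.bits_small hA hD (k := 0) (by omega), ?_⟩
  simp only [Expr.eval_zero]
  have h2 : ∀ x ∉ [24, 31], write s₁ 31 0 0 x = s x := fun x hx => by
    rw [write_apply_ne _ _ _ (by rintro rfl; simp at hx), hf₁ x (by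
      rw [show (Cmd.forLoop 24 (.var 19) (.store 31 (.var 24) (.var 40))).writes = [24, 31, 24]
        from rfl]
      simp at hx ⊢; tauto)]
  refine wp_forLoop (fun i s' => ∃ V ch, HoldsTable A b r j i V ch s') A.n
    (hfit.loops_of_le (by omega)) (hfit.bits_small hA hD (by omega)) (by decide) ?_ ?_ ?_ ?_
  · intro s' hf
    rw [Expr.eval_var, hf 2 (by decide), h2 2 (by decide), h.n_eq]
  · refine ⟨fun _ st => if st = 0 then 0 else A.penalty b, fun _ _ => 0,
      ⟨fun _ _ => rfl, fun i hi => absurd hi (Nat.not_lt_zero _)⟩, fun i hi st hst => ?_,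
      fun i hi => absurd hi (Nat.not_lt_zero _)⟩
    obtain rfl : i = 0 := by omega
    by_cases hs : st = 0
    · simp [write, hs]
    · simp [write, hs, h31 st hst]
  · rintro i hi s' hf h23 ⟨V, ch, hT⟩
    have h' : A.HoldsThreshold D b r s' := h.of_agree fun x hx =>
      (hf x (by revert x; decide)).trans (h2 x (by revert x; decide))
    have h22' : s' 22 0 = j := by rw [hf 22 (by decide), h2 22 (by decide), h22]
    refine (wp_row hA hD hfit h' hi hT h22' h23).imp fun s'' _ ⟨V', ch', h1, h3, h4⟩ =>
      ⟨V', ch', h1, ?_, ?_⟩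
    · simpa [write_apply_ne] using h3
    · simpa [write_apply_ne] using h4
  · exact fun s' _ _ hI => hI

include hA in
-- As `b ≤ n + 1` and `p j ≤ n`, rows of width `(n + 2) * (n + 2)` contain the target state for
-- every threshold.
theorem mul_p_lt_width (hb : b ≤ A.n + 1) {j : ℕ} (hj : j < A.m) : b * A.p j < A.width := by
  have : A.p j ≤ A.n := (hA.p_le j hj).trans ((card_filter_le _ _).trans (card_range _).le)
  unfold width
  nlinarith [Nat.mul_le_mul hb this]

include hA hD hfit in
-- Bank `33` is shared by all parts, hence the last clause, which protects the choices made for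
-- other parts.
theorem wp_backStep (h : A.HoldsThreshold D b r s) {j s₀ t cur : ℕ} {κ : ℕ → ℕ} {V : ℕ → ℕ → ℤ}
    {ch : ℕ → ℕ → ℕ} (hT : HoldsTable A b r j A.n V ch s) (h22 : s 22 0 = j) (h36 : s 36 0 = t)
    (h35 : s 35 0 = cur) (ht : t < A.n) (hs₀ : s₀ < A.width)
    (hB : IsBacktrack A b r j V s₀ t cur κ)
    (h33 : ∀ i ∈ Ico (A.n - t) A.n, A.part i = j → s 33 i = κ i) :
    WP N B Program.backStep s fun s' => (∃ κ' cur', s' 35 0 = (cur' : ℕ) ∧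
      IsBacktrack A b r j V s₀ (t + 1) cur' κ' ∧
      ∀ i ∈ Ico (A.n - (t + 1)) A.n, A.part i = j → s' 33 i = κ' i) ∧
      ∀ i < A.n, A.part i ≠ j → s' 33 i = s 33 i := by
  obtain ⟨hV, -, hch⟩ := hT
  have hcur : cur < A.width := by have := hB.units; omega
  obtain ⟨i, hi⟩ : ∃ i, A.n - t - 1 = i := ⟨_, rfl⟩
  have hin : i < A.n := by omega
  have hii : (A.n : ℤ) - 1 - t = i := by omega
  obtain ⟨k, hk⟩ : ∃ k, ch i cur = k := ⟨_, rfl⟩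
  have hkb : k ≤ b + 1 := by
    have h1 := (hV.entry i hin cur hcur).lt
    have h2 := options_le (A := A) b j i
    omega
  have hle := h.le
  have bi := hfit.bits_small hA hD (k := i) (by omega)
  have bk := hfit.bits_small hA hD (k := k) (by omega)
  have bb := hfit.bits_small hA hD (k := b) (by omega)
  have e32 : s 32 ((i : ℤ) * A.width + cur) = k := by
    have := hch i hin cur hcur
    rw [hk] at this
    rw [← this]; push_cast; rfl
  have hκ₀ : ∀ i' ∈ Ico (A.n - t) A.n, A.part i' = j →
      Function.update κ i k i' = κ i' := fun i' hi' _ =>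
    Function.update_of_ne (by rw [mem_Ico] at hi'; omega) _ _
  obtain ⟨hmin, hB'⟩ := hB.succ hV ht hs₀ (k := k) (κ' := Function.update κ i k)
    (by rw [hi, hk]) hκ₀ (fun _ => by rw [hi, Function.update_self])
  have bc : bits ((cur : ℤ) - (min k b : ℕ)) ≤ B := by
    rw [← Nat.cast_sub hmin]
    exact hfit.bits_nat hA hD (by have := A.width_le; omega)
  set s₁ := write (write s 23 0 i) 29 0 k with hs₁
  have hs₁ne : ∀ x ∉ [23, 29], s₁ x = s x := fun x hx => by
    rw [hs₁, write_apply_ne _ _ _ (by rintro rfl; simp at hx),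
      write_apply_ne _ _ _ (by rintro rfl; simp at hx)]
  have h26 : WP N B (.ite (.var 20 - .var 29 + 1) (.set 26 (.var 29)) (.set 26 (.var 20))) s₁
      fun s' => s' 26 0 = (min k b : ℕ) := by
    by_cases hkb : k ≤ b
    · simp [hs₁, write, h.b_eq, hkb, bk, show (0 : ℤ) < b - k + 1 by omega]
    · simp [hs₁, write, h.b_eq, bb, show ¬ (0 : ℤ) < b - k + 1 by omega, show b ≤ k by omega]
  simp only [Program.backStep, wp_block_cons, wp_block_singleton]
  simp only [wp_set, Expr.eval_sub, Expr.eval_var, Expr.eval_one, h.n_eq, h36, hii]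
  refine ⟨bi, ?_⟩
  have e29 : (Expr.load 32 (.var 23 * .var 19 + .var 35)).eval (write s 23 0 i) = k := by
    simp [write, h.width_eq, h35, e32]
  rw [e29]
  refine ⟨bk, h26.imp fun s₂ hf₂ h26 => ?_⟩
  have hs₂ : ∀ x ∉ [23, 26, 29], s₂ x = s x := fun x hx => by
    rw [hf₂ x (by
      rw [show (Cmd.ite (.var 20 - .var 29 + 1) (.set 26 (.var 29)) (.set 26 (.var 20))).writes =
        [26, 26] from rfl]
      simp at hx ⊢; tauto), hs₁ne x (by simp at hx ⊢; tauto)]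
  have h29 : s₂ 29 0 = k := by rw [hf₂ 29 (by decide)]; simp [hs₁, write]
  have h23 : s₂ 23 0 = i := by rw [hf₂ 23 (by decide)]; simp [hs₁, write]
  have e35 : s₂ 35 0 - s₂ 26 0 = (cur - min k b : ℕ) := by
    rw [hs₂ 35 (by decide), h35, h26, Nat.cast_sub hmin]
  rw [e35]
  refine ⟨by rwa [Nat.cast_sub hmin], ?_⟩
  have h₃ : A.Holds D (write s₂ 35 0 (cur - min k b : ℕ)) := h.toHolds.of_agree fun x hx => by
    rw [write_apply_ne _ _ _ (by revert x; decide), hs₂ x (by revert x; decide)]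
  have e1 : A.n - (t + 1) = i := by omega
  have e2 : A.n - t = i + 1 := by omega
  rw [wp_ifInPart h₃ hin (by simpa [write] using h23)
    (by simpa [write, hs₂ 22 (by decide)] using h22)]
  split_ifs with hp
  · rw [wp_store]
    refine ⟨by simpa [write, h29] using bk, ⟨_, cur - min k b, ?_, hB', fun i' hi' hp' => ?_⟩,
      fun i' hi' hp' => ?_⟩
    · simp [write]
    · rw [e1] at hi'
      by_cases hne : i' = i
      · subst hne
        simp [write, h23, h29]
      · simp only [write, Expr.eval_var, h23, hne, Nat.cast_inj, and_false, if_false,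
          show ¬ (33 = 35) by decide, show ¬ (23 = 35) by decide, false_and]
        rw [hs₂ 33 (by decide), h33 i' (by rw [mem_Ico] at hi' ⊢; omega) hp',
          Function.update_of_ne hne]
    · have hne : i' ≠ i := by rintro rfl; exact hp' hp
      simp [write, h23, hne, hs₂ 33 (by decide)]
  · rw [wp_skip]
    refine ⟨⟨_, cur - min k b, ?_, hB', fun i' hi' hp' => ?_⟩, fun i' hi' hp' => ?_⟩
    · simp [write]
    · have hne : i' ≠ i := by rintro rfl; exact hp hp'
      rw [write_apply_ne _ _ _ (by decide), hs₂ 33 (by decide),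
        h33 i' (by rw [mem_Ico] at hi' ⊢; omega) hp', Function.update_of_ne hne]
    · rw [write_apply_ne _ _ _ (by decide), hs₂ 33 (by decide)]

include hA hD hfit in
theorem wp_backtrack (h : A.HoldsThreshold D b r s) {j : ℕ} {V : ℕ → ℕ → ℤ} {ch : ℕ → ℕ → ℕ}
    (hT : HoldsTable A b r j A.n V ch s) (hj : j < A.m) (h22 : s 22 0 = j) :
    WP N B Program.backtrack s fun s' => (∃ κ : ℕ → ℕ,
      (∀ i < A.n, A.part i = j → s' 33 i = κ i) ∧
      IsPartOptimal A b r j κ (V A.n (b * A.p j))) ∧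
      ∀ i < A.n, A.part i ≠ j → s' 33 i = s 33 i := by
  have hW := mul_p_lt_width hA h.le hj
  have e35 : (Expr.var 20 * Expr.load 0 (4 + .var 2 + .var 22)).eval s = (b * A.p j : ℕ) := by
    simp [h.b_eq, h.n_eq, h22, h.p_eq j hj]
  simp only [Program.backtrack, wp_block_cons, wp_block_singleton]
  rw [wp_set, e35]
  refine ⟨hfit.bits_nat hA hD (hW.le.trans A.width_le), ?_⟩
  have hne : ∀ x ≠ 35, write s 35 0 (b * A.p j : ℕ) x = s x := fun x hx =>
    write_apply_ne _ _ _ hx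
  refine wp_forLoop (fun t s' => (∃ κ cur, s' 35 0 = (cur : ℕ) ∧
      IsBacktrack A b r j V (b * A.p j) t cur κ ∧
      ∀ i ∈ Ico (A.n - t) A.n, A.part i = j → s' 33 i = κ i) ∧
      ∀ i < A.n, A.part i ≠ j → s' 33 i = s 33 i) A.n
    (hfit.loops_of_le (by omega)) (hfit.bits_small hA hD (by omega)) (by decide) ?_ ?_ ?_ ?_
  · intro s' hf
    rw [Expr.eval_var, hf 2 (by decide), hne 2 (by decide), h.n_eq]
  · refine ⟨⟨fun _ => 0, b * A.p j, by simp [write], .zero _ _ _ _ _ _, by simp⟩, ?_⟩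
    simp [write]
  · rintro t ht s' hf h36 ⟨⟨κ, cur, h35, hB, h33⟩, hpres⟩
    have fr (x : ℕ) (hx : x ∉ [23, 26, 29, 33, 35, 36]) : s' x = s x := by
      rw [hf x (by
        rw [show (Cmd.forLoop 36 (.var 2) Program.backStep).writes =
          [36, 23, 29, 26, 26, 35, 33, 36] from rfl]
        simp at hx ⊢; tauto), hne x (by rintro rfl; simp at hx)]
    have h' : A.HoldsThreshold D b r s' := h.of_agree fun x hx => fr x (by revert x; decide)
    have hT' : HoldsTable A b r j A.n V ch s' := by
      refine ⟨hT.1, ?_, ?_⟩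
      · rw [fr 31 (by decide)]; exact hT.2.1
      · rw [fr 32 (by decide)]; exact hT.2.2
    refine (wp_backStep hA hD hfit h' hT' (by rw [fr 22 (by decide), h22]) h36 h35 ht hW hB
      h33).imp fun s'' _ ⟨⟨κ', cur', h1, h2, h3⟩, h4⟩ => ⟨⟨κ', cur', ?_, h2, ?_⟩, ?_⟩
    · rw [write_apply_ne _ _ _ (by decide), h1]
    · rw [write_apply_ne _ _ _ (by decide)]; exact h3
    · intro i hi hp
      rw [write_apply_ne _ _ _ (by decide), h4 i hi hp, hpres i hi hp]
  · rintro s' - - ⟨⟨κ, cur, h35, hB, h33⟩, hpres⟩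
    refine ⟨⟨κ, fun i hi hp => h33 i ?_ hp, hB.isPartOptimal hA hj hT.1 hW⟩, hpres⟩
    simpa using hi

include hA hD hfit in
-- Each part adds at most one penalty; the bounds on the running total `a` are there to control its
-- bit length.
theorem wp_solvePart (h : A.HoldsThreshold D b r s) {j : ℕ} (hj : j < A.m) (h22 : s 22 0 = j)
    (h40 : s 40 0 = A.penalty b) {a : ℤ} (h34 : s 34 0 = a) (ha0 : 0 ≤ a)
    (ha : a ≤ j * A.penalty b) :
    WP N B Program.solvePart s fun s' => (∃ (κ : ℕ → ℕ) (v : ℤ),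
      (∀ i < A.n, A.part i = j → s' 33 i = κ i) ∧ IsPartOptimal A b r j κ v ∧
      0 ≤ v ∧ v ≤ A.penalty b ∧ s' 34 0 = a + v) ∧
      ∀ i < A.n, A.part i ≠ j → s' 33 i = s 33 i := by
  simp only [Program.solvePart, wp_block_cons, wp_block_singleton]
  refine (wp_table hA hD hfit h h22 h40).imp fun s₁ hf₁ ⟨V, ch, hT⟩ => ?_
  have h₁ : A.HoldsThreshold D b r s₁ := h.of_agree fun x hx => hf₁ x (by revert x; decide)
  refine (wp_backtrack hA hD hfit h₁ hT hj (by rw [hf₁ 22 (by decide), h22])).imp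
    fun s₂ hf₂ ⟨⟨κ, hκ, hopt⟩, hpres⟩ => ?_
  have h₂ : A.HoldsThreshold D b r s₂ := h₁.of_agree fun x hx => hf₂ x (by revert x; decide)
  have hW := mul_p_lt_width hA h.le hj
  have hv := hT.1.bounds hA le_rfl hW
  have e34 : (Expr.var 34 + Expr.load 31 (.var 2 * .var 19 + .var 20 *
      Expr.load 0 (4 + .var 2 + .var 22))).eval s₂ = a + V A.n (b * A.p j) := by
    have h22' : s₂ 22 0 = j := by rw [hf₂ 22 (by decide), hf₁ 22 (by decide), h22]
    have h34' : s₂ 34 0 = a := by rw [hf₂ 34 (by decide), hf₁ 34 (by decide), h34]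
    rw [← hT.2.1 A.n le_rfl _ hW, ← hf₂ 31 (by decide)]
    simp [h₂.n_eq, h₂.width_eq, h₂.b_eq, h22', h34', h₂.p_eq j hj]
  rw [wp_set, e34]
  refine ⟨?_, ⟨κ, _, ?_, hopt, hv.1, hv.2, ?_⟩, ?_⟩
  · refine hfit.bits_sum hA hD (by linarith) (k := (j + 1) * (A.n + 1)) ?_ ?_
    · rw [sq]; exact Nat.mul_le_mul (by omega) (by omega)
    · have h1 : a + V A.n (b * A.p j) ≤ (j + 1) * A.penalty b := by linarith [hv.2]
      refine h1.trans ?_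
      push_cast
      rw [mul_assoc]
      refine mul_le_mul_of_nonneg_left ?_ (by positivity)
      have h1 : (b : ℤ) ≤ A.n + 1 := by exact_mod_cast h.le
      have h2 := costSum_nonneg hA
      have h3 := hA.Γ_nonneg
      have h4 := mul_le_mul_of_nonneg_right h1 h2
      unfold penalty
      nlinarith
  · rw [write_apply_ne _ _ _ (by decide)]; exact hκ
  · simp [write]
  · intro i hi hp
    rw [write_apply_ne _ _ _ (by decide), hpres i hi hp, hf₁ 33 (by decide)]

include hA hD hfit in
theorem wp_solveThreshold (h : A.HoldsThreshold D b r s) :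
    WP N B Program.solveThreshold s fun s' => ∃ (κ : ℕ → ℕ) (v : ℤ),
      (∀ i < A.n, s' 33 i = κ i) ∧ s' 34 0 = v ∧ 0 ≤ v ∧
      v ≤ (A.n + A.m + 3) ^ 2 * (A.costSum + A.Γ + D + 1) ∧ IsOptimalAt A b r κ v := by
  have hp := penalty_pos hA b
  have e40 : (Expr.var 20 * Expr.var 18 + 1).eval s = A.penalty b := by
    simp [h.b_eq, h.sum_eq, penalty]
  simp only [Program.solveThreshold, wp_block_cons, wp_block_singleton]
  rw [wp_set, e40, wp_set]
  refine ⟨hfit.bits_penalty hA hD h.le hp.le le_rfl,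
    by simpa using hfit.bits_small hA hD (k := 0) (by omega), ?_⟩
  set s₁ := write (write s 40 0 (A.penalty b)) 34 0 ((0 : Expr).eval (write s 40 0 (A.penalty b)))
    with hs₁
  have hs₁ne : ∀ x ∉ [34, 40], s₁ x = s x := fun x hx => by
    rw [hs₁, write_apply_ne _ _ _ (by rintro rfl; simp at hx),
      write_apply_ne _ _ _ (by rintro rfl; simp at hx)]
  refine wp_forLoop (fun j s' => ∃ (κ : ℕ → ℕ) (v : ℕ → ℤ),
      (∀ i < A.n, A.part i < j → s' 33 i = κ i) ∧ s' 34 0 = ∑ j' ∈ range j, v j' ∧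
      ∀ j' < j, IsPartOptimal A b r j' κ (v j') ∧ 0 ≤ v j' ∧ v j' ≤ A.penalty b) A.m
    (hfit.loops_of_le (by omega)) (hfit.bits_small hA hD (by omega)) (by decide) ?_ ?_ ?_ ?_
  · intro s' hf
    rw [Expr.eval_var, hf 3 (by decide), hs₁ne 3 (by decide), h.m_eq]
  · refine ⟨fun _ => 0, fun _ => 0, by simp, by simp [hs₁, write], by simp⟩
  · rintro j hj s' hf h22 ⟨κ, v, h33, h34, hopt⟩
    have h' : A.HoldsThreshold D b r s' := h.of_agree fun x hx =>
      (hf x (by revert x; decide)).trans (hs₁ne x (by revert x; decide))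
    have h40' : s' 40 0 = A.penalty b := by rw [hf 40 (by decide)]; simp [hs₁, write]
    refine (wp_solvePart hA hD hfit h' hj h22 h40' h34
      (sum_nonneg fun j' hj' => (hopt j' (mem_range.1 hj')).2.1)
      ((sum_le_sum fun j' hj' => (hopt j' (mem_range.1 hj')).2.2).trans (by simp))).imp
      fun s'' _ ⟨⟨κ', v', h1, h2, h3, h4, h5⟩, h6⟩ => ?_
    -- The choices for part `j` are merged with the earlier ones. Optimality for a part depends only
    -- on the choices for its own items, so nothing proved before is lost.
    refine ⟨fun i => if A.part i = j then κ' i else κ i, Function.update v j v', ?_, ?_, ?_⟩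
    · intro i hi hp
      rw [write_apply_ne _ _ _ (by decide)]
      simp only
      split_ifs with hpj
      · exact h1 i hi hpj
      · rw [h6 i hi hpj, h33 i hi (by omega)]
    · rw [write_apply_ne _ _ _ (by decide), h5, sum_range_succ, Function.update_self]
      congr 1
      exact sum_congr rfl fun j' hj' => by
        rw [Function.update_of_ne (by rw [mem_range] at hj'; omega)]
    · intro j' hj'
      obtain hj' | rfl : j' < j ∨ j' = j := by omega
      · rw [Function.update_of_ne (by omega)]
        exact ⟨(hopt j' hj').1.congr fun i _ hp => by rw [if_neg (by omega)],
          (hopt j' hj').2⟩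
      · rw [Function.update_self]
        exact ⟨h2.congr fun i _ hp => by rw [if_pos hp], h3, h4⟩
  · rintro s' hf - ⟨κ, v, h33, h34, hopt⟩
    have h' : A.HoldsThreshold D b r s' := h.of_agree fun x hx =>
      (hf x (by revert x; decide)).trans (hs₁ne x (by revert x; decide))
    have e : (Expr.var 34 + Expr.load 6 (3 * .var 2) * .var 21).eval s' =
        ∑ j ∈ range A.m, v j + A.Γ * r := by
      simp [h34, h'.n_eq, h'.Γ_eq, h'.r_eq]
    have hΓ := hA.Γ_nonneg
    have hsum0 : 0 ≤ ∑ j ∈ range A.m, v j := sum_nonneg fun j hj => (hopt j (mem_range.1 hj)).2.1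
    have h0 : 0 ≤ ∑ j ∈ range A.m, v j + A.Γ * r := by positivity
    have hle : ∑ j ∈ range A.m, v j + A.Γ * r ≤
        (A.n + A.m + 3) ^ 2 * (A.costSum + A.Γ + D + 1) := by
      have h1 : ∑ j ∈ range A.m, v j ≤ A.m * A.penalty b :=
        (sum_le_sum fun j hj => (hopt j (mem_range.1 hj)).2.2).trans (by simp)
      have h2 : (b : ℤ) ≤ A.n + 1 := by exact_mod_cast h.le
      have h3 : (r : ℤ) ≤ A.n + 1 := by exact_mod_cast h.r_le.trans h.le
      have h4 := costSum_nonneg hA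
      have h5 : A.penalty b ≤ (A.n + 1) * (A.costSum + 1) := by
        unfold penalty
        nlinarith [mul_le_mul_of_nonneg_right h2 h4]
      have h6 : (A.m : ℤ) * A.penalty b ≤ A.m * ((A.n + 1) * (A.costSum + 1)) :=
        mul_le_mul_of_nonneg_left h5 (by positivity)
      have h7 : A.Γ * r ≤ A.Γ * (A.n + 1) := mul_le_mul_of_nonneg_left h3 hΓ
      have h8 : (A.m : ℤ) * (A.n + 1) ≤ (A.n + A.m + 3) ^ 2 := by nlinarith
      have h9 : (A.n : ℤ) + 1 ≤ (A.n + A.m + 3) ^ 2 := by nlinarith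
      have h10 := mul_le_mul_of_nonneg_right h8 (show 0 ≤ A.costSum + 1 by linarith)
      have h11 := mul_le_mul_of_nonneg_left h9 hΓ
      have h12 : 0 ≤ ((A.n : ℤ) + A.m + 3) ^ 2 * D := by positivity
      nlinarith
    rw [wp_set, e]
    refine ⟨hfit.numbers _ h0 hle, κ, _, ?_, by simp [write], h0, hle,
      isOptimalAt_of_parts hA fun j hj => (hopt j hj).1⟩
    intro i hi
    rw [write_apply_ne _ _ _ (by decide)]
    exact h33 i hi (hA.part_lt i hi)

end Data

end MultiRepSel

namespace MultiRepSel

open Finset RAM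

/-! ### Search over all thresholds and output

Banks: `37`, `38`, `39` total cost and threshold of the best solution found, `41` loop counter. -/

namespace Program

open RAM.Expr (var load)

def keepBest : Cmd :=
  .ite (var 37 * var 20 - var 34 * var 38)
    (.block [.set 37 (var 34), .set 38 (var 20), .set 39 (var 21)]) .skip

/-- The initial pair `1, 0` acts as the fraction `1 / 0`, an infinite cost, so the first threshold
always replaces it. -/
def search : Cmd :=
  .block [.set 37 1, .set 38 0, .set 39 0,
    .forLoop 41 (var 2 + 1) (.seq (.set 20 (var 41 + 1))
      (.forLoop 21 (var 20 + 1) (.seq solveThreshold keepBest)))]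

def outputItem : Cmd :=
  .block [.set 25 (load 33 (var 23)),
    .ite (var 20 - var 25 + 1)
      (.block [.store 1 (4 + 5 * var 23) 0, .store 1 (5 + 5 * var 23) (var 25),
        .ite (var 25 - var 21) (.store 1 (7 + 5 * var 23) (var 25 - var 21))
          (.store 1 (7 + 5 * var 23) 0)])
      (.block [.store 1 (4 + 5 * var 23) 1, .store 1 (5 + 5 * var 23) 0,
        .store 1 (7 + 5 * var 23) 0]),
    .store 1 (6 + 5 * var 23) (var 20), .store 1 (8 + 5 * var 23) (var 20)]

def output : Cmd :=
  .block [.store 1 0 (var 34), .store 1 1 (var 7 * var 20), .store 1 2 (var 21),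
    .store 1 3 (var 20), .forLoop 23 (var 2) outputItem]

/-- The search remembers only the best threshold and its cost. Its choices are recovered by solving
for that threshold once more. -/
def solve : Cmd :=
  .block [search, .set 20 (var 38), .set 21 (var 39), solveThreshold, output]

end Program

namespace Data

variable {A : Data} {D : ℤ} {N B b r : ℕ} {s : Memory} (hA : A.Valid) (hD : 0 ≤ D)
  (hfit : A.Fits D N B)

/-- Banks `37`, `38` and `39` describe the best solution for the thresholds in `V`. -/
def BestSoFar (A : Data) (V : ℕ → ℕ → Prop) (s : Memory) : Prop :=
  ∃ (best : ℤ) (bb br : ℕ), s 37 0 = best ∧ s 38 0 = bb ∧ s 39 0 = br ∧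
    ((bb = 0 ∧ best = 1 ∧ ∀ b' r', ¬ V b' r') ∨
      (1 ≤ bb ∧ bb ≤ A.n + 1 ∧ br ≤ bb ∧ ∃ κ, IsOptimalAt A bb br κ best)) ∧
    ∀ b' r', V b' r' → 1 ≤ b' → ∀ κ', A.IsChoice b' κ' → best * b' ≤ A.total b' r' κ' * bb

theorem BestSoFar.congr {V V' : ℕ → ℕ → Prop} {s s' : Memory} (h : A.BestSoFar V s)
    (hV : ∀ b' r', V' b' r' ↔ V b' r') (h37 : s' 37 = s 37) (h38 : s' 38 = s 38)
    (h39 : s' 39 = s 39) : A.BestSoFar V' s' := by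
  obtain rfl : V' = V := funext fun b' => funext fun r' => propext (hV b' r')
  unfold BestSoFar
  rwa [h37, h38, h39]

include hA hD hfit in
theorem wp_solveThreshold_keepBest (h : A.HoldsThreshold D b r s) (hb : 1 ≤ b)
    {V : ℕ → ℕ → Prop} (hV : A.BestSoFar V s) :
    WP N B (.seq Program.solveThreshold Program.keepBest) s
      (A.BestSoFar fun b' r' => V b' r' ∨ (b' = b ∧ r' = r)) := by
  rw [wp_seq]
  refine (wp_solveThreshold hA hD hfit h).imp fun s' hf ⟨κ, v, _, h34, hv0, hvle, hopt⟩ => ?_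
  obtain ⟨best, bb, br, h37, h38, h39, hbest, hle⟩ := hV
  have h37' : s' 37 0 = best := by rw [hf 37 (by decide), h37]
  have h38' : s' 38 0 = bb := by rw [hf 38 (by decide), h38]
  have h39' : s' 39 0 = br := by rw [hf 39 (by decide), h39]
  have h20 : s' 20 0 = b := by rw [hf 20 (by decide), h.b_eq]
  have h21 : s' 21 0 = r := by rw [hf 21 (by decide), h.r_eq]
  have hbz : (0 : ℤ) < b := by exact_mod_cast hb
  have := h.le
  have := h.r_le
  have e1 := hfit.bits_small hA hD (k := b) (by omega)
  have e2 := hfit.bits_small hA hD (k := r) (by omega)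
  -- This is `v / b < best / bb` after cross-multiplication, which also has the intended meaning for
  -- the initial pair.
  by_cases hlt : v * bb < best * b
  · simp only [Program.keepBest, wp_ite, Expr.eval_sub, Expr.eval_mul, Expr.eval_var, h37', h20,
      h34, h38', if_pos (sub_pos.2 hlt)]
    suffices A.BestSoFar (fun b' r' => V b' r' ∨ (b' = b ∧ r' = r))
        (write (write (write s' 37 0 v) 38 0 b) 39 0 r) by
      simpa [write_apply_ne, h34, h20, h21, hfit.numbers v hv0 hvle, e1, e2] using this
    refine ⟨v, b, r, by simp [write], by simp [write], by simp [write],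
      .inr ⟨hb, by omega, by omega, κ, hopt⟩, ?_⟩
    rintro b' r' (hV' | ⟨rfl, rfl⟩) hb' κ' hκ'
    · have hbz' : (0 : ℤ) < b' := by exact_mod_cast hb'
      obtain ⟨_, _, hno⟩ | ⟨hbb, -⟩ := hbest
      · exact absurd hV' (hno _ _)
      · have hbbz : (0 : ℤ) < bb := by exact_mod_cast hbb
        have h1 := hle b' r' hV' hb' κ' hκ'
        have h2 := mul_le_mul_of_nonneg_right hlt.le hbz'.le
        have h3 := mul_le_mul_of_nonneg_right h1 hbz.le
        have h4 : v * b' * bb ≤ A.total b' r' κ' * b * bb := by linarith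
        exact le_of_mul_le_mul_right h4 hbbz
    · exact mul_le_mul_of_nonneg_right (hopt.optimal κ' hκ') hbz.le
  · simp only [Program.keepBest, wp_ite, Expr.eval_sub, Expr.eval_mul, Expr.eval_var, h37', h20,
      h34, h38', if_neg (show ¬ 0 < best * b - v * bb by omega), wp_skip]
    refine ⟨best, bb, br, h37', h38', h39', ?_, ?_⟩
    · obtain ⟨rfl, rfl, _⟩ | hbest := hbest
      · exact absurd (by simpa using hbz) hlt
      · exact .inr hbest
    rintro b' r' (hV' | ⟨rfl, rfl⟩) hb' κ' hκ'
    · exact hle b' r' hV' hb' κ' hκ'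
    · exact (not_lt.1 hlt).trans
        (mul_le_mul_of_nonneg_right (hopt.optimal κ' hκ') (Int.natCast_nonneg _))

include hA hD hfit in
theorem wp_search (h : A.Holds D s) :
    WP N B Program.search s
      (A.BestSoFar fun b' r' => 1 ≤ b' ∧ b' ≤ A.n + 1 ∧ r' ≤ b') := by
  simp only [Program.search, wp_block_cons, wp_block_singleton]
  suffices WP N B (.forLoop 41 (.var 2 + 1) (.seq (.set 20 (.var 41 + 1))
      (.forLoop 21 (.var 20 + 1) (.seq Program.solveThreshold Program.keepBest))))
      (write (write (write s 37 0 1) 38 0 0) 39 0 0)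
      (A.BestSoFar fun b' r' => 1 ≤ b' ∧ b' ≤ A.n + 1 ∧ r' ≤ b') by
    have e0 := hfit.bits_small hA hD (k := 0) (by omega)
    have e1 := hfit.bits_small hA hD (k := 1) (by omega)
    push_cast at e0 e1
    simpa [e0, e1] using this
  have hne : ∀ x ∉ [37, 38, 39], write (write (write s 37 0 1) 38 0 0) 39 0 0 x = s x := by
    intro x hx
    simp at hx
    rw [write_apply_ne _ _ _ hx.2.2, write_apply_ne _ _ _ hx.2.1, write_apply_ne _ _ _ hx.1]
  refine wp_forLoop (fun b₀ => A.BestSoFar fun b' r' => 1 ≤ b' ∧ b' ≤ b₀ ∧ r' ≤ b') (A.n + 1)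
    (hfit.loops_of_le (by omega)) (hfit.bits_small hA hD (by omega)) (by decide) ?_ ?_ ?_
    fun s' _ _ h => h
  · intro s' hf
    simp [hf 2 (by decide), hne 2 (by decide), h.n_eq]
  · refine ⟨1, 0, 0, by simp [write], by simp [write], by simp [write], .inl ⟨rfl, rfl, ?_⟩, ?_⟩
    · rintro b' r' ⟨h1, h2, -⟩; omega
    · rintro b' r' ⟨h1, h2, -⟩; omega
  · rintro b₀ hb₀ s₁ hf₁ h41 hI
    have e1 : (Expr.var 41 + 1).eval s₁ = (b₀ + 1 : ℕ) := by simp [h41]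
    rw [wp_seq, wp_set, e1]
    refine ⟨hfit.bits_small hA hD (by omega), ?_⟩
    have h₁ : A.Holds D s₁ := h.of_agree fun x hx =>
      (hf₁ x (by revert x; decide)).trans (hne x (by revert x; decide))
    refine wp_forLoop (fun r₀ => A.BestSoFar fun b' r' =>
        (1 ≤ b' ∧ b' ≤ b₀ ∧ r' ≤ b') ∨ (b' = b₀ + 1 ∧ r' < r₀)) (b₀ + 1 + 1)
      (hfit.loops_of_le (by omega)) (hfit.bits_small hA hD (by omega)) (by decide) ?_ ?_ ?_ ?_
    · intro s' hf
      simp [hf 20 (by decide), write]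
    · exact hI.congr (fun b' r' => by simp) (by simp [write_apply_ne]) (by simp [write_apply_ne])
        (by simp [write_apply_ne])
    · intro r₀ hr₀ s₂ hf₂ h21 hI₂
      have h₂ : A.HoldsThreshold D (b₀ + 1) r₀ s₂ := by
        refine ⟨h₁.of_agree fun x hx => (hf₂ x (by revert x; decide)).trans
          (write_apply_ne _ _ _ (by revert x; decide)), ?_, h21, by omega, by omega⟩
        rw [hf₂ 20 (by decide)]; simp [write]
      refine (wp_solveThreshold_keepBest hA hD hfit h₂ (by omega) hI₂).imp fun s₃ _ h₃ => ?_
      refine h₃.congr (fun b' r' => ?_) (by simp [write_apply_ne]) (by simp [write_apply_ne])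
        (by simp [write_apply_ne])
      omega
    · intro s' _ _ hI'
      refine hI'.congr (fun b' r' => ?_) (by simp [write_apply_ne]) (by simp [write_apply_ne])
        (by simp [write_apply_ne])
      omega

/-- Bank `1` contains the output for item `i`. -/
def HoldsItem (b r : ℕ) (κ : ℕ → ℕ) (i : ℕ) (s : Memory) : Prop :=
  s 1 (4 + 5 * i) = (if κ i ≤ b then 0 else 1) ∧
  s 1 (5 + 5 * i) = ((if κ i ≤ b then κ i else 0 : ℕ) : ℤ) ∧ s 1 (6 + 5 * i) = b ∧
  s 1 (7 + 5 * i) = ((if κ i ≤ b then κ i - r else 0 : ℕ) : ℤ) ∧ s 1 (8 + 5 * i) = b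

include hA hD hfit in
theorem wp_outputItem (h : A.HoldsThreshold D b r s) {κ : ℕ → ℕ} {i : ℕ} (hκ : κ i ≤ b + 1)
    (h33 : s 33 i = κ i) (h23 : s 23 0 = i) :
    WP N B Program.outputItem s fun s' => HoldsItem b r κ i s' ∧
      ∀ a, a < 4 + 5 * (i : ℤ) → s' 1 a = s 1 a := by
  have := h.le
  have e0 := hfit.bits_small hA hD (k := 0) (by omega)
  have e1 := hfit.bits_small hA hD (k := 1) (by omega)
  have eb := hfit.bits_small hA hD (k := b) (by omega)
  have ek := hfit.bits_small hA hD (k := κ i) (by omega)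
  have er := hfit.bits_small hA hD (k := κ i - r) (by omega)
  push_cast at e0 e1
  unfold HoldsItem
  -- The bound on the address is restated as inequality with each of the five cells of item `i`, the
  -- form in which simplification can discard the stores.
  have fin : ∀ {P : ℤ → Prop}, (∀ a, a < 4 + 5 * (i : ℤ) → a ≠ 4 + 5 * (i : ℤ) →
      a ≠ 5 + 5 * (i : ℤ) → a ≠ 6 + 5 * (i : ℤ) → a ≠ 7 + 5 * (i : ℤ) → a ≠ 8 + 5 * (i : ℤ) →
      P a) → ∀ a, a < 4 + 5 * (i : ℤ) → P a := fun hP a ha =>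
    hP a ha (by omega) (by omega) (by omega) (by omega) (by omega)
  by_cases hkb : κ i ≤ b
  · by_cases hkr : r < κ i
    · rw [Nat.cast_sub hkr.le] at er
      simp [Program.outputItem, write, h.b_eq, h.r_eq, h33, h23, e0, eb, ek, er, hkb, hkr, hkr.le]
      exact fin fun a _ h4 h5 h6 h7 h8 => by simp [h4, h5, h6, h7, h8]
    · simp [Program.outputItem, write, h.b_eq, h.r_eq, h33, h23, e0, eb, ek, hkb, hkr,
        Nat.sub_eq_zero_of_le (not_lt.1 hkr)]
      exact fin fun a _ h4 h5 h6 h7 h8 => by simp [h4, h5, h6, h7, h8]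
  · simp [Program.outputItem, write, h.b_eq, h33, h23, e0, e1, eb, ek, hkb]
    exact fin fun a _ h4 h5 h6 h7 h8 => by simp [h4, h5, h6, h7, h8]

include hA hD hfit in
theorem wp_output (h : A.HoldsThreshold D b r s) {κ : ℕ → ℕ} {v : ℤ}
    (hκ : ∀ i < A.n, κ i ≤ b + 1) (h33 : ∀ i < A.n, s 33 i = κ i) (h34 : s 34 0 = v)
    (hv : bits v ≤ B) :
    WP N B Program.output s fun s' => s' 1 0 = v ∧ s' 1 1 = D * b ∧ s' 1 2 = r ∧ s' 1 3 = b ∧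
      ∀ i < A.n, HoldsItem b r κ i s' := by
  have hle := h.le
  have hrle := h.r_le
  have eb := hfit.bits_small hA hD (k := b) (by omega)
  have er := hfit.bits_small hA hD (k := r) (by omega)
  have eD : bits (D * b) ≤ B := by
    refine hfit.bits_sum hA hD (by positivity) (k := A.n + 1)
      ((show A.n + 1 ≤ A.n + A.m + 3 by omega).trans (Nat.le_self_pow two_ne_zero _)) ?_
    have h1 : (b : ℤ) ≤ A.n + 1 := by exact_mod_cast hle
    have h2 := costSum_nonneg hA
    have h3 := hA.Γ_nonneg
    push_cast
    nlinarith
  simp only [Program.output, wp_block_cons, wp_block_singleton]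
  suffices WP N B (.forLoop 23 (.var 2) Program.outputItem)
      (write (write (write (write s 1 0 v) 1 1 (D * b)) 1 2 r) 1 3 b)
      fun s' => s' 1 0 = v ∧ s' 1 1 = D * b ∧ s' 1 2 = r ∧ s' 1 3 = b ∧
      ∀ i < A.n, HoldsItem b r κ i s' by
    simpa [write_apply_ne, h34, h.b_eq, h.r_eq, h.D_eq, hv, eD, eb, er] using this
  have hne : ∀ x ≠ 1, write (write (write (write s 1 0 v) 1 1 (D * b)) 1 2 r) 1 3 b x = s x := by
    intro x hx
    simp only [write_apply_ne _ _ _ hx]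
  refine wp_forLoop (fun i' s' => s' 1 0 = v ∧ s' 1 1 = D * b ∧ s' 1 2 = r ∧ s' 1 3 = b ∧
      ∀ i < i', HoldsItem b r κ i s') A.n (hfit.loops_of_le (by omega))
    (hfit.bits_small hA hD (by omega)) (by decide) ?_ ?_ ?_ fun s' _ _ hI => hI
  · intro s' hf
    rw [Expr.eval_var, hf 2 (by decide), hne 2 (by decide), h.n_eq]
  · simp [write]
  · rintro i hi s' hf h23 ⟨h0, h1, h2, h3, hI⟩
    have h' : A.HoldsThreshold D b r s' := h.of_agree fun x hx =>
      (hf x (by revert x; decide)).trans (hne x (by revert x; decide))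
    refine (wp_outputItem hA hD hfit h' (hκ i hi) (by
      rw [hf 33 (by decide), hne 33 (by decide), h33 i hi]) h23).imp fun s'' _ ⟨h4, h5⟩ => ?_
    unfold HoldsItem at *
    simp only [write_apply_ne _ _ _ (show 1 ≠ 23 by decide)]
    refine ⟨?_, ?_, ?_, ?_, fun i' hi' => ?_⟩
    · rw [h5 _ (by omega), h0]
    · rw [h5 _ (by omega), h1]
    · rw [h5 _ (by omega), h2]
    · rw [h5 _ (by omega), h3]
    · obtain hi' | rfl : i' < i ∨ i' = i := by omega
      · rw [h5 _ (by omega), h5 _ (by omega), h5 _ (by omega), h5 _ (by omega), h5 _ (by omega)]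
        exact hI i' hi'
      · exact h4

include hA hD hfit in
theorem wp_solve (h : A.Holds D s) :
    WP N B Program.solve s fun s' => ∃ b r κ, A.IsBest b r κ ∧
      s' 1 0 = A.total b r κ ∧ s' 1 1 = D * b ∧ s' 1 2 = r ∧ s' 1 3 = b ∧
      ∀ i < A.n, HoldsItem b r κ i s' := by
  simp only [Program.solve, wp_block_cons, wp_block_singleton]
  refine (wp_search hA hD hfit h).imp fun s₁ hf₁ ⟨best, b, r, h37, h38, h39, hbest, hle⟩ => ?_
  have h₁ : A.Holds D s₁ := h.of_agree fun x hx => hf₁ x (by revert x; decide)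
  obtain ⟨-, -, hno⟩ | ⟨hb1, hbn, hrb, κ₀, hκ₀⟩ := hbest
  -- The threshold `0 / 1` has been visited, so the initial pair cannot have survived.
  · exact absurd ⟨le_rfl, by omega, zero_le_one⟩ (hno 1 0)
  have e39 : write s₁ 20 0 (b : ℤ) 39 0 = r := by rw [write_apply_ne _ _ _ (by decide), h39]
  simp only [wp_set, Expr.eval_var, h38, e39]
  refine ⟨hfit.bits_small hA hD (by omega), hfit.bits_small hA hD (by omega), ?_⟩
  have h₂ : A.HoldsThreshold D b r (write (write s₁ 20 0 b) 21 0 r) := by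
    refine ⟨h₁.of_agree fun x hx => ?_, by simp [write], by simp [write], hbn, hrb⟩
    rw [write_apply_ne _ _ _ (by revert x; decide), write_apply_ne _ _ _ (by revert x; decide)]
  refine (wp_solveThreshold hA hD hfit h₂).imp fun s₃ hf₃ ⟨κ, v, h33, h34, hv0, hvle, hopt⟩ => ?_
  have h₃ : A.HoldsThreshold D b r s₃ := h₂.of_agree fun x hx => hf₃ x (by revert x; decide)
  refine (wp_output hA hD hfit h₃ hopt.isChoice.1 h33 h34 (hfit.numbers v hv0 hvle)).imp
    fun s₄ _ ⟨h5, h6, h7, h8, h9⟩ => ?_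
  refine ⟨b, r, κ, ⟨hb1, hbn, hrb, hopt.isChoice, fun b' r' κ' h1 h2 h3 h4 => ?_⟩,
    by rw [h5, hopt.value], h6, h7, h8, h9⟩
  -- The second run may return other choices than the `κ₀` of the search, but their cost is no
  -- larger, which suffices.
  refine le_trans ?_ (hle b' r' ⟨h1, h2, h3⟩ h1 κ' h4)
  rw [hopt.value]
  exact mul_le_mul_of_nonneg_right
    ((hopt.optimal κ₀ hκ₀.isChoice).trans hκ₀.value.le) (Int.natCast_nonneg _)

end Data

end MultiRepSel

namespace MultiRepSel

open Finset RAM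

/-! ### Multiplication of all costs with the product of all denominators

Banks: `4` and `5` numerators and denominators, `8`, `9` and `10` loop counters, `11` product. -/

namespace Program

open RAM.Expr (var load)

/-- Copies the `g`-th block of costs. -/
def copyBlock (g : ℕ) : Cmd :=
  .forLoop 8 (var 2) (.block [
    .store 4 (.const g * var 2 + var 8) (load 0 (4 + var 2 + var 3 + .const (2 * g) * var 2 + var 8)),
    .store 5 (.const g * var 2 + var 8)
      (load 0 (4 + var 2 + var 3 + .const (2 * g + 1) * var 2 + var 8))])

/-- Multiplying a numerator by all denominators except its own avoids division. The squared
difference of the two counters is positive exactly when they differ. -/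
def scaleCost : Cmd :=
  .block [.set 11 (load 4 (var 9)),
    .forLoop 10 (3 * var 2 + 1) (.ite ((var 9 - var 10) * (var 9 - var 10))
      (.set 11 (var 11 * load 5 (var 10))) .skip),
    .store 6 (var 9) (var 11)]

def commonDenominator : Cmd :=
  .seq (.set 7 1) (.forLoop 10 (3 * var 2 + 1) (.set 7 (var 7 * load 5 (var 10))))

def sumCosts : Cmd :=
  .seq (.set 18 0) (.forLoop 9 (var 2) (.set 18
    (var 18 + (load 6 (var 9) + load 6 (var 2 + var 9) + load 6 (2 * var 2 + var 9)))))

def prepare : Cmd :=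
  .block [.set 2 (load 0 0), .set 3 (load 0 1),
    .store 4 (3 * var 2) (load 0 2), .store 5 (3 * var 2) (load 0 3),
    copyBlock 0, copyBlock 1, copyBlock 2,
    .forLoop 9 (3 * var 2 + 1) scaleCost, commonDenominator, sumCosts,
    .set 19 ((var 2 + 2) * (var 2 + 2))]

end Program

/-- An instance with costs as fractions: the blocks of the numerators `num` and of the denominators
`den` contain first-stage costs, lower second-stage costs, deviations, and the budget. -/
structure RawData where
  n : ℕ
  m : ℕ
  part : ℕ → ℕ
  p : ℕ → ℕ
  num : ℕ → ℤ
  den : ℕ → ℤ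

namespace RawData

variable (R : RawData)

/-- The numerator of the `k`-th cost, multiplied by those of the first `t` denominators that belong
to other costs. -/
def scaled (t k : ℕ) : ℤ := R.num k * ∏ l ∈ range t, if l = k then 1 else R.den l

/-- Product of all denominators. -/
def commonDen : ℤ := ∏ l ∈ range (3 * R.n + 1), R.den l

/-- The costs multiplied by the product of all denominators. -/
def toData : Data where
  n := R.n
  m := R.m
  part := R.part
  p := R.p
  C i := R.scaled (3 * R.n + 1) i
  c i := R.scaled (3 * R.n + 1) (R.n + i)
  d i := R.scaled (3 * R.n + 1) (2 * R.n + i)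
  Γ := R.scaled (3 * R.n + 1) (3 * R.n)

/-- The input in bank `0`. -/
structure IsInput (s : Memory) : Prop where
  n_eq : s 0 0 = R.n
  m_eq : s 0 1 = R.m
  num_eq : s 0 2 = R.num (3 * R.n)
  den_eq : s 0 3 = R.den (3 * R.n)
  part_eq : ∀ i < R.n, s 0 (4 + i) = R.part i
  p_eq : ∀ j < R.m, s 0 (4 + R.n + j) = R.p j
  num_block_eq : ∀ g : ℕ, g < 3 → ∀ i < R.n,
    s 0 (4 + R.n + R.m + (2 * g) * R.n + i) = R.num (g * R.n + i)
  den_block_eq : ∀ g : ℕ, g < 3 → ∀ i < R.n,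
    s 0 (4 + R.n + R.m + (2 * g + 1) * R.n + i) = R.den (g * R.n + i)

variable {R} {N B : ℕ} {s : Memory} (hnum : ∀ k, 0 ≤ R.num k) (hden : ∀ k, 0 < R.den k)
  (hfit : R.toData.Fits R.commonDen N B)

theorem scaled_succ (t k : ℕ) :
    R.scaled (t + 1) k = R.scaled t k * if t = k then 1 else R.den t := by
  rw [scaled, scaled, prod_range_succ, mul_assoc]

theorem scaled_mul_den {t k : ℕ} (hk : k < t) :
    R.scaled t k * R.den k = R.num k * ∏ l ∈ range t, R.den l := by
  rw [scaled, mul_assoc]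
  congr 1
  rw [← mul_prod_erase _ _ (mem_range.2 hk), ← mul_prod_erase (range t) R.den (mem_range.2 hk),
    if_pos rfl, one_mul, mul_comm]
  congr 1
  exact prod_congr rfl fun l hl => if_neg (ne_of_mem_erase hl)

include hnum hden in
theorem scaled_nonneg (t k : ℕ) : 0 ≤ R.scaled t k :=
  mul_nonneg (hnum k) (prod_nonneg fun l _ => by split_ifs <;> [norm_num; exact (hden l).le])

include hnum hden in
-- All factors are at least one, so the final product bounds every intermediate result of the
-- scaling loop.
theorem scaled_mono (k : ℕ) : Monotone fun t => R.scaled t k := by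
  refine monotone_nat_of_le_succ fun t => ?_
  simp only [scaled_succ]
  refine le_mul_of_one_le_right (scaled_nonneg hnum hden t k) ?_
  split_ifs
  · norm_num
  · have := hden t; omega

include hnum hden in
-- Each scaled cost is a summand of `costSum` or is the scaled budget, and all of them are
-- non-negative. The single bound in `Fits` thus controls every cost.
theorem scaled_le {k : ℕ} (hk : k < 3 * R.n + 1) :
    R.scaled (3 * R.n + 1) k ≤ R.toData.costSum + R.toData.Γ := by
  have h0 := scaled_nonneg hnum hden (3 * R.n + 1)
  have hs : ∀ i ∈ range R.n, 0 ≤ R.scaled (3 * R.n + 1) i + R.scaled (3 * R.n + 1) (R.n + i) +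
      R.scaled (3 * R.n + 1) (2 * R.n + i) := fun i _ =>
    add_nonneg (add_nonneg (h0 _) (h0 _)) (h0 _)
  have key (i : ℕ) (hi : i < R.n) : R.scaled (3 * R.n + 1) i + R.scaled (3 * R.n + 1) (R.n + i) +
      R.scaled (3 * R.n + 1) (2 * R.n + i) ≤ R.toData.costSum :=
    single_le_sum (f := fun i => R.scaled (3 * R.n + 1) i + R.scaled (3 * R.n + 1) (R.n + i) +
      R.scaled (3 * R.n + 1) (2 * R.n + i)) hs (mem_range.2 hi)
  have hΓ : R.toData.Γ = R.scaled (3 * R.n + 1) (3 * R.n) := rfl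
  have hΓ0 := h0 (3 * R.n)
  by_cases h1 : k < R.n
  · have := key k h1
    have := h0 k
    have := h0 (R.n + k)
    have := h0 (2 * R.n + k)
    linarith
  by_cases h2 : k < 2 * R.n
  · obtain ⟨i, rfl⟩ := Nat.exists_eq_add_of_le (not_lt.1 h1)
    have := key i (by omega)
    have := h0 i
    have := h0 (R.n + i)
    have := h0 (2 * R.n + i)
    linarith
  by_cases h3 : k < 3 * R.n
  · obtain ⟨i, rfl⟩ := Nat.exists_eq_add_of_le (not_lt.1 h2)
    have := key i (by omega)
    have := h0 i
    have := h0 (R.n + i)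
    have := h0 (2 * R.n + i)
    linarith
  · obtain rfl : k = 3 * R.n := by omega
    have : 0 ≤ R.toData.costSum := sum_nonneg hs
    linarith

include hden in
theorem commonDen_pos : 0 < R.commonDen := prod_pos fun l _ => hden l

include hden in
theorem prod_den_le {t : ℕ} (ht : t ≤ 3 * R.n + 1) : ∏ l ∈ range t, R.den l ≤ R.commonDen := by
  have : Monotone fun t => ∏ l ∈ range t, R.den l := by
    refine monotone_nat_of_le_succ fun t => ?_
    simp only [prod_range_succ]
    exact le_mul_of_one_le_right (prod_nonneg fun l _ => (hden l).le) (hden t)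
  exact this ht

include hden in
theorem den_le {k : ℕ} (hk : k < 3 * R.n + 1) : R.den k ≤ R.commonDen := by
  rw [commonDen, ← mul_prod_erase _ _ (mem_range.2 hk)]
  exact le_mul_of_one_le_right (hden k).le (prod_pos fun l _ => hden l)

section

include hfit in
theorem bits_small {k : ℕ} (hnn : 0 ≤ R.toData.costSum + R.toData.Γ) (hD : 0 < R.commonDen)
    (hk : k ≤ (R.n + R.m + 3) ^ 2) : bits (k : ℤ) ≤ B := by
  refine hfit.numbers k (by positivity) ?_
  have h1 : (k : ℤ) ≤ (R.n + R.m + 3) ^ 2 := by exact_mod_cast hk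
  refine h1.trans (le_mul_of_one_le_right (by positivity) (by linarith))

include hfit in
theorem bits_of_le (hD : 0 < R.commonDen) {z : ℤ} (h0 : 0 ≤ z)
    (hnn : 0 ≤ R.toData.costSum + R.toData.Γ)
    (hz : z ≤ R.toData.costSum + R.toData.Γ + R.commonDen) : bits z ≤ B := by
  refine hfit.numbers z h0 (hz.trans ?_)
  have : (1 : ℤ) ≤ (R.toData.n + R.toData.m + 3) ^ 2 := by
    exact_mod_cast Nat.one_le_pow 2 (R.toData.n + R.toData.m + 3) (by omega)
  nlinarith

end

/-- The memory contains the dimensions, and the fractions with indices below `t`, and the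
budget. -/
structure Copied (R : RawData) (t : ℕ) (s : Memory) : Prop extends R.IsInput s where
  n_copied : s 2 0 = R.n
  m_copied : s 3 0 = R.m
  num_copied : ∀ k < 3 * R.n + 1, k < t ∨ k = 3 * R.n → s 4 k = R.num k
  den_copied : ∀ k < 3 * R.n + 1, k < t ∨ k = 3 * R.n → s 5 k = R.den k

theorem IsInput.congr {s s' : Memory} (h : R.IsInput s) (hs : s' 0 = s 0) : R.IsInput s' := by
  obtain ⟨⟩ := h
  constructor <;> simpa only [hs]

theorem Copied.of_agree {t : ℕ} {s s' : Memory} (h : R.Copied t s)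
    (hs : ∀ b ∈ [0, 2, 3, 4, 5], s' b = s b) : R.Copied t s' := by
  refine ⟨h.toIsInput.congr (hs 0 (by simp)), ?_, ?_, ?_, ?_⟩
  · rw [hs 2 (by simp), h.n_copied]
  · rw [hs 3 (by simp), h.m_copied]
  · rw [hs 4 (by simp)]; exact h.num_copied
  · rw [hs 5 (by simp)]; exact h.den_copied

include hnum hden in
theorem costSum_add_nonneg : 0 ≤ R.toData.costSum + R.toData.Γ :=
  (scaled_nonneg hnum hden _ 0).trans (scaled_le hnum hden (Nat.succ_pos _))

include hnum hden hfit in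
theorem bits_scaled {t k : ℕ} (ht : t ≤ 3 * R.n + 1) (hk : k < 3 * R.n + 1) :
    bits (R.scaled t k) ≤ B := by
  have hD := commonDen_pos hden
  refine bits_of_le hfit hD (scaled_nonneg hnum hden t k) (costSum_add_nonneg hnum hden) ?_
  have h1 := scaled_mono hnum hden k ht
  have h2 := scaled_le hnum hden hk
  simp only at h1
  linarith

include hnum hden hfit in
theorem bits_num {k : ℕ} (hk : k < 3 * R.n + 1) : bits (R.num k) ≤ B := by
  simpa [scaled] using bits_scaled hnum hden hfit (Nat.zero_le _) hk

include hnum hden hfit in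
theorem bits_den {k : ℕ} (hk : k < 3 * R.n + 1) : bits (R.den k) ≤ B := by
  have h1 := costSum_add_nonneg hnum hden
  have h2 := den_le hden hk
  exact bits_of_le hfit (commonDen_pos hden) (hden k).le h1 (by linarith)

include hnum hden hfit in
theorem bits_index {k : ℕ} (hk : k ≤ 3 * (R.n + R.m + 3)) : bits (k : ℤ) ≤ B := by
  refine bits_small hfit (costSum_add_nonneg hnum hden) (commonDen_pos hden) (hk.trans ?_)
  rw [sq]
  exact Nat.mul_le_mul_right _ (by omega)

include hfit in
theorem loops_le {k : ℕ} (hk : k ≤ 3 * (R.n + R.m + 3)) : k ≤ N := by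
  refine le_trans (hk.trans ?_) hfit.loops
  rw [sq]
  exact Nat.mul_le_mul_right _ (show 3 ≤ R.n + R.m + 3 by omega)

include hnum hden hfit in
-- Blocks of numerators and of denominators alternate in the input, hence the offsets `2 * g` and `2
-- * g + 1`. The budget sits at index `3 * n` from the beginning, so the invariant carries it along
-- with the copied prefix.
theorem wp_copyBlock {g : ℕ} (hg : g < 3) (h : R.Copied (g * R.n) s) :
    WP N B (Program.copyBlock g) s (R.Copied ((g + 1) * R.n)) := by
  have hne : ∀ x ≠ 8, ∀ a v, write s 8 a v x = s x := fun x hx a v => write_apply_ne _ _ _ hx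
  refine wp_forLoop (fun i s' => (∀ k < 3 * R.n + 1, k < g * R.n + i ∨ k = 3 * R.n →
      s' 4 k = R.num k) ∧ ∀ k < 3 * R.n + 1, k < g * R.n + i ∨ k = 3 * R.n → s' 5 k = R.den k)
    R.n (loops_le hfit (by omega)) (bits_index hnum hden hfit (by omega)) ?_ ?_ ?_ ?_ ?_
  · simp [Cmd.writes, Cmd.block]
  · intro s' hf
    rw [Expr.eval_var, hf 2 (by simp [Cmd.forLoop, Cmd.set, Cmd.writes, Cmd.block]), h.n_copied]
  · simpa only [hne 4 (by decide), hne 5 (by decide), add_zero] using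
      ⟨h.num_copied, h.den_copied⟩
  · rintro i hi s' hf h8 ⟨h4, h5⟩
    have f (x : ℕ) (hx : x ∉ [4, 5, 8]) : s' x = s x :=
      hf x (by simp [Cmd.forLoop, Cmd.set, Cmd.writes, Cmd.block] at hx ⊢; tauto)
    have hk : g * R.n + i < 3 * R.n := by
      have : (g + 1) * R.n ≤ 3 * R.n := Nat.mul_le_mul_right _ hg
      rw [add_mul] at this
      omega
    have e4 : s' 0 (4 + R.n + R.m + 2 * g * R.n + i) = R.num (g * R.n + i) := by
      rw [f 0 (by decide)]; exact h.num_block_eq g hg i hi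
    have e5 : s' 0 (4 + R.n + R.m + (2 * g + 1) * R.n + i) = R.den (g * R.n + i) := by
      rw [f 0 (by decide)]; exact h.den_block_eq g hg i hi
    have h2 : s' 2 0 = R.n := by rw [f 2 (by decide), h.n_copied]
    have h3 : s' 3 0 = R.m := by rw [f 3 (by decide), h.m_copied]
    have bn := bits_num hnum hden hfit (k := g * R.n + i) (by omega)
    have bd := bits_den hnum hden hfit (k := g * R.n + i) (by omega)
    suffices (∀ k < 3 * R.n + 1, k < g * R.n + (i + 1) ∨ k = 3 * R.n →
        (if (k : ℤ) = g * R.n + i then R.num (g * R.n + i) else s' 4 k) = R.num k) ∧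
        (∀ k < 3 * R.n + 1, k < g * R.n + (i + 1) ∨ k = 3 * R.n →
        (if (k : ℤ) = g * R.n + i then R.den (g * R.n + i) else s' 5 k) = R.den k) by
      simpa [write, Expr.eval, h2, h3, h8, e4, e5, bn, bd] using this
    have hcast (k : ℕ) : (k : ℤ) = g * R.n + i ↔ k = g * R.n + i := by
      rw [← Nat.cast_mul, ← Nat.cast_add, Nat.cast_inj]
    simp only [hcast]
    refine ⟨fun k hk hk' => ?_, fun k hk hk' => ?_⟩
    · split_ifs with he
      · rw [he]
      · exact h4 k hk (by omega)
    · split_ifs with he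
      · rw [he]
      · exact h5 k hk (by omega)
  · rintro s' hf - ⟨h4, h5⟩
    have f (x : ℕ) (hx : x ∉ [4, 5, 8]) : s' x = s x :=
      hf x (by simp [Cmd.forLoop, Cmd.set, Cmd.writes, Cmd.block] at hx ⊢; tauto)
    refine ⟨h.toIsInput.congr (f 0 (by decide)), by rw [f 2 (by decide), h.n_copied],
      by rw [f 3 (by decide), h.m_copied], ?_, ?_⟩
    · rw [add_mul, one_mul]; exact h4
    · rw [add_mul, one_mul]; exact h5

include hnum hden hfit in
theorem wp_scaleCost (h : R.Copied (3 * R.n) s) {k : ℕ} (hk : k < 3 * R.n + 1)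
    (h9 : s 9 0 = k) :
    WP N B Program.scaleCost s fun s' => ∀ a : ℤ,
      s' 6 a = if a = k then R.scaled (3 * R.n + 1) k else s 6 a := by
  have e4 : (Expr.load 4 (.var 9)).eval s = R.num k := by
    simp [h9, h.num_copied k hk (by omega)]
  simp only [Program.scaleCost, wp_block_cons, wp_block_singleton]
  rw [wp_set, e4]
  refine ⟨bits_num hnum hden hfit hk, ?_⟩
  have hne : ∀ x ≠ 11, ∀ v, write s 11 0 v x = s x := fun x hx v => write_apply_ne _ _ _ hx
  refine wp_forLoop (fun t s' => s' 11 0 = R.scaled t k) (3 * R.n + 1) (loops_le hfit (by omega))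
    (bits_index hnum hden hfit (by omega)) (by decide) ?_ ?_ ?_ ?_
  · intro s' hf
    simp [hf 2 (by decide), hne 2 (by decide), h.n_copied]
  · simp [write, scaled]
  · intro l hl s' hf h10 hI
    have f (x : ℕ) (hx : x ∉ [10, 11]) : s' x = s x := by
      rw [hf x (by
        simp only [Cmd.forLoop, Cmd.set, Cmd.writes]; simp at hx ⊢; tauto), hne x (by
        rintro rfl; simp at hx)]
    have h9' : s' 9 0 = k := by rw [f 9 (by decide), h9]
    have e5 : s' 5 l = R.den l := by rw [f 5 (by decide), h.den_copied l hl (by omega)]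
    have hb := bits_scaled hnum hden hfit (t := l + 1) (by omega) hk
    rw [scaled_succ] at hb
    have hpos : 0 < ((k : ℤ) - l) * (k - l) ↔ l ≠ k := by
      rw [mul_self_pos, sub_ne_zero, Ne, Nat.cast_inj, eq_comm]
    simp only [wp_ite, Expr.eval_mul, Expr.eval_sub, Expr.eval_var, h9', h10, hpos, wp_set,
      Expr.eval_load, hI, e5, wp_skip, scaled_succ]
    by_cases hlk : l = k
    · simp [hlk, write, hI]
    · simp only [hlk, if_false, ne_eq, not_false_eq_true, if_true] at hb ⊢
      exact ⟨hb, by simp [write]⟩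
  · intro s' hf _ hI
    have f (x : ℕ) (hx : x ∉ [10, 11]) : s' x = s x := by
      rw [hf x (by
        simp only [Cmd.forLoop, Cmd.set, Cmd.writes]; simp at hx ⊢; tauto), hne x (by
        rintro rfl; simp at hx)]
    have h9' : s' 9 0 = k := by rw [f 9 (by decide), h9]
    simp only [wp_store, Expr.eval_var, hI, h9']
    refine ⟨bits_scaled hnum hden hfit le_rfl hk, fun a => ?_⟩
    simp [write, f 6 (by decide)]

include hnum hden hfit in
theorem wp_commonDenominator (h : R.Copied (3 * R.n) s) :
    WP N B Program.commonDenominator s fun s' => s' 7 0 = R.commonDen := by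
  rw [Program.commonDenominator, wp_seq, wp_set]
  have hne : ∀ x ≠ 7, ∀ v, write s 7 0 v x = s x := fun x hx v => write_apply_ne _ _ _ hx
  have b1 := bits_index hnum hden hfit (k := 1) (by omega)
  refine ⟨by simpa using b1, ?_⟩
  refine wp_forLoop (fun t s' => s' 7 0 = ∏ l ∈ range t, R.den l) (3 * R.n + 1)
    (loops_le hfit (by omega)) (bits_index hnum hden hfit (by omega)) (by decide) ?_ ?_ ?_
    fun s' _ _ hI => hI
  · intro s' hf
    simp [hf 2 (by decide), hne 2 (by decide), h.n_copied]
  · simp [write]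
  · intro l hl s' hf h10 hI
    have e5 : s' 5 l = R.den l := by
      rw [hf 5 (by decide), hne 5 (by decide), h.den_copied l hl (by omega)]
    simp only [wp_set, Expr.eval_mul, Expr.eval_var, Expr.eval_load, h10, hI, e5,
      ← prod_range_succ]
    have h1 := costSum_add_nonneg hnum hden
    have h2 := prod_den_le hden (t := l + 1) hl
    exact ⟨bits_of_le hfit (commonDen_pos hden) (prod_nonneg fun l _ => (hden l).le) h1
      (by linarith), by simp [write]⟩

include hnum hden hfit in
theorem wp_sumCosts (h2 : s 2 0 = R.n)
    (h6 : ∀ k < 3 * R.n + 1, s 6 (k : ℕ) = R.scaled (3 * R.n + 1) k) :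
    WP N B Program.sumCosts s fun s' => s' 18 0 = R.toData.costSum := by
  rw [Program.sumCosts, wp_seq, wp_set]
  have hne : ∀ x ≠ 18, ∀ v, write s 18 0 v x = s x := fun x hx v => write_apply_ne _ _ _ hx
  have b0 := bits_index hnum hden hfit (k := 0) (by omega)
  refine ⟨by simpa using b0, ?_⟩
  have hnn := scaled_nonneg hnum hden (3 * R.n + 1)
  have hterm (i : ℕ) : 0 ≤ R.toData.C i + R.toData.c i + R.toData.d i :=
    add_nonneg (add_nonneg (hnn _) (hnn _)) (hnn _)
  refine wp_forLoop (fun t s' => s' 18 0 = ∑ i ∈ range t,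
    (R.toData.C i + R.toData.c i + R.toData.d i)) R.n
    (loops_le hfit (by omega)) (bits_index hnum hden hfit (by omega)) (by decide) ?_ ?_ ?_
    fun s' _ _ hI => hI
  · intro s' hf
    simp [hf 2 (by decide), hne 2 (by decide), h2]
  · simp [write]
  · intro i hi s' hf h9 hI
    have f6 : s' 6 = s 6 := by rw [hf 6 (by decide), hne 6 (by decide)]
    have f2 : s' 2 0 = R.n := by rw [hf 2 (by decide), hne 2 (by decide), h2]
    have e1 : s 6 (i : ℤ) = R.toData.C i := h6 i (by omega)
    have e2 : s 6 ((R.n : ℤ) + i) = R.toData.c i := by exact_mod_cast h6 (R.n + i) (by omega)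
    have e3 : s 6 (2 * (R.n : ℤ) + i) = R.toData.d i := by
      exact_mod_cast h6 (2 * R.n + i) (by omega)
    simp only [wp_set, Expr.eval_add, Expr.eval_mul, Expr.eval_ofNat, Expr.eval_var,
      Expr.eval_load, h9, hI, f6, f2, e1, e2, e3, ← sum_range_succ]
    refine ⟨bits_of_le hfit (commonDen_pos hden) (sum_nonneg fun i _ => hterm i)
      (costSum_add_nonneg hnum hden) ?_, by simp [write]⟩
    have h1 : ∑ i ∈ range (i + 1), (R.toData.C i + R.toData.c i + R.toData.d i) ≤
        R.toData.costSum :=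
      sum_le_sum_of_subset_of_nonneg (range_subset_range.2 hi) fun i _ _ => hterm i
    have h2 : 0 ≤ R.toData.Γ := hnn _
    have h3 := commonDen_pos hden
    linarith

include hnum hden hfit in
theorem wp_prepare (h : R.IsInput s) :
    WP N B Program.prepare s (R.toData.Holds R.commonDen) := by
  simp only [Program.prepare, wp_block_cons, wp_block_singleton]
  have bn := bits_index hnum hden hfit (k := R.n) (by omega)
  have bm := bits_index hnum hden hfit (k := R.m) (by omega)
  have b3 := bits_num hnum hden hfit (k := 3 * R.n) (by omega)
  have b3' := bits_den hnum hden hfit (k := 3 * R.n) (by omega)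
  set s₁ := write (write (write (write s 2 0 R.n) 3 0 R.m) 4 (3 * R.n) (R.num (3 * R.n)))
    5 (3 * R.n) (R.den (3 * R.n)) with hs₁
  have hc : R.Copied (0 * R.n) s₁ := by
    refine ⟨h.congr (by simp [hs₁, write_apply_ne]), by simp [hs₁, write], by simp [hs₁, write],
      fun k _ hk => ?_, fun k _ hk => ?_⟩
    all_goals
      obtain rfl : k = 3 * R.n := by omega
      simp [hs₁, write]
  suffices WP N B (Program.copyBlock 0) s₁ fun r => WP N B (Program.copyBlock 1) r fun r =>
      WP N B (Program.copyBlock 2) r fun r =>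
      WP N B (.forLoop 9 (3 * .var 2 + 1) Program.scaleCost) r fun r =>
      WP N B Program.commonDenominator r fun r => WP N B Program.sumCosts r fun r =>
      WP N B (.set 19 ((.var 2 + 2) * (.var 2 + 2))) r (R.toData.Holds R.commonDen) by
    simpa only [wp_set, wp_store, Expr.eval_load, Expr.eval_zero, Expr.eval_one, Expr.eval_ofNat,
      Expr.eval_mul, Expr.eval_var, h.n_eq, h.m_eq, h.num_eq, h.den_eq, write_same,
      write_apply_ne _ _ _ (show 0 ≠ 2 by decide), write_apply_ne _ _ _ (show 0 ≠ 3 by decide),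
      write_apply_ne _ _ _ (show 2 ≠ 3 by decide), write_apply_ne _ _ _ (show 0 ≠ 4 by decide),
      write_apply_ne _ _ _ (show 2 ≠ 4 by decide), bn, bm, b3, b3', true_and] using this
  refine (wp_copyBlock hnum hden hfit (by omega) hc).imp fun s₂ _ hc => ?_
  refine (wp_copyBlock hnum hden hfit (g := 1) (by omega) hc).imp fun s₃ _ hc => ?_
  refine (wp_copyBlock hnum hden hfit (g := 2) (by omega) hc).imp fun s₄ _ hc => ?_
  have hc : R.Copied (3 * R.n) s₄ := hc
  have hscale : WP N B (.forLoop 9 (3 * .var 2 + 1) Program.scaleCost) s₄ fun s' =>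
      ∀ k < 3 * R.n + 1, s' 6 (k : ℕ) = R.scaled (3 * R.n + 1) k := by
    refine wp_forLoop (fun t s' => ∀ k < t, s' 6 (k : ℕ) = R.scaled (3 * R.n + 1) k) (3 * R.n + 1)
      (loops_le hfit (by omega)) (bits_index hnum hden hfit (by omega)) (by decide) ?_ (by simp) ?_
      fun s' _ _ hI => hI
    · intro s' hf
      simp [hf 2 (by decide), hc.n_copied]
    · intro k hk s' hf h9 hI
      have hc' : R.Copied (3 * R.n) s' := hc.of_agree fun x hx => hf x (by revert x; decide)
      refine (wp_scaleCost hnum hden hfit hc' hk h9).imp fun s'' _ h6 k' hk' => ?_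
      rw [write_apply_ne _ _ _ (by decide), h6]
      split_ifs with he
      · rw [Nat.cast_inj.1 he]
      · exact hI k' (by omega)
  refine hscale.imp fun s₅ hf₅ h6 => ?_
  have hc : R.Copied (3 * R.n) s₅ := hc.of_agree fun x hx => hf₅ x (by revert x; decide)
  refine (wp_commonDenominator hnum hden hfit hc).imp fun s₆ hf₆ h7 => ?_
  have hc : R.Copied (3 * R.n) s₆ := hc.of_agree fun x hx => hf₆ x (by revert x; decide)
  rw [← hf₆ 6 (by decide)] at h6
  refine (wp_sumCosts hnum hden hfit hc.n_copied h6).imp fun s₇ hf₇ h18 => ?_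
  have hc : R.Copied (3 * R.n) s₇ := hc.of_agree fun x hx => hf₇ x (by revert x; decide)
  rw [← hf₇ 6 (by decide)] at h6
  rw [← hf₇ 7 (by decide)] at h7
  have e : ((Expr.var 2 + 2) * (Expr.var 2 + 2)).eval s₇ = (R.toData.width : ℕ) := by
    simp [hc.n_copied, Data.width, toData]
  rw [wp_set, e]
  refine ⟨bits_small hfit (costSum_add_nonneg hnum hden) (commonDen_pos hden)
    R.toData.width_le, ?_⟩
  constructor <;> simp only [write_same, write_apply_ne _ _ _ (show 2 ≠ 19 by decide),
    write_apply_ne _ _ _ (show 3 ≠ 19 by decide), write_apply_ne _ _ _ (show 0 ≠ 19 by decide),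
    write_apply_ne _ _ _ (show 6 ≠ 19 by decide), write_apply_ne _ _ _ (show 7 ≠ 19 by decide),
    write_apply_ne _ _ _ (show 18 ≠ 19 by decide)]
  · exact hc.n_copied
  · exact hc.m_copied
  · exact hc.part_eq
  · exact hc.p_eq
  · exact fun i (hi : i < R.n) => h6 i (by omega)
  · exact fun i (hi : i < R.n) => by exact_mod_cast h6 (R.n + i) (by omega)
  · exact fun i (hi : i < R.n) => by exact_mod_cast h6 (2 * R.n + i) (by omega)
  · exact_mod_cast h6 (3 * R.n) (by omega)
  · exact h7
  · exact h18

end RawData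

end MultiRepSel

/-! ### Reading the input word and bounding numbers by its length -/

namespace MultiRepSel

open Finset RAM

namespace Instance

variable (I : Instance)

/-- All costs, in the order of the input, and finally the budget. -/
def costs (k : ℕ) : ℚ :=
  if h : k < I.n then I.C ⟨k, h⟩
  else if h : k - I.n < I.n then I.c ⟨k - I.n, h⟩
  else if h : k - 2 * I.n < I.n then I.d ⟨k - 2 * I.n, h⟩
  else I.Γ

/-- The fractions of the input. -/
def rawData : RawData where
  n := I.n
  m := I.m
  part i := if h : i < I.n then I.part ⟨i, h⟩ else 0
  p j := if h : j < I.m then I.p ⟨j, h⟩ else 0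
  num k := (I.costs k).num
  den k := (I.costs k).den

theorem costs_C (i : Fin I.n) : I.costs i = I.C i := by simp [costs]

theorem costs_c (i : Fin I.n) : I.costs (I.n + i) = I.c i := by simp [costs]

theorem costs_d (i : Fin I.n) : I.costs (2 * I.n + i) = I.d i := by
  have h1 : ¬ 2 * I.n + (i : ℕ) < I.n := by omega
  have h2 : ¬ 2 * I.n + (i : ℕ) - I.n < I.n := by omega
  simp [costs, h1, h2]

theorem costs_Γ : I.costs (3 * I.n) = I.Γ := by
  unfold costs
  split_ifs with h1 h2 h3
  · omega
  · omega
  · omega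
  · rfl

theorem rawData_num_nonneg (k : ℕ) : 0 ≤ I.rawData.num k := by
  refine Rat.num_nonneg.2 ?_
  unfold costs
  split_ifs
  exacts [I.C_nonneg _, I.c_nonneg _, I.d_nonneg _, I.Γ_nonneg]

theorem rawData_den_pos (k : ℕ) : 0 < I.rawData.den k := by
  have : (0 : ℤ) < ((I.costs k).den : ℤ) := by exact_mod_cast (I.costs k).den_pos
  exact this

theorem scaled_eq {k : ℕ} (hk : k < 3 * I.n + 1) :
    (I.rawData.scaled (3 * I.n + 1) k : ℝ) = I.rawData.commonDen * I.costs k := by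
  have h := RawData.scaled_mul_den (R := I.rawData) hk
  have hden : (0 : ℝ) < (I.costs k).den := by exact_mod_cast (I.costs k).den_pos
  have h' : (I.rawData.scaled (3 * I.n + 1) k : ℝ) * (I.costs k).den =
      (I.costs k).num * I.rawData.commonDen := by exact_mod_cast h
  rw [Rat.cast_def (I.costs k), mul_div_assoc', eq_div_iff hden.ne', h', mul_comm]

theorem represents : I.rawData.toData.Represents I I.rawData.commonDen where
  D_pos := RawData.commonDen_pos I.rawData_den_pos
  n_eq := rfl
  m_eq := rfl
  part_eq i := by simp [RawData.toData, rawData]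
  p_eq j := by simp [RawData.toData, rawData]
  C_eq i := by rw [← I.costs_C]; exact I.scaled_eq (by omega)
  c_eq i := by rw [← I.costs_c]; exact I.scaled_eq (k := I.n + i) (by omega)
  d_eq i := by rw [← I.costs_d]; exact I.scaled_eq (k := 2 * I.n + i) (by omega)
  Γ_eq := by rw [← I.costs_Γ]; exact I.scaled_eq (k := 3 * I.n) (by omega)

theorem valid : I.rawData.toData.Valid where
  part_lt i hi := by
    have hi : i < I.n := hi
    simp [RawData.toData, rawData, hi]
  p_le j hj := by
    have hj : j < I.m := hj
    have h := I.p_le ⟨j, hj⟩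
    rw [card_filter] at h ⊢
    simp only [RawData.toData, rawData, sum_range, hj, dite_true, Fin.is_lt, Fin.eta]
    refine h.trans (le_of_eq (sum_congr rfl fun i _ => ?_))
    simp only [Fin.ext_iff]
  C_nonneg i := RawData.scaled_nonneg I.rawData_num_nonneg I.rawData_den_pos _ _
  c_nonneg i := RawData.scaled_nonneg I.rawData_num_nonneg I.rawData_den_pos _ _
  d_nonneg i := RawData.scaled_nonneg I.rawData_num_nonneg I.rawData_den_pos _ _
  Γ_nonneg := RawData.scaled_nonneg I.rawData_num_nonneg I.rawData_den_pos _ _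

theorem getD_block {k : ℕ} (l r : List ℤ) (f : Fin k → ℤ) (i : Fin k) {a : ℕ}
    (ha : a = l.length + i) : (l ++ (List.ofFn f ++ r)).getD a 0 = f i := by
  subst ha
  rw [List.getD_append_right _ _ _ _ (by omega), Nat.add_sub_cancel_left,
    List.getD_append _ _ _ _ (by simp), List.getD_eq_getElem _ _ (by simp), List.getElem_ofFn]

set_option linter.unusedSimpArgs false in
theorem isInput : I.rawData.IsInput (initial I.encode) := by
  have hget (a : ℕ) : initial I.encode 0 a = I.encode.getD a 0 := by simp [initial]
  set l₀ : List ℤ := [(I.n : ℤ), (I.m : ℤ), I.Γ.num, (I.Γ.den : ℤ)] with hl₀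
  set lpart := List.ofFn fun i => ((I.part i : ℕ) : ℤ) with hlpart
  set lp := List.ofFn fun j => (I.p j : ℤ) with hlp
  set lCn := List.ofFn fun i => (I.C i).num with hlCn
  set lCd := List.ofFn fun i => ((I.C i).den : ℤ) with hlCd
  set lcn := List.ofFn fun i => (I.c i).num with hlcn
  set lcd := List.ofFn fun i => ((I.c i).den : ℤ) with hlcd
  set ldn := List.ofFn fun i => (I.d i).num with hldn
  set ldd := List.ofFn fun i => ((I.d i).den : ℤ) with hldd
  have henc : I.encode = l₀ ++ (lpart ++ (lp ++ (lCn ++ (lCd ++ (lcn ++ (lcd ++ (ldn ++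
      (ldd ++ [])))))))) := by
    simp only [encode, List.append_assoc, List.append_nil, hl₀, hlpart, hlp, hlCn, hlCd, hlcn,
      hlcd, hldn, hldd]
  have key {k : ℕ} (l r : List ℤ) (f : Fin k → ℤ) (h : I.encode = l ++ (List.ofFn f ++ r))
      (i : Fin k) {a : ℕ} (ha : a = l.length + i) : initial I.encode 0 a = f i := by
    rw [hget, h, getD_block l r f i ha]
  have len₀ : l₀.length = 4 := rfl
  have lenpart : lpart.length = I.n := List.length_ofFn
  have lenp : lp.length = I.m := List.length_ofFn
  have lenCn : lCn.length = I.n := List.length_ofFn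
  have lenCd : lCd.length = I.n := List.length_ofFn
  have lencn : lcn.length = I.n := List.length_ofFn
  have lencd : lcd.length = I.n := List.length_ofFn
  have lendn : ldn.length = I.n := List.length_ofFn
  constructor
  · exact (hget 0).trans rfl
  · exact (hget 1).trans rfl
  · refine (hget 2).trans ?_
    simp only [rawData, costs_Γ]; rfl
  · refine (hget 3).trans ?_
    simp only [rawData, costs_Γ]; rfl
  · intro i (hi : i < I.n)
    refine Eq.trans (by push_cast; rfl) ((key l₀ _ _ henc ⟨i, hi⟩
      (a := 4 + i) (by rw [len₀])).trans ?_)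
    simp [rawData, hi]
  · intro i (hi : i < I.m)
    refine Eq.trans (by push_cast; rfl) ((key (l₀ ++ lpart) _ _
      (henc.trans (by simp only [List.append_assoc]; rfl)) ⟨i, hi⟩
      (a := 4 + I.n + i) (by simp only [List.length_append, len₀, lenpart])).trans ?_)
    simp [rawData, hi]
  · intro g hg i (hi : i < I.n)
    have hcast : (4 + (I.rawData.n : ℤ) + I.rawData.m + (2 * g) * I.rawData.n + i) =
        ((4 + I.n + I.m + (2 * g) * I.n + i : ℕ) : ℤ) := by push_cast; rfl
    rw [hcast]
    match g, hg with
    | 0, _ =>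
      refine (key (l₀ ++ lpart ++ lp) _ _
        (henc.trans (by simp only [List.append_assoc]; rfl)) ⟨i, hi⟩ ?_).trans ?_
      · simp only [List.length_append, len₀, lenpart, lenp, lenCn, lenCd, lencn, lencd, lendn]
        ring
      · simp only [rawData, zero_mul, one_mul, zero_add, ← I.costs_C]
    | 1, _ =>
      refine (key (l₀ ++ lpart ++ lp ++ lCn ++ lCd) _ _
        (henc.trans (by simp only [List.append_assoc]; rfl)) ⟨i, hi⟩ ?_).trans ?_
      · simp only [List.length_append, len₀, lenpart, lenp, lenCn, lenCd, lencn, lencd, lendn]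
        ring
      · simp only [rawData, zero_mul, one_mul, zero_add, ← I.costs_c]
    | 2, _ =>
      refine (key (l₀ ++ lpart ++ lp ++ lCn ++ lCd ++ lcn ++ lcd) _ _
        (henc.trans (by simp only [List.append_assoc]; rfl)) ⟨i, hi⟩ ?_).trans ?_
      · simp only [List.length_append, len₀, lenpart, lenp, lenCn, lenCd, lencn, lencd, lendn]
        ring
      · simp only [rawData, zero_mul, one_mul, zero_add, ← I.costs_d]
  · intro g hg i (hi : i < I.n)
    have hcast : (4 + (I.rawData.n : ℤ) + I.rawData.m + (2 * g + 1) * I.rawData.n + i) =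
        ((4 + I.n + I.m + (2 * g + 1) * I.n + i : ℕ) : ℤ) := by push_cast; rfl
    rw [hcast]
    match g, hg with
    | 0, _ =>
      refine (key (l₀ ++ lpart ++ lp ++ lCn) _ _
        (henc.trans (by simp only [List.append_assoc]; rfl)) ⟨i, hi⟩ ?_).trans ?_
      · simp only [List.length_append, len₀, lenpart, lenp, lenCn, lenCd, lencn, lencd, lendn]
        ring
      · simp only [rawData, zero_mul, one_mul, zero_add, ← I.costs_C]
    | 1, _ =>
      refine (key (l₀ ++ lpart ++ lp ++ lCn ++ lCd ++ lcn) _ _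
        (henc.trans (by simp only [List.append_assoc]; rfl)) ⟨i, hi⟩ ?_).trans ?_
      · simp only [List.length_append, len₀, lenpart, lenp, lenCn, lenCd, lencn, lencd, lendn]
        ring
      · simp only [rawData, zero_mul, one_mul, zero_add, ← I.costs_c]
    | 2, _ =>
      refine (key (l₀ ++ lpart ++ lp ++ lCn ++ lCd ++ lcn ++ lcd ++ ldn) _ _
        (henc.trans (by simp only [List.append_assoc]; rfl)) ⟨i, hi⟩ ?_).trans ?_
      · simp only [List.length_append, len₀, lenpart, lenp, lenCn, lenCd, lencn, lencd, lendn]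
        ring
      · simp only [rawData, zero_mul, one_mul, zero_add, ← I.costs_d]

/-- Every item and every part contributes an index or a demand of at least one bit, so `n` and `m`
are paid for in addition to the fractions. -/
theorem sum_bits_le : I.n + I.m + ∑ k ∈ range (3 * I.n + 1),
    (bits (I.rawData.num k) + bits (I.rawData.den k)) ≤ inputSize I.encode := by
  have hlist (k : ℕ) (f : Fin k → ℤ) : ((List.ofFn f).map bits).sum = ∑ i, bits (f i) := by
    rw [List.map_ofFn, List.sum_ofFn]; rfl
  have h1 (k : ℕ) (f : Fin k → ℤ) : k ≤ ∑ i, bits (f i) := by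
    simpa using sum_le_sum fun i (_ : i ∈ univ) => one_le_bits (f i)
  have hn := h1 I.n fun i => ((I.part i : ℕ) : ℤ)
  have hm := h1 I.m fun j => (I.p j : ℤ)
  simp only [inputSize, encode, List.map_append, List.sum_append, hlist, List.map_cons,
    List.map_nil, List.sum_cons, List.sum_nil]
  rw [sum_range_succ, show 3 * I.n = I.n + I.n + I.n by ring, sum_range_add, sum_range_add,
    sum_range, sum_range, sum_range, ← two_mul, show 2 * I.n + I.n = 3 * I.n by ring]
  simp only [rawData, costs_C, costs_c, costs_d, costs_Γ, sum_add_distrib]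
  omega

/-- Let `Q` be the product of all `num + 1` and `D` the product of all denominators. Every scaled
cost is at most `Q * D`, and `Q * D ≤ 2 ^ L` because the bit lengths add up to at most `L`. The
numbers to be stored are thus at most `3 * (n + m + 3) ^ 3 * 2 ^ L`. With `n + m + 3 ≤ 2 ^ (L + 3)`
and `3 < 4` this is below `2 ^ (4 * L + 11)`, and one more bit is the sign. -/
theorem fits {L : ℕ} (hL : inputSize I.encode ≤ L) :
    I.rawData.toData.Fits I.rawData.commonDen ((L + 3) ^ 2) (4 * L + 12) := by
  have hsum := I.sum_bits_le
  have hnm : I.n + I.m ≤ L := by omega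
  constructor
  · exact Nat.pow_le_pow_left (show I.n + I.m + 3 ≤ L + 3 by omega) 2
  intro z h0 hz
  set R := I.rawData with hR
  have hnum : ∀ k, 0 ≤ R.num k := I.rawData_num_nonneg
  have hden : ∀ k, 0 < R.den k := I.rawData_den_pos
  have hD := RawData.commonDen_pos hden
  set Q : ℤ := ∏ k ∈ range (3 * I.n + 1), (R.num k + 1) with hQ
  have hQ1 : 1 ≤ Q := by
    have : (0 : ℤ) < Q := prod_pos fun k _ => by have := hnum k; omega
    omega
  have hnumQ (k : ℕ) (hk : k < 3 * I.n + 1) : R.num k ≤ Q := by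
    have h1 : (0 : ℤ) < ∏ k ∈ (range (3 * I.n + 1)).erase k, (R.num k + 1) :=
      prod_pos fun k _ => by have := hnum k; omega
    rw [hQ, ← mul_prod_erase _ _ (mem_range.2 hk)]
    have := hnum k
    nlinarith
  have hscaled (k : ℕ) (hk : k < 3 * I.n + 1) :
      R.scaled (3 * I.n + 1) k ≤ Q * R.commonDen := by
    have h1 := RawData.scaled_mul_den (R := R) hk
    have h2 : R.scaled (3 * I.n + 1) k ≤ R.scaled (3 * I.n + 1) k * R.den k :=
      le_mul_of_one_le_right (RawData.scaled_nonneg hnum hden _ _) (hden k)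
    rw [h1] at h2
    exact h2.trans (mul_le_mul_of_nonneg_right (hnumQ k hk) hD.le)
  have hcost : R.toData.costSum ≤ I.n * (3 * (Q * R.commonDen)) := by
    have : ∀ i ∈ range I.n, R.toData.C i + R.toData.c i + R.toData.d i ≤
        3 * (Q * R.commonDen) := by
      intro i hi
      rw [mem_range] at hi
      have h1 : R.toData.C i ≤ _ := hscaled i (by omega)
      have h2 : R.toData.c i ≤ _ := hscaled (I.n + i) (by omega)
      have h3 : R.toData.d i ≤ _ := hscaled (2 * I.n + i) (by omega)
      linarith
    refine (sum_le_sum this).trans ?_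
    simp
  have hΓ : R.toData.Γ ≤ Q * R.commonDen := hscaled (3 * I.n) (by omega)
  have hDQ : R.commonDen ≤ Q * R.commonDen := le_mul_of_one_le_left hD.le hQ1
  have hall : R.toData.costSum + R.toData.Γ + R.commonDen + 1 ≤
      3 * (I.n + I.m + 3) * (Q * R.commonDen) := by
    have : (0 : ℤ) ≤ I.m * (Q * R.commonDen) := by positivity
    nlinarith
  have hz' : z ≤ 3 * (I.n + I.m + 3) ^ 3 * (Q * R.commonDen) := by
    refine hz.trans ((mul_le_mul_of_nonneg_left hall (by positivity)).trans (le_of_eq ?_))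
    change ((I.n : ℤ) + I.m + 3) ^ 2 * _ = _
    ring
  have hQD : Q * R.commonDen ≤ 2 ^ L := by
    have h1 : Q * R.commonDen ≤ ∏ k ∈ range (3 * I.n + 1),
        (2 : ℤ) ^ (bits (R.num k) + bits (R.den k)) := by
      rw [hQ, RawData.commonDen, show R.n = I.n from rfl, ← prod_mul_distrib]
      refine prod_le_prod (fun k _ => mul_nonneg (by have := hnum k; omega) (hden k).le)
        fun k _ => ?_
      rw [pow_add]
      have h2 : ((R.num k).natAbs : ℤ) + 1 ≤ 2 ^ bits (R.num k) := by
        exact_mod_cast natAbs_succ_le_two_pow_bits (R.num k)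
      have h3 : ((R.den k).natAbs : ℤ) + 1 ≤ 2 ^ bits (R.den k) := by
        exact_mod_cast natAbs_succ_le_two_pow_bits (R.den k)
      rw [Int.natAbs_of_nonneg (hnum k)] at h2
      rw [Int.natAbs_of_nonneg (hden k).le] at h3
      exact mul_le_mul h2 (by linarith) (hden k).le (by positivity)
    rw [prod_pow_eq_pow_sum] at h1
    exact h1.trans (pow_le_pow_right₀ (by norm_num) (by omega))
  have hnm' : (I.n : ℤ) + I.m + 3 ≤ 2 ^ (L + 3) := by
    have : L + 3 < 2 ^ (L + 3) := Nat.lt_two_pow_self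
    have : I.n + I.m + 3 ≤ 2 ^ (L + 3) := by omega
    exact_mod_cast this
  rw [show 4 * L + 12 = (4 * L + 11) + 1 by ring, bits_le_iff]
  have : z < 2 ^ (4 * L + 11) := by
    calc z ≤ 3 * (I.n + I.m + 3) ^ 3 * (Q * R.commonDen) := hz'
      _ ≤ 3 * (2 ^ (L + 3)) ^ 3 * 2 ^ L := by gcongr
      _ < 4 * (2 ^ (L + 3)) ^ 3 * 2 ^ L := by gcongr; norm_num
      _ = 2 ^ (4 * L + 11) := by ring
  zify
  rwa [abs_of_nonneg h0]

end Instance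

theorem bounded_initial (w : List ℤ) {B : ℕ} (hB : inputSize w + 1 ≤ B) :
    Bounded B (initial w) := by
  intro b a
  unfold initial
  split_ifs
  · by_cases ha : a.toNat < w.length
    · rw [List.getD_eq_getElem _ _ ha]
      have : bits w[a.toNat] ≤ inputSize w :=
        List.single_le_sum (by simp) _ (List.mem_map_of_mem (List.getElem_mem ha))
      omega
    · rw [List.getD_eq_default _ _ (by omega)]
      simp [bits]; omega
  · simp [bits]; omega

end MultiRepSel

/-! ### Assembly of the algorithm and its time bound -/

open MultiRepSel RAM in
theorem theorem5 :
    ∃ (prog : RAM.Cmd) (P : Polynomial ℕ), ∀ I : MultiRepSel.Instance,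
      ∃ (s : RAM.Memory) (t : ℕ),
        RAM.Exec prog (RAM.initial I.encode) s t ∧
        t ≤ P.eval (RAM.inputSize I.encode) ∧
        ∃ (x y : Fin I.n → ℝ) (π : ℝ) (ρ : Fin I.n → ℝ) (v : ℝ),
          MultiRepSel.IsOutput s x y π ρ v ∧
          I.IsTwoStageOptimal I.UAC x v ∧
          I.IsMIPOptimal x y π ρ v := by
  -- The iteration and bit-length bounds of `Instance.fits` as polynomials in the input size;
  -- `prog.time N B` is then the required polynomial, the same for all instances.
  let N : Polynomial ℕ := (Polynomial.X + 3) ^ 2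
  let B : Polynomial ℕ := 4 * Polynomial.X + 12
  let prog : Cmd := .seq Program.prepare Program.solve
  refine ⟨prog, prog.time N B, fun I => ?_⟩
  set L := inputSize I.encode with hL
  have hN : N.eval L = (L + 3) ^ 2 := by simp [N]
  have hB : B.eval L = 4 * L + 12 := by simp [B]
  have hfit := I.fits hL.ge
  have hD := RawData.commonDen_pos I.rawData_den_pos
  obtain ⟨s, hrun, b, r, κ, hbest, h0, h1, h2, h3, hitem⟩ :
      WP ((L + 3) ^ 2) (4 * L + 12) prog (initial I.encode) _ :=
    wp_seq.2 ((RawData.wp_prepare I.rawData_num_nonneg I.rawData_den_pos hfit I.isInput).imp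
      fun s' _ h => Data.wp_solve I.valid hD.le hfit h)
  rw [← hN, ← hB] at hrun
  obtain ⟨-, t, ht, hexec⟩ := hrun.exists_exec (by rw [hB]; omega)
    (bounded_initial I.encode (by rw [hB]; omega))
  have hopt := hbest.isMIPOptimal I.represents
  refine ⟨s, t, hexec, ht, _, _, _, _, _, ?_, hopt.isTwoStageOptimal, hopt⟩
  have hb : (0 : ℤ) < b := by exact_mod_cast hbest.one_le
  refine ⟨⟨?_, ?_⟩, ⟨?_, ?_⟩, fun i => ?_, fun i => ⟨?_, ?_⟩, fun i => ⟨?_, ?_⟩⟩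
  · rw [zero_add, h1]; positivity
  · rw [zero_add, h0, h1]
  · rw [show (2 : ℤ) + 1 = 3 from rfl, h3]; exact hb
  · rw [show (2 : ℤ) + 1 = 3 from rfl, h2, h3]; simp
  · rw [(hitem i i.2).1, firstStage]; push_cast; rfl
  · rw [show (5 + 5 * ((i : ℕ) : ℤ)) + 1 = 6 + 5 * i by ring, (hitem i i.2).2.2.1]; exact hb
  · rw [show (5 + 5 * ((i : ℕ) : ℤ)) + 1 = 6 + 5 * i by ring, (hitem i i.2).2.2.1,
      (hitem i i.2).2.1, secondStage]
    simp
  · rw [show (7 + 5 * ((i : ℕ) : ℤ)) + 1 = 8 + 5 * i by ring, (hitem i i.2).2.2.2.2]; exact hb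
  · rw [show (7 + 5 * ((i : ℕ) : ℤ)) + 1 = 8 + 5 * i by ring, (hitem i i.2).2.2.2.2,
      (hitem i i.2).2.2.2.1, excess]
    simp
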